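/- **Theorem (Kinetic Energy Estimate).** Let $d\in\{2,3\}$, $k\ge 0$ an integer and $\rho>0$. *Mesh.* $\mathcal T_h$ is a finite conforming mesh of non-overlapping bounded convex polytopes $K\subset\mathbb R^d$ with nonempty interior (two elements meet in a, possibly empty, common face, so there are no hanging nodes), and $\Omega$ is the interior of $\bigcup K$. Write $h_K=\operatorname{diam}K$, $h_F=\operatorname{diam}F$, $\mathcal F_h$ for the $(d-1)$-dimensional faces, $\mathcal F_h^i$ for those shared by two elements, $\mathcal F_h^\partial$ for the others, $n$ for the outward normal of an element, and $n_F$ for the normal of $F\in\mathcal F_h^i$ pointing from its $+$ side to its $-$ side. On $F\in\mathcal F_h^i$ put $[\![v]\!]=v_+-v_-$, $\{\!\{v\}\!\}=\frac12(v_++v_-)$, $[\![v\otimes n]\!]=v_+\otimes n_++v_-\otimes n_-$; on boundary faces $[\![v]\!]=\{\!\{v\}\!\}=v$, $[\![v\otimes n]\!]=v\otimes n$. Let $(\cdot,\cdot)_{\mathcal T_h}$, $\langle\cdot,\cdot\rangle_{\partial\mathcal T_h}$ and $\langle\cdot,\cdot\rangle_{\mathcal F}$ (for a set $\mathcal F$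 of faces) be the sums over $K$ of the integrals over $K$, over $K$ of those over $\partial K$, and over $F\in\mathcal F$ of those over $F$. Let $\tau(v)=\nabla_h v+\nabla_h v^T-\frac23(\nabla_h\cdot v)\mathbb I$, where $\nabla_h$ acts element by element. The mesh is $\rho$-regular if every $K$ contains a ball of radius $\rho h_K$. *Constants.* A number $C_{tr}>0$ is called a trace constant for $(d,k,\rho)$ if $h_K^{1/2}\|g\|_{L^2(F)}\le C_{tr}\|g\|_{L^2(K)}$ for every convex polytope $K$ (bounded, with nonempty interior) that contains a ball of radius $\rho h_K$, every face $F$ of $K$ and every polynomial $g$ of degree at most $k$. *Method.* $W_h\subset H_0(\mathrm{div};\Omega)$ is a linear space of piecewise polynomial vector fields of degree at most $k$, and $Q_h\subset L^2_*(\Omega)$ a linear space of zero-mean functions, continuous on each closed element. Let $\nu_h\ge0$, $\zeta\ge0$, $\eta\in\mathbb R$, $t_0\le t_n$, $f\in L^1(t_0,t_n;L^2(\Omega))$, and $\theta\in\{0,1\}$. A solution $(p_h,u_h)$ consists of $u_h:[t_0,t_n]\to W_h$, absolutely continuous in time, and $p_h(t)\in Q_h$ for a.e. $t$, such that for a.e.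 $t\in(t_0,t_n)$ and all $(q_h,w_h)\in Q_h\times W_h$ we have $(\nabla\cdot u_h,q_h)_{\mathcal T_h}=0$ and $$\begin{aligned}&(\partial_tu_h,w_h)_{\mathcal T_h}-(u_h\otimes u_h,\nabla_hw_h)_{\mathcal T_h}-(p_h,\nabla\cdot w_h)_{\mathcal T_h}+\langle\hat\sigma_{inv}n,w_h\rangle_{\partial\mathcal T_h}-\tfrac12((\nabla\cdot u_h)u_h,w_h)_{\mathcal T_h}\\&+\nu_h\Big[(\tau(u_h),\nabla_hw_h)_{\mathcal T_h}-\langle\hat\sigma_{vis}n,w_h\rangle_{\partial\mathcal T_h}+\langle\{\!\{u_h\}\!\}-u_h,\tau(w_h)n\rangle_{\partial\mathcal T_h}-\theta\,\langle u_h,\tau(w_h)n\rangle_{\mathcal F_h^\partial}\Big]=(f,w_h)_{\mathcal T_h},\end{aligned}$$ with $\hat\sigma_{inv}=\{\!\{u_h\}\!\}\otimes\{\!\{u_h\}\!\}+\{\!\{p_h\}\!\}\mathbb I+\zeta|u_h\cdot n_F|[\![u_h\otimes n]\!]$ and $\hat\sigma_{vis}=\{\!\{\tau(u_h)\}\!\}-\frac{\eta}{h_F}[\![u_h\otimes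 n]\!]$. (For $\theta=1$ the viscous form is the symmetric one, with a consistent boundary term; for $\theta=0$ that term is absent.) *Norms.* $|w|_\beta^2=\zeta\,\langle|\beta\cdot n_F|\,[\![w]\!],[\![w]\!]\rangle_{\mathcal F_h^i}$ and $|||w|||_{sym}^2=\|\tau(w)\|_{L^2(\Omega)}^2+\langle h_F^{-1}[\![w]\!],[\![w]\!]\rangle_{\mathcal F_h}$. *Conclusion.* Trace constants for $(d,k,\rho)$ exist. Moreover, for every trace constant $C_{tr}$ for $(d,k,\rho)$, every integer $N_\partial\ge0$ and every $\eta>2C_{tr}^2N_\partial$, the number $$C=\frac{\eta-2C_{tr}^2N_\partial}{1+2\eta}$$ is positive, and on every $\rho$-regular mesh whose elements have at most $N_\partial$ faces each, for all $W_h,Q_h,\nu_h,\zeta,\theta,t_0,t_n,f$ as above, every solution $(p_h,u_h)$ satisfies the following: the integrand below is integrable on $(t_0,t_n)$, and $$\tfrac12\|u_h(t_n)\|_{L^2(\Omega)}^2+\int_{t_0}^{t_n}\Big(|u_h(s)|_{u_h(s)}^2+\nu_h\,C\,|||u_h(s)|||_{sym}^2\Big)\,ds\le\|u_h(t_0)\|_{L^2(\Omega)}^2+\tfrac32\Big(\int_{t_0}^{t_n}\|f(s)\|_{L^2(\Omega)}\,ds\Big)^2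 .$$ -/

import Mathlib

open MeasureTheory Set
open scoped RealInnerProductSpace ContDiff

noncomputable section

namespace MixedNS

/-- `ℝ^d` with the Euclidean norm. -/
abbrev Vec (d : ℕ) := EuclideanSpace ℝ (Fin d)

/-! ### Elements -/

/-- A mesh element: a bounded `d`-dimensional convex polytope `{x | n · x ≤ c for all (n, c)}`.
The pairs `(n, c)` (unit outward normal, offset) are in bijection with the flat faces of the
element: by `irredundant` none of the half-spaces can be omitted. -/
structure Cell (d : ℕ) where
  halfspaces : Finset (Vec d × ℝ)
  unit_normal : ∀ p ∈ halfspaces, ‖p.1‖ = 1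
  bounded : Bornology.IsBounded {x : Vec d | ∀ p ∈ halfspaces, ⟪p.1, x⟫ ≤ p.2}
  nonempty_interior : (interior {x : Vec d | ∀ p ∈ halfspaces, ⟪p.1, x⟫ ≤ p.2}).Nonempty
  irredundant : ∀ p ∈ halfspaces, ∃ x : Vec d, ⟪p.1, x⟫ = p.2 ∧
    ∀ q ∈ halfspaces, q ≠ p → ⟪q.1, x⟫ < q.2

namespace Cell

variable {d : ℕ}

/-- The closed element `K`. -/
def carrier (K : Cell d) : Set (Vec d) := {x | ∀ p ∈ K.halfspaces, ⟪p.1, x⟫ ≤ p.2}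

/-- The face of `K` on the hyperplane `p.1 · x = p.2`. -/
def facet (K : Cell d) (p : Vec d × ℝ) : Set (Vec d) := {x ∈ K.carrier | ⟪p.1, x⟫ = p.2}

/-- Shape regularity: `K` contains a ball of radius `ρ h_K`, where `h_K = diam K`. -/
def ShapeRegular (ρ : ℝ) (K : Cell d) : Prop :=
  ∃ x : Vec d, Metric.closedBall x (ρ * Metric.diam K.carrier) ⊆ K.carrier

end Cell

/-! ### Meshes -/

/-- A conforming mesh: finitely many non-overlapping elements, any two of which meet in a
(possibly empty) common face of both, so that there are no hanging nodes. -/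
structure Mesh (d : ℕ) where
  numCells : ℕ
  cell : Fin numCells → Cell d
  disjoint_interior : ∀ i j, i ≠ j →
    Disjoint (interior (cell i).carrier) (interior (cell j).carrier)
  face_to_face : ∀ i j, i ≠ j →
    IsExtreme ℝ (cell i).carrier ((cell i).carrier ∩ (cell j).carrier)

/-- A family of functions on `ℝ^d`, one for each element. Only the restriction of `v i` to the
closed element `i` matters; it is the restriction of the broken function to that element, including
its trace on the boundary of the element. -/
abbrev Broken {d : ℕ} (M : Mesh d) (V : Type) := Fin M.numCells → Vec d → V

namespace Mesh

variable {d : ℕ} (M : Mesh d)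

/-- The open domain `Ω` covered by the mesh. -/
def domain : Set (Vec d) := interior (⋃ i, (M.cell i).carrier)

/-- The face `p` of element `i` is also a face of the other element `j`. -/
def IsNeighbor (i : Fin M.numCells) (p : Vec d × ℝ) (j : Fin M.numCells) : Prop :=
  j ≠ i ∧ ∃ q ∈ (M.cell j).halfspaces, (M.cell j).facet q = (M.cell i).facet p

open Classical in
/-- The element on the other side of the face `p` of element `i`; `none` on the boundary of the
domain. -/
def neighbor (i : Fin M.numCells) (p : Vec d × ℝ) : Option (Fin M.numCells) :=
  if h : ∃ j, M.IsNeighbor i p j then some h.choose else none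

/-- The sum over all elements `K` of the integrals over `K`. -/
def cellInt (g : Broken M ℝ) : ℝ := ∑ i, ∫ x in (M.cell i).carrier, g i x

/-- The integral over one face, with respect to surface measure. -/
def facetInt (i : Fin M.numCells) (p : Vec d × ℝ) (g : Vec d → ℝ) : ℝ :=
  ∫ x in (M.cell i).facet p, g x ∂(Measure.euclideanHausdorffMeasure (d - 1))

/-- The sum over all elements `K` of the integrals over `∂K`. -/
def bdryInt (g : Fin M.numCells → Vec d × ℝ → Vec d → ℝ) : ℝ :=
  ∑ i, ∑ p ∈ (M.cell i).halfspaces, M.facetInt i p (g i p)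

/-- Sum over the interior faces. The `+` side of an interior face is the element with the smaller
index, and `n_F = p.1` points from the `+` side to the `-` side. -/
def interiorFaceSum (g : Fin M.numCells → Vec d × ℝ → ℝ) : ℝ :=
  ∑ i, ∑ p ∈ (M.cell i).halfspaces,
    match M.neighbor i p with
    | some j => if i < j then g i p else 0
    | none => 0

/-- Sum over the boundary faces. -/
def boundaryFaceSum (g : Fin M.numCells → Vec d × ℝ → ℝ) : ℝ :=
  ∑ i, ∑ p ∈ (M.cell i).halfspaces,
    match M.neighbor i p with
    | some _ => 0
    | none => g i p

/-- Sum over all faces of the mesh, each counted once. -/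
def faceSum (g : Fin M.numCells → Vec d × ℝ → ℝ) : ℝ :=
  M.interiorFaceSum g + M.boundaryFaceSum g

/-- The diameter `h_F` of a face. -/
def faceDiam (i : Fin M.numCells) (p : Vec d × ℝ) : ℝ := Metric.diam ((M.cell i).facet p)

section traces

variable {M} {V : Type} [AddCommGroup V] [Module ℝ V]

/-- The average on the face `p` of element `i`. -/
def avg (v : Broken M V) (i : Fin M.numCells) (p : Vec d × ℝ) (x : Vec d) : V :=
  match M.neighbor i p with
  | some j => (1 / 2 : ℝ) • (v i x + v j x)
  | none => v i x

/-- The jump on the face `p` of element `i`, with element `i` as the `+` side. -/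
def jump (v : Broken M V) (i : Fin M.numCells) (p : Vec d × ℝ) (x : Vec d) : V :=
  match M.neighbor i p with
  | some j => v i x - v j x
  | none => v i x

/-- The jump of `v ⊗ n`, that is `v₊ ⊗ n₊ + v₋ ⊗ n₋` on interior faces (where `n₋ = -n₊`) and
`v ⊗ n` on boundary faces. It is the same seen from either side. -/
def jumpTensorNormal (v : Broken M (Vec d)) (i : Fin M.numCells) (p : Vec d × ℝ) (x : Vec d) :
    Matrix (Fin d) (Fin d) ℝ :=
  match M.neighbor i p with
  | some j => Matrix.vecMulVec (v i x) p.1 + Matrix.vecMulVec (v j x) (-p.1)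
  | none => Matrix.vecMulVec (v i x) p.1

end traces

end Mesh

/-! ### Differential operators on one element -/

section operators

variable {d : ℕ}

/-- The double contraction `A : B`. -/
def frob (A B : Matrix (Fin d) (Fin d) ℝ) : ℝ := ∑ a, ∑ b, A a b * B a b

/-- The matrix `A` applied to the vector `n`. -/
def act (A : Matrix (Fin d) (Fin d) ℝ) (n : Vec d) : Vec d := WithLp.toLp 2 (A.mulVec n)

/-- The velocity gradient, `(∇ v) a b = ∂ v_a / ∂ x_b`. -/
def grad (v : Vec d → Vec d) (x : Vec d) : Matrix (Fin d) (Fin d) ℝ :=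
  Matrix.of fun a b => fderiv ℝ v x (EuclideanSpace.single b 1) a

/-- The divergence. -/
def divergence (v : Vec d → Vec d) (x : Vec d) : ℝ := (grad v x).trace

/-- The tensor `∇ v + (∇ v)ᵀ - (2/3) (∇ · v) I`. -/
def tau (v : Vec d → Vec d) (x : Vec d) : Matrix (Fin d) (Fin d) ℝ :=
  grad v x + (grad v x).transpose - (2 / 3 * divergence v x) • (1 : Matrix (Fin d) (Fin d) ℝ)

end operators

/-! ### Function spaces -/

/-- A polynomial function on `ℝ^d` of total degree at most `k`. -/
def IsPoly {d : ℕ} (k : ℕ) (g : Vec d → ℝ) : Prop :=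
  ∃ P : MvPolynomial (Fin d) ℝ, P.totalDegree ≤ k ∧ ∀ x, g x = MvPolynomial.eval (fun a => x a) P

/-- The space `H₀(div; Ω)`: `w ∈ L²(Ω)` has a weak divergence `g ∈ L²(Ω)` and zero normal trace on
`∂Ω`. The test functions `φ` need not vanish on `∂Ω`; those with compact support in `Ω` say that `g`
is the weak divergence, and the others that the normal trace is zero. -/
def MemHdivZero {d : ℕ} (Ω : Set (Vec d)) (w : Vec d → Vec d) : Prop :=
  MemLp w 2 (volume.restrict Ω) ∧
  ∃ g : Vec d → ℝ, MemLp g 2 (volume.restrict Ω) ∧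
    ∀ φ : Vec d → ℝ, ContDiff ℝ ∞ φ → HasCompactSupport φ →
      ∫ x in Ω, ⟪w x, gradient φ x⟫ = - ∫ x in Ω, g x * φ x

namespace Mesh

variable {d : ℕ} (M : Mesh d)

open Classical in
/-- The function on the domain (up to a null set) given by a broken function. -/
def glue (v : Broken M (Vec d)) (x : Vec d) : Vec d :=
  ∑ i, if x ∈ interior (M.cell i).carrier then v i x else 0

/-- `W` is a space of piecewise polynomial vector fields of degree at most `k`, contained in
`H₀(div; Ω)`. -/
def IsVelocitySpace (k : ℕ) (W : Submodule ℝ (Broken M (Vec d))) : Prop :=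
  ∀ w ∈ W, (∀ i a, IsPoly k fun x => w i x a) ∧ MemHdivZero M.domain (M.glue w)

/-- `Q` is a space of functions with zero mean which are continuous on each closed element. -/
def IsPressureSpace (Q : Submodule ℝ (Broken M ℝ)) : Prop :=
  ∀ q ∈ Q, (∀ i, ContinuousOn (q i) (M.cell i).carrier) ∧ M.cellInt q = 0

end Mesh

/-! ### Norms -/

namespace Mesh

variable {d : ℕ} (M : Mesh d)

/-- The norm of `L²(Ω)`. -/
def l2Norm (v : Broken M (Vec d)) : ℝ := √(M.cellInt fun i x => ‖v i x‖ ^ 2)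

/-- The norm `|||w|||_sym`. -/
def symNorm (w : Broken M (Vec d)) : ℝ :=
  √((M.cellInt fun i x => frob (tau (w i) x) (tau (w i) x)) +
    M.faceSum fun i p => M.facetInt i p fun x => 1 / M.faceDiam i p * ‖jump w i p x‖ ^ 2)

/-- The seminorm `|w|_β`. For `β` in `H₀(div; Ω)` the normal component of `β` is single-valued on
interior faces, hence equal to that of the average. -/
def convSeminorm (ζ : ℝ) (β w : Broken M (Vec d)) : ℝ :=
  √(ζ * M.interiorFaceSum fun i p =>
    M.facetInt i p fun x => |⟪avg β i p x, p.1⟫| * ‖jump w i p x‖ ^ 2)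

/-! ### The semi-discrete method -/

/-- The inviscid numerical flux
`{u} ⊗ {u} + {π} I + ζ |u · n_F| [u ⊗ n]`. -/
def fluxInv (ζ : ℝ) (u : Broken M (Vec d)) (π : Broken M ℝ)
    (i : Fin M.numCells) (p : Vec d × ℝ) (x : Vec d) : Matrix (Fin d) (Fin d) ℝ :=
  Matrix.vecMulVec (avg u i p x).ofLp (avg u i p x).ofLp + avg π i p x • (1 : Matrix (Fin d) (Fin d) ℝ) +
    (ζ * |⟪avg u i p x, p.1⟫|) • jumpTensorNormal u i p x

/-- The viscous numerical flux `{τ(u)} - (η / h_F) [u ⊗ n]`. -/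
def fluxVis (η : ℝ) (u : Broken M (Vec d))
    (i : Fin M.numCells) (p : Vec d × ℝ) (x : Vec d) : Matrix (Fin d) (Fin d) ℝ :=
  avg (fun j => tau (u j)) i p x - (η / M.faceDiam i p) • jumpTensorNormal u i p x

/-- Left-hand side of the mass equation. -/
def massForm (u : Broken M (Vec d)) (q : Broken M ℝ) : ℝ :=
  M.cellInt fun i x => divergence (u i) x * q i x

/-- The viscous terms (the bracket multiplied by the viscosity), with `{u}` as the numerical flux
for the velocity. The last term is the boundary term which, for `θ = 1`, makes the form symmetric;
it is absent for `θ = 0`. -/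
def viscousForm (η θ : ℝ) (u w : Broken M (Vec d)) : ℝ :=
  (M.cellInt fun i x => frob (tau (u i) x) (grad (w i) x))
  - (M.bdryInt fun i p x => ⟪act (M.fluxVis η u i p x) p.1, w i x⟫)
  + (M.bdryInt fun i p x => ⟪avg u i p x - u i x, act (tau (w i) x) p.1⟫)
  - θ * M.boundaryFaceSum fun i p =>
      M.facetInt i p fun x => ⟪u i x, act (tau (w i) x) p.1⟫

/-- Left-hand side of the momentum equation, with `ut` the time derivative of `u`. -/
def momentumForm (ν ζ η θ : ℝ) (ut u : Broken M (Vec d)) (π : Broken M ℝ)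
    (w : Broken M (Vec d)) : ℝ :=
  (M.cellInt fun i x => ⟪ut i x, w i x⟫)
  - (M.cellInt fun i x => frob (Matrix.vecMulVec (u i x) (u i x)) (grad (w i) x))
  - (M.cellInt fun i x => π i x * divergence (w i) x)
  + (M.bdryInt fun i p x => ⟪act (M.fluxInv ζ u π i p x) p.1, w i x⟫)
  + ν * M.viscousForm η θ u w
  - 1 / 2 * (M.cellInt fun i x => ⟪divergence (u i) x • u i x, w i x⟫)

/-- `(π, u)` solves the semi-discrete mixed method on `(t0, tn)` with forcing `f`: `u` is absolutely
continuous in time with values in `W`, `π` has values in `Q`, and for almost every time the mass and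
momentum equations hold for all test functions. -/
structure IsSolution (W : Submodule ℝ (Broken M (Vec d))) (Q : Submodule ℝ (Broken M ℝ))
    (ν ζ η θ t0 tn : ℝ) (f : ℝ → Lp (Vec d) 2 (volume.restrict M.domain))
    (u : ℝ → Broken M (Vec d)) (π : ℝ → Broken M ℝ) : Prop where
  velocity_mem : ∀ t ∈ Icc t0 tn, u t ∈ W
  pressure_mem : ∀ᵐ t ∂(volume.restrict (Ioo t0 tn)), π t ∈ Q
  absolutelyContinuous : ∀ i, ∀ x ∈ (M.cell i).carrier,
    AbsolutelyContinuousOnInterval (fun t => u t i x) t0 tn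
  mass : ∀ᵐ t ∂(volume.restrict (Ioo t0 tn)), ∀ q ∈ Q, M.massForm (u t) q = 0
  momentum : ∀ᵐ t ∂(volume.restrict (Ioo t0 tn)), ∀ w ∈ W,
    M.momentumForm ν ζ η θ (fun i x => deriv (fun s => u s i x) t) (u t) (π t) w =
      M.cellInt fun i x => ⟪f t x, w i x⟫

end Mesh

/-! ### Constants -/

/-- `Ctr` is a constant in the discrete trace inequality
`h_K^{1/2} ‖g‖_{L²(F)} ≤ Ctr ‖g‖_{L²(K)}` for polynomials of degree at most `k`, valid for all
faces `F` of all elements `K` with shape parameter `ρ`. -/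
def IsTraceConst (d k : ℕ) (ρ Ctr : ℝ) : Prop :=
  0 < Ctr ∧ ∀ K : Cell d, K.ShapeRegular ρ → ∀ p ∈ K.halfspaces, ∀ g : Vec d → ℝ, IsPoly k g →
    √(Metric.diam K.carrier) *
        √(∫ x in K.facet p, g x ^ 2 ∂(Measure.euclideanHausdorffMeasure (d - 1))) ≤
      Ctr * √(∫ x in K.carrier, g x ^ 2)

/-- The coercivity constant. -/
def coercConst (Ctr : ℝ) (N : ℕ) (η : ℝ) : ℝ := (η - 2 * Ctr ^ 2 * N) / (1 + 2 * η)

end MixedNS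

end

open MixedNS

noncomputable section

namespace MixedNS

open Filter Topology

/-! ### Orthogonal charts of hyperplanes -/

section frames

variable {m : ℕ} {n : Vec (m + 1)}

/-! The estimate is an energy argument. At almost every time the mass equation is tested with `q =
π`, which removes the pressure volume term, and the momentum equation with `w = u`. What remains is
`1/2 (‖u‖²)' + D ≤ ‖f‖ ‖u‖` with `D` the dissipation (`Mesh.energy_inequality`).

Convection. On each element the divergence theorem (`Cell.integral_divergence`, obtained by
smoothing the indicator of a polytope) turns the two cubic volume terms into `1/2 ∫ |u|² u·n` over
the boundary. Since `u` lies in `H₀(div)`, its normal jump vanishes on every face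
(`Mesh.inner_jump_eq_zero`). Therefore the pressure flux drops out, the central flux cancels the
cubic boundary terms, and only the upwind part survives: it is exactly the seminorm
(`Mesh.inviscid_eq`).

Viscosity. In dimension two or three, `τ : ∇u ≥ 1/2 |τ|²`. The faces contribute `η/h |J|² - c
J·{τ}n`, with `J` the jump, `c = 2` inside and `c = 1 + θ` on the boundary. Young's inequality with
weight `B/h` splits the mixed term, and the trace inequality, summed over at most `N` faces per
element, bounds `∑ h ‖{τ}n‖²` by `Ctr² N ‖τ‖²`. Coercivity with constant `c₀` thus needs `η - B ≥
c₀` and `1/2 - Ctr² N / B ≥ c₀`; the choice `B = η - c₀` with `c₀ = coercConst` satisfies both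
(`Mesh.viscousForm_ge`).

Trace constants exist by scaling to unit size: polynomials of bounded degree form a
finite-dimensional space, so the supremum on the unit ball is controlled by the `L²` norm on the
ball of radius `ρ` (`exists_isTraceConst`).

Time. Dropping `D` gives `‖u(t)‖ ≤ ‖u(t₀)‖ + ∫‖f‖`. Inserting this bound into the right-hand side,
integrating and using Young's inequality gives the constants `1` and `3/2` (`energy_estimate`).
Absolute continuity is assumed only pointwise in space. It passes to the polynomial coefficients,
which are finite combinations of point values (`exists_coeffs`), and hence to the energy, a
quadratic form in the coefficients. -/

theorem exists_orthogonalFrame (hn : ‖n‖ = 1) :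
    ∃ L : Vec m →ₗᵢ[ℝ] Vec (m + 1), (∀ y, ⟪n, L y⟫ = 0) ∧ (∀ x, ⟪n, x⟫ = 0 → ∃ y, L y = x) ∧
      MeasurePreserving (fun z : ℝ × Vec m => z.1 • n + L z.2) (volume.prod volume) volume := by
  -- Complete `n` to an orthonormal basis with `b 0 = n`. In its coordinates the frame inserts a
  -- zero in position `0`, and `(s, y) ↦ s n + L y` is a composition of volume-preserving coordinate
  -- maps.
  obtain ⟨b, hb⟩ := Orthonormal.exists_orthonormalBasis_extension_of_card_eq (𝕜 := ℝ)
    (E := Vec (m + 1)) (ι := Fin (m + 1)) (by simp) (v := fun _ => n) (s := {0}) (by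
      constructor
      · intro i; simpa using hn
      · intro i j hij
        exact absurd (Subsingleton.elim i j) hij)
  have hb0 : b 0 = n := hb 0 rfl
  let c : Vec m →ₗᵢ[ℝ] Vec (m + 1) :=
    { toFun := fun y => WithLp.toLp 2 (Fin.cons 0 y.ofLp)
      map_add' := fun x y => by
        ext i; refine Fin.cases ?_ (fun j => ?_) i <;> simp
      map_smul' := fun r y => by
        ext i; refine Fin.cases ?_ (fun j => ?_) i <;> simp
      norm_map' := fun y => by
        simp [EuclideanSpace.norm_eq, Fin.sum_univ_succ] }
  have hc : ∀ y : Vec m, c y = WithLp.toLp 2 (Fin.cons 0 y.ofLp) := fun y => rfl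
  have hinner : ∀ x, ⟪n, x⟫ = b.repr x 0 := fun x => by rw [b.repr_apply_apply, hb0]
  refine ⟨b.repr.symm.toLinearIsometry.comp c, fun y => ?_, fun x hx => ?_, ?_⟩
  · rw [hinner]; simp [hc]
  · refine ⟨WithLp.toLp 2 fun i => b.repr x i.succ, ?_⟩
    have : c (WithLp.toLp 2 fun i => b.repr x i.succ) = b.repr x := by
      ext i; refine Fin.cases ?_ (fun j => ?_) i
      · rw [hc, ← hinner, hx]; simp
      · simp [hc]
    simp [this]
  · have h1 : MeasurePreserving (fun z : ℝ × Vec m => (z.1, z.2.ofLp)) (volume.prod volume)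
        (volume.prod volume) :=
      (MeasurePreserving.id volume).prod (PiLp.volume_preserving_ofLp (Fin m))
    have h2 := (volume_preserving_piFinSuccAbove (fun _ : Fin (m + 1) => ℝ) 0).symm
    have h3 := (b.measurePreserving_repr_symm.comp (PiLp.volume_preserving_toLp (Fin (m + 1)))).comp
      (h2.comp h1)
    convert h3 using 1
    funext z
    have : z.1 • n = b.repr.symm (EuclideanSpace.single 0 z.1) := by
      rw [← hb0, ← b.repr_symm_single, ← map_smul]
      congr 1
      ext i; simp
    change z.1 • n + b.repr.symm (c z.2) = b.repr.symm _
    rw [this, ← map_add]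
    congr 1
    ext i
    refine Fin.cases ?_ (fun j => ?_) i
    · simp [hc, MeasurableEquiv.piFinSuccAbove]
    · simp [hc, MeasurableEquiv.piFinSuccAbove]

/-- A linear isometry onto the orthogonal complement of a unit vector. -/
def frame (hn : ‖n‖ = 1) : Vec m →ₗᵢ[ℝ] Vec (m + 1) := (exists_orthogonalFrame hn).choose

theorem inner_frame (hn : ‖n‖ = 1) (y : Vec m) : ⟪n, frame hn y⟫ = 0 :=
  (exists_orthogonalFrame hn).choose_spec.1 y

theorem exists_frame_eq (hn : ‖n‖ = 1) {x : Vec (m + 1)} (hx : ⟪n, x⟫ = 0) :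
    ∃ y, frame hn y = x :=
  (exists_orthogonalFrame hn).choose_spec.2.1 x hx

theorem measurePreserving_frame (hn : ‖n‖ = 1) :
    MeasurePreserving (fun z : ℝ × Vec m => z.1 • n + frame hn z.2) (volume.prod volume) volume :=
  (exists_orthogonalFrame hn).choose_spec.2.2

/-- The isometric parametrization of the hyperplane `n · x = s`. -/
def chart (hn : ‖n‖ = 1) (s : ℝ) (y : Vec m) : Vec (m + 1) := s • n + frame hn y

theorem inner_chart (hn : ‖n‖ = 1) (s : ℝ) (y : Vec m) : ⟪n, chart hn s y⟫ = s := by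
  rw [chart, inner_add_right, inner_frame, inner_smul_right, real_inner_self_eq_norm_sq, hn]; simp

theorem isometry_chart (hn : ‖n‖ = 1) (s : ℝ) : Isometry (chart hn s) :=
  (IsometryEquiv.addLeft (s • n)).isometry.comp (frame hn).isometry

theorem exists_chart_eq (hn : ‖n‖ = 1) {s : ℝ} {x : Vec (m + 1)} (hx : ⟪n, x⟫ = s) :
    ∃ y, chart hn s y = x := by
  obtain ⟨y, hy⟩ := exists_frame_eq hn (x := x - s • n) (by
    rw [inner_sub_right, inner_smul_right, real_inner_self_eq_norm_sq, hn, hx]; simp)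
  exact ⟨y, by rw [chart, hy]; abel⟩

theorem range_chart (hn : ‖n‖ = 1) (s : ℝ) : range (chart hn s) = {x | ⟪n, x⟫ = s} := by
  ext x
  constructor
  · rintro ⟨y, rfl⟩; exact inner_chart hn s y
  · intro hx; exact exists_chart_eq hn hx

theorem norm_le_norm_chart (hn : ‖n‖ = 1) (s : ℝ) (y : Vec m) : ‖y‖ ≤ ‖chart hn s y‖ := by
  have h : ‖chart hn s y‖ ^ 2 = s ^ 2 + ‖y‖ ^ 2 := by
    rw [chart, norm_add_sq_real, inner_smul_left, inner_frame, norm_smul, hn,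
      (frame hn).norm_map]
    simp
  exact le_of_sq_le_sq (by nlinarith [sq_nonneg s]) (norm_nonneg _)
  
theorem continuous_chart (hn : ‖n‖ = 1) :
    Continuous fun z : ℝ × Vec m => chart hn z.1 z.2 := by
  unfold chart
  have := (frame hn).continuous
  fun_prop

theorem measurableEmbedding_chart (hn : ‖n‖ = 1) (s : ℝ) : MeasurableEmbedding (chart hn s) :=
  (isometry_chart hn s).isClosedEmbedding.measurableEmbedding

/-- Normalised Hausdorff measure is preserved by isometries and equals Lebesgue measure on `Vec m`,
so surface integrals over a flat face become ordinary integrals in the chart. -/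
theorem hausdorff_restrict_eq_map_chart (hn : ‖n‖ = 1) {s : ℝ} {F : Set (Vec (m + 1))}
    (hF : MeasurableSet F) (hFs : ∀ x ∈ F, ⟪n, x⟫ = s) :
    (Measure.euclideanHausdorffMeasure m : Measure (Vec (m + 1))).restrict F =
      (volume.restrict (chart hn s ⁻¹' F)).map (chart hn s) := by
  rw [← (measurableEmbedding_chart hn s).restrict_map,
    ← EuclideanSpace.euclideanHausdorffMeasure_eq_volume,
    (isometry_chart hn s).map_euclideanHausdorffMeasure, Measure.restrict_restrict hF,
    inter_eq_left.mpr]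
  rw [range_chart]
  exact hFs

end frames

/-! ### Basic geometry of elements -/

namespace Cell

section general

variable {d : ℕ} (K : Cell d)

theorem mem_carrier {x : Vec d} : x ∈ K.carrier ↔ ∀ p ∈ K.halfspaces, ⟪p.1, x⟫ ≤ p.2 := Iff.rfl

theorem isClosed_carrier : IsClosed K.carrier := by
  have : K.carrier = ⋂ p ∈ K.halfspaces, {x : Vec d | ⟪p.1, x⟫ ≤ p.2} := by
    ext x; simp [mem_carrier]
  rw [this]
  exact isClosed_biInter fun p _ => isClosed_le (by fun_prop) continuous_const

theorem isCompact_carrier : IsCompact K.carrier :=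
  Metric.isCompact_of_isClosed_isBounded K.isClosed_carrier K.bounded

theorem convex_carrier : Convex ℝ K.carrier := by
  intro x hx y hy a b ha hb hab p hp
  rw [inner_add_right, inner_smul_right, inner_smul_right]
  have h1 := mul_le_mul_of_nonneg_left (hx p hp) ha
  have h2 := mul_le_mul_of_nonneg_left (hy p hp) hb
  have h3 : a * p.2 + b * p.2 = p.2 := by rw [← add_mul, hab, one_mul]
  linarith

theorem isClosed_facet (p : Vec d × ℝ) : IsClosed (K.facet p) :=
  K.isClosed_carrier.inter (isClosed_eq (by fun_prop) continuous_const)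

theorem facet_subset (p : Vec d × ℝ) : K.facet p ⊆ K.carrier := fun _ hx => hx.1

theorem isCompact_facet (p : Vec d × ℝ) : IsCompact (K.facet p) :=
  K.isCompact_carrier.of_isClosed_subset (K.isClosed_facet p) (K.facet_subset p)

/-- The open element, described by strict inequalities. -/
def openCarrier : Set (Vec d) := {x | ∀ p ∈ K.halfspaces, ⟪p.1, x⟫ < p.2}

theorem isOpen_openCarrier : IsOpen K.openCarrier := by
  have : K.openCarrier = ⋂ p ∈ K.halfspaces, {x : Vec d | ⟪p.1, x⟫ < p.2} := by
    ext x; simp [openCarrier]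
  rw [this]
  exact isOpen_biInter_finset fun p _ => isOpen_lt (by fun_prop) continuous_const

theorem openCarrier_subset : K.openCarrier ⊆ K.carrier := fun _ hx p hp => (hx p hp).le

/-- At a point where a constraint is active, an arbitrarily small move along its outward normal
leaves the element. -/
theorem interior_carrier : interior K.carrier = K.openCarrier := by
  apply Subset.antisymm
  · intro x hx p hp
    have hx' := interior_subset hx p hp
    refine lt_of_le_of_ne hx' fun heq => ?_
    have hn := K.unit_normal p hp
    have hcont : Tendsto (fun t : ℝ => x + t • p.1) (𝓝[>] 0) (𝓝 x) := by
      have : Continuous fun t : ℝ => x + t • p.1 := by fun_prop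
      simpa using (this.tendsto 0).mono_left nhdsWithin_le_nhds
    have hev := hcont.eventually (isOpen_interior.mem_nhds hx)
    obtain ⟨t, ht, ht0⟩ := (hev.and self_mem_nhdsWithin).exists
    have := interior_subset ht p hp
    rw [inner_add_right, inner_smul_right, real_inner_self_eq_norm_sq, hn, heq] at this
    have ht0' : (0 : ℝ) < t := ht0
    linarith
  · exact interior_maximal K.openCarrier_subset K.isOpen_openCarrier

theorem openCarrier_nonempty : K.openCarrier.Nonempty := by
  rw [← interior_carrier]; exact K.nonempty_interior

theorem openCarrier_ae_eq : K.openCarrier =ᵐ[volume] K.carrier := by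
  rw [← interior_carrier]
  exact interior_ae_eq_of_null_frontier (K.convex_carrier.addHaar_frontier volume)

theorem measurableSet_carrier : MeasurableSet K.carrier := K.isClosed_carrier.measurableSet

theorem integrableOn_carrier {g : Vec d → ℝ} (hg : ContinuousOn g K.carrier) :
    IntegrableOn g K.carrier :=
  hg.integrableOn_compact K.isCompact_carrier

/-- The relative interior of the facet `p`. -/
def relFacet (p : Vec d × ℝ) : Set (Vec d) :=
  {x | ⟪p.1, x⟫ = p.2 ∧ ∀ q ∈ K.halfspaces, q ≠ p → ⟪q.1, x⟫ < q.2}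

theorem relFacet_nonempty {p : Vec d × ℝ} (hp : p ∈ K.halfspaces) : (K.relFacet p).Nonempty :=
  K.irredundant p hp

theorem relFacet_subset {p : Vec d × ℝ} : K.relFacet p ⊆ K.facet p := by
  intro x hx
  refine ⟨fun q hq => ?_, hx.1⟩
  by_cases h : q = p
  · rw [h, hx.1]
  · exact (hx.2 q hq h).le

/-- Strictness of the inactive constraints survives any positive weight on `x`; letting that weight
tend to zero shows that the relative interior is dense in the facet. -/
theorem combo_mem_relFacet {p : Vec d × ℝ} {x y : Vec d} (hx : x ∈ K.relFacet p)
    (hy : y ∈ K.facet p) {t : ℝ} (ht : 0 < t) (ht1 : t ≤ 1) :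
    t • x + (1 - t) • y ∈ K.relFacet p := by
  constructor
  · rw [inner_add_right, inner_smul_right, inner_smul_right, hx.1, hy.2]; ring
  · intro q hq hqp
    rw [inner_add_right, inner_smul_right, inner_smul_right]
    nlinarith [hx.2 q hq hqp, hy.1 q hq]

theorem facet_subset_closure_relFacet {p : Vec d × ℝ} (hp : p ∈ K.halfspaces) :
    K.facet p ⊆ closure (K.relFacet p) := by
  intro y hy
  obtain ⟨x, hx⟩ := K.relFacet_nonempty hp
  have hcont : Tendsto (fun t : ℝ => t • x + (1 - t) • y) (𝓝[>] 0) (𝓝 y) := by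
    have : Continuous fun t : ℝ => t • x + (1 - t) • y := by fun_prop
    simpa using (this.tendsto 0).mono_left nhdsWithin_le_nhds
  refine mem_closure_of_tendsto hcont ?_
  filter_upwards [Ioc_mem_nhdsGT (zero_lt_one' ℝ)] with t ht
  exact K.combo_mem_relFacet hx hy ht.1 ht.2

theorem eventually_mem_relFacet {p : Vec d × ℝ} {x : Vec d}
    (hx : x ∈ K.relFacet p) : ∀ᶠ z in 𝓝 x, ∀ q ∈ K.halfspaces, q ≠ p → ⟪q.1, z⟫ < q.2 := by
  rw [Filter.eventually_all_finset]
  intro q hq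
  by_cases h : q = p
  · simp [h]
  · have : ∀ᶠ z in 𝓝 x, ⟪q.1, z⟫ < q.2 :=
      (isOpen_lt (by fun_prop) continuous_const).mem_nhds (hx.2 q hq h)
    filter_upwards [this] with z hz _ using hz

end general

/-! ### Surface measure on a facet. -/

section surface

variable {m : ℕ} (K : Cell (m + 1)) {p : Vec (m + 1) × ℝ} (hn : ‖p.1‖ = 1)

theorem hausdorff_restrict_facet :
    (Measure.euclideanHausdorffMeasure m : Measure (Vec (m + 1))).restrict (K.facet p) =
      (volume.restrict (chart hn p.2 ⁻¹' K.facet p)).map (chart hn p.2) :=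
  hausdorff_restrict_eq_map_chart hn (K.isClosed_facet p).measurableSet fun _ hx => hx.2

theorem isCompact_chart_preimage : IsCompact (chart hn p.2 ⁻¹' K.facet p) :=
  (isometry_chart hn p.2).isClosedEmbedding.isCompact_preimage (K.isCompact_facet p)

theorem integral_facet (g : Vec (m + 1) → ℝ) :
    ∫ x in K.facet p, g x ∂(Measure.euclideanHausdorffMeasure m) =
      ∫ y in chart hn p.2 ⁻¹' K.facet p, g (chart hn p.2 y) := by
  rw [hausdorff_restrict_facet K hn, (measurableEmbedding_chart hn p.2).integral_map]

theorem isFiniteMeasure_facet (hn : ‖p.1‖ = 1) : IsFiniteMeasure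
    ((Measure.euclideanHausdorffMeasure m : Measure (Vec (m + 1))).restrict (K.facet p)) := by
  have := isFiniteMeasure_restrict.mpr
    ((K.isCompact_chart_preimage hn).measure_lt_top (μ := volume)).ne
  rw [hausdorff_restrict_facet K hn]
  infer_instance

theorem integrableOn_facet (hn : ‖p.1‖ = 1) {g : Vec (m + 1) → ℝ} (hg : ContinuousOn g (K.facet p)) :
    IntegrableOn g (K.facet p) (Measure.euclideanHausdorffMeasure m) := by
  have := K.isFiniteMeasure_facet hn
  obtain ⟨C, hC⟩ := (K.isCompact_facet p).exists_bound_of_continuousOn hg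
  refine Integrable.of_bound (C := C)
    (hg.aestronglyMeasurable (K.isClosed_facet p).measurableSet) ?_
  filter_upwards [ae_restrict_mem (K.isClosed_facet p).measurableSet] with x hx using hC x hx

/-- The relative boundary lies in finitely many sets where another constraint is active. In the
chart each of them is an affine subspace, proper because the irredundancy witness of `p` avoids it,
hence null. -/
theorem chart_relFacet_ae_eq (hp : p ∈ K.halfspaces) :
    (chart hn p.2 ⁻¹' K.relFacet p : Set (Vec m)) =ᵐ[volume] chart hn p.2 ⁻¹' K.facet p := by
  refine (LE.le.eventuallyLE (preimage_mono K.relFacet_subset)).antisymm ?_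
  have hnull : ∀ q ∈ K.halfspaces, q ≠ p →
      volume {y : Vec m | ⟪q.1, chart hn p.2 y⟫ = q.2} = 0 := by
    intro q hq hqp
    obtain ⟨x, hx, hx'⟩ := K.irredundant p hp
    obtain ⟨y₀, rfl⟩ := exists_chart_eq hn hx
    let f : Vec m →ᵃ[ℝ] ℝ :=
      ((innerSL ℝ q.1).toLinearMap.comp (frame hn).toLinearMap).toAffineMap +
        AffineMap.const ℝ (Vec m) (p.2 * ⟪q.1, p.1⟫)
    have hf : ∀ y, f y = ⟪q.1, chart hn p.2 y⟫ := fun y => by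
      simp [f, chart, inner_add_right, inner_smul_right, add_comm]
    let S : AffineSubspace ℝ (Vec m) := (AffineSubspace.mk' q.2 ⊥).comap f
    have hS : (S : Set (Vec m)) = {y : Vec m | ⟪q.1, chart hn p.2 y⟫ = q.2} := by
      ext y
      simp [S, hf, AffineSubspace.mem_mk', sub_eq_zero]
    rw [← hS]
    apply Measure.addHaar_affineSubspace
    intro htop
    have : y₀ ∈ (S : Set (Vec m)) := by rw [htop]; trivial
    rw [hS] at this
    exact (hx' q hq hqp).ne this
  have hall : ∀ᵐ y : Vec m, ∀ q ∈ K.halfspaces, q ≠ p → ⟪q.1, chart hn p.2 y⟫ ≠ q.2 := by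
    rw [Filter.eventually_all_finset]
    intro q hq
    by_cases h : q = p
    · simp [h]
    · filter_upwards [measure_eq_zero_iff_ae_notMem.mp (hnull q hq h)] with y hy _ using hy
  filter_upwards [hall] with y hy hyF
  exact ⟨hyF.2, fun q hq hqp => lt_of_le_of_ne (hyF.1 q hq) (hy q hq hqp)⟩

end surface

end Cell

/-! ### The divergence theorem on an element -/

section cutoff

/-- The derivative of the smooth step function. -/
def stepDeriv (r : ℝ) : ℝ := deriv Real.smoothTransition r

theorem continuous_stepDeriv : Continuous stepDeriv :=
  (Real.smoothTransition.contDiff (n := 1)).continuous_deriv le_rfl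

theorem hasDerivAt_smoothTransition (r : ℝ) :
    HasDerivAt Real.smoothTransition (stepDeriv r) r :=
  ((Real.smoothTransition.contDiff (n := 1)).differentiable (by simp) r).hasDerivAt

theorem stepDeriv_of_nonpos {r : ℝ} (hr : r ≤ 0) : stepDeriv r = 0 := by
  apply IsLocalMin.deriv_eq_zero
  filter_upwards with s
  rw [Real.smoothTransition.zero_of_nonpos hr]
  exact Real.smoothTransition.nonneg s

theorem stepDeriv_of_one_le {r : ℝ} (hr : 1 ≤ r) : stepDeriv r = 0 := by
  apply IsLocalMax.deriv_eq_zero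
  filter_upwards with s
  rw [Real.smoothTransition.one_of_one_le hr]
  exact Real.smoothTransition.le_one s

theorem mem_Icc_of_stepDeriv_ne_zero {r : ℝ} (hr : stepDeriv r ≠ 0) : r ∈ Icc (0 : ℝ) 1 :=
  ⟨le_of_not_ge fun h => hr (stepDeriv_of_nonpos h),
    le_of_not_ge fun h => hr (stepDeriv_of_one_le h)⟩

theorem integral_stepDeriv : ∫ r, stepDeriv r = 1 := by
  have h1 : ∫ r in Ioc (0 : ℝ) 1, stepDeriv r = ∫ r, stepDeriv r := by
    apply setIntegral_eq_integral_of_forall_compl_eq_zero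
    intro r hr
    by_contra h
    have h2 := mem_Icc_of_stepDeriv_ne_zero h
    refine hr ⟨lt_of_le_of_ne h2.1 fun h0 => h (stepDeriv_of_nonpos h0.symm.le), h2.2⟩
  rw [← h1, ← intervalIntegral.integral_of_le zero_le_one,
    intervalIntegral.integral_eq_sub_of_hasDerivAt (fun r _ => hasDerivAt_smoothTransition r)
      (continuous_stepDeriv.intervalIntegrable _ _)]
  simp

variable {d : ℕ}

/-- A smooth approximation of the indicator function of the half-space `p`. -/
def cut (ε : ℝ) (p : Vec d × ℝ) (x : Vec d) : ℝ :=
  Real.smoothTransition ((p.2 - ⟪p.1, x⟫) / ε)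

theorem continuous_cut (ε : ℝ) (p : Vec d × ℝ) : Continuous (cut ε p) := by
  unfold cut
  exact Real.smoothTransition.continuous.comp (by fun_prop)

theorem cut_mem (ε : ℝ) (p : Vec d × ℝ) (x : Vec d) : cut ε p x ∈ Icc (0 : ℝ) 1 :=
  ⟨Real.smoothTransition.nonneg _, Real.smoothTransition.le_one _⟩

theorem cut_eq_zero {ε : ℝ} (hε : 0 < ε) {p : Vec d × ℝ} {x : Vec d} (h : p.2 ≤ ⟪p.1, x⟫) :
    cut ε p x = 0 :=
  Real.smoothTransition.zero_of_nonpos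
    (div_nonpos_of_nonpos_of_nonneg (sub_nonpos.mpr h) hε.le)

theorem cut_eq_one {ε : ℝ} (hε : 0 < ε) {p : Vec d × ℝ} {x : Vec d} (h : ε ≤ p.2 - ⟪p.1, x⟫) :
    cut ε p x = 1 :=
  Real.smoothTransition.one_of_one_le ((one_le_div hε).mpr h)

theorem prod_cut_mem (s : Finset (Vec d × ℝ)) (ε : ℝ) (x : Vec d) :
    ∏ p ∈ s, cut ε p x ∈ Icc (0 : ℝ) 1 :=
  ⟨Finset.prod_nonneg fun p _ => (cut_mem ε p x).1,
    Finset.prod_le_one (fun p _ => (cut_mem ε p x).1) fun p _ => (cut_mem ε p x).2⟩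

theorem tendsto_prod_cut_one {s : Finset (Vec d × ℝ)} {x : ℝ → Vec d} {x₀ : Vec d}
    (hx : Tendsto x (𝓝[>] 0) (𝓝 x₀)) (h : ∀ p ∈ s, ⟪p.1, x₀⟫ < p.2) :
    ∀ᶠ ε in 𝓝[>] 0, ∏ p ∈ s, cut ε p (x ε) = 1 := by
  have : ∀ᶠ ε in 𝓝[>] (0 : ℝ), ∀ p ∈ s, cut ε p (x ε) = 1 := by
    rw [Filter.eventually_all_finset]
    intro p hp
    have h1 : Tendsto (fun ε => p.2 - ⟪p.1, x ε⟫) (𝓝[>] 0) (𝓝 (p.2 - ⟪p.1, x₀⟫)) :=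
      tendsto_const_nhds.sub (tendsto_const_nhds.inner hx)
    have h2 : Tendsto (fun ε : ℝ => ε) (𝓝[>] 0) (𝓝 0) := nhdsWithin_le_nhds
    filter_upwards [h2.eventually_lt h1 (sub_pos.mpr (h p hp)), self_mem_nhdsWithin]
      with ε hε hε0 using cut_eq_one hε0 hε.le
  filter_upwards [this] with ε hε using Finset.prod_eq_one hε

theorem tendsto_prod_cut_zero {s : Finset (Vec d × ℝ)} {x : ℝ → Vec d} {x₀ : Vec d}
    (hx : Tendsto x (𝓝[>] 0) (𝓝 x₀)) {p : Vec d × ℝ} (hp : p ∈ s) (h : p.2 < ⟪p.1, x₀⟫) :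
    ∀ᶠ ε in 𝓝[>] 0, ∏ p ∈ s, cut ε p (x ε) = 0 := by
  have h1 : Tendsto (fun ε => ⟪p.1, x ε⟫) (𝓝[>] 0) (𝓝 ⟪p.1, x₀⟫) :=
    tendsto_const_nhds.inner hx
  filter_upwards [h1.eventually (lt_mem_nhds h), self_mem_nhdsWithin] with ε hε hε0
  exact Finset.prod_eq_zero hp (cut_eq_zero hε0 hε.le)

theorem hasFDerivAt_cut (ε : ℝ) (p : Vec d × ℝ) (x : Vec d) :
    HasFDerivAt (cut ε p)
      (-(stepDeriv ((p.2 - ⟪p.1, x⟫) / ε) / ε) • innerSL ℝ p.1) x := by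
  have h1 : HasFDerivAt (fun x : Vec d => (p.2 - ⟪p.1, x⟫) / ε) (-(1 / ε) • innerSL ℝ p.1) x := by
    have := (((innerSL ℝ p.1).hasFDerivAt (x := x)).const_sub p.2).const_mul (1 / ε)
    convert! this using 1
    · ext y; simp [div_eq_inv_mul]
    · ext y; simp
  have h2 := (hasDerivAt_smoothTransition ((p.2 - ⟪p.1, x⟫) / ε)).comp_hasFDerivAt x h1
  convert! h2 using 1
  ext y; simp [div_eq_mul_inv, mul_assoc]

theorem mem_of_prod_cut_ne_zero {s : Finset (Vec d × ℝ)} {ε : ℝ} (hε : 0 < ε) {x : Vec d}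
    (h : ∏ p ∈ s, cut ε p x ≠ 0) : ∀ p ∈ s, ⟪p.1, x⟫ ≤ p.2 := by
  intro p hp
  by_contra hlt
  exact h (Finset.prod_eq_zero hp (cut_eq_zero hε (not_le.mp hlt).le))

end cutoff

namespace Cell

/-! ### Integration by parts against a smoothed indicator of the element. -/

section IBP

variable {d : ℕ} (K : Cell d)

/-- The approximate surface density on the facet `p`. -/
def layer (ε : ℝ) (p : Vec d × ℝ) (x : Vec d) : ℝ := by
  classical
  exact stepDeriv ((p.2 - ⟪p.1, x⟫) / ε) / ε * ∏ q ∈ K.halfspaces.erase p, cut ε q x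

theorem layer_def [DecidableEq (Vec d × ℝ)] (ε : ℝ) (p : Vec d × ℝ) (x : Vec d) :
    K.layer ε p x =
      stepDeriv ((p.2 - ⟪p.1, x⟫) / ε) / ε * ∏ q ∈ K.halfspaces.erase p, cut ε q x := by
  unfold layer; congr!

theorem continuous_layer (ε : ℝ) (p : Vec d × ℝ) : Continuous (K.layer ε p) := by
  classical
  unfold layer
  refine ((continuous_stepDeriv.comp (by fun_prop)).div_const _).mul ?_
  exact continuous_finsetProd _ fun q _ => continuous_cut ε q

theorem mem_carrier_of_layer_ne_zero {ε : ℝ} (hε : 0 < ε) {p : Vec d × ℝ} {x : Vec d}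
    (h : K.layer ε p x ≠ 0) : x ∈ K.carrier := by
  classical
  rw [layer_def] at h
  have h1 := mem_of_prod_cut_ne_zero hε (right_ne_zero_of_mul h)
  have h2 : stepDeriv ((p.2 - ⟪p.1, x⟫) / ε) ≠ 0 :=
    (div_ne_zero_iff.mp (left_ne_zero_of_mul h)).1
  intro q hq
  by_cases hqp : q = p
  · have h3 := (mem_Icc_of_stepDeriv_ne_zero h2).1
    rw [hqp]
    by_contra hlt
    exact absurd h3 (not_le.mpr (div_neg_of_neg_of_pos (by linarith) hε))
  · exact h1 q (Finset.mem_erase.mpr ⟨hqp, hq⟩)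

theorem hasCompactSupport_of_ne_zero {f : Vec d → ℝ} (h : ∀ x, f x ≠ 0 → x ∈ K.carrier) :
    HasCompactSupport f :=
  HasCompactSupport.intro K.isCompact_carrier fun x hx => by
    by_contra h0; exact hx (h x h0)

/-- The product of the cut-offs vanishes outside the element, so integration by parts over the whole
space has no boundary term. Differentiating the factor of `p` produces `-⟪p.1, v⟫` times the layer
of `p`. -/
theorem integral_fderiv_mul_cut {g : Vec d → ℝ} (hg : ContDiff ℝ 1 g) (v : Vec d) {ε : ℝ}
    (hε : 0 < ε) :
    ∫ x, fderiv ℝ g x v * ∏ p ∈ K.halfspaces, cut ε p x =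
      ∑ p ∈ K.halfspaces, ⟪p.1, v⟫ * ∫ x, g x * K.layer ε p x := by
  classical
  have hcut : Continuous fun x => ∏ p ∈ K.halfspaces, cut ε p x :=
    continuous_finsetProd _ fun q _ => continuous_cut ε q
  have hg0 := hg.continuous
  have hg1 : Continuous fun x => fderiv ℝ g x v :=
    (hg.continuous_fderiv (by simp)).clm_apply continuous_const
  have hd : ∀ x, HasFDerivAt (fun x => ∏ p ∈ K.halfspaces, cut ε p x)
      (∑ p ∈ K.halfspaces, (∏ q ∈ K.halfspaces.erase p, cut ε q x) •
        (-(stepDeriv ((p.2 - ⟪p.1, x⟫) / ε) / ε) • innerSL ℝ p.1)) x := fun x =>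
    HasFDerivAt.finsetProd fun p _ => hasFDerivAt_cut ε p x
  have hdv : ∀ x, fderiv ℝ (fun x => ∏ p ∈ K.halfspaces, cut ε p x) x v =
      -∑ p ∈ K.halfspaces, ⟪p.1, v⟫ * K.layer ε p x := by
    intro x
    rw [(hd x).fderiv, sum_apply, ← Finset.sum_neg_distrib]
    refine Finset.sum_congr rfl fun p _ => ?_
    rw [layer_def]
    simp
    ring
  have hcs : ∀ f : Vec d → ℝ, Continuous f →
      Integrable fun x => f x * ∏ p ∈ K.halfspaces, cut ε p x := fun f hf =>
    (hf.mul hcut).integrable_of_hasCompactSupport (K.hasCompactSupport_of_ne_zero fun x hx =>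
      mem_of_prod_cut_ne_zero hε (right_ne_zero_of_mul hx))
  have hls : ∀ p, Integrable fun x => g x * K.layer ε p x := fun p =>
    (hg0.mul (K.continuous_layer ε p)).integrable_of_hasCompactSupport
      (K.hasCompactSupport_of_ne_zero fun x hx =>
        K.mem_carrier_of_layer_ne_zero hε (right_ne_zero_of_mul hx))
  have hsum : ∀ x, g x * fderiv ℝ (fun x => ∏ p ∈ K.halfspaces, cut ε p x) x v =
      -∑ p ∈ K.halfspaces, ⟪p.1, v⟫ * (g x * K.layer ε p x) := by
    intro x
    rw [hdv, mul_neg, Finset.mul_sum]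
    congr 1
    exact Finset.sum_congr rfl fun p _ => by ring
  have hibp := integral_mul_fderiv_eq_neg_fderiv_mul_of_integrable (μ := (volume : Measure (Vec d)))
    (f := g) (g := fun x => ∏ p ∈ K.halfspaces, cut ε p x) (v := v) (hcs _ hg1)
    (by simp_rw [hsum]; exact (integrable_finsetSum _ fun p _ => (hls p).const_mul _).neg)
    (hcs _ hg0) (fun x _ => hg.differentiable (by simp) x)
    (fun x _ => (hd x).differentiableAt)
  simp_rw [hsum] at hibp
  rw [integral_neg, integral_finsetSum _ fun p _ => (hls p).const_mul _, neg_inj] at hibp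
  rw [← hibp]
  exact Finset.sum_congr rfl fun p _ => integral_const_mul _ _

/-- Dominated convergence: the cut-offs tend to the indicator of the open element, which differs
from the closed one by a null set because a convex set has null frontier. -/
theorem tendsto_integral_mul_cut {f : Vec d → ℝ} (hf : Continuous f) :
    Tendsto (fun ε => ∫ x, f x * ∏ p ∈ K.halfspaces, cut ε p x) (𝓝[>] 0)
      (𝓝 (∫ x in K.carrier, f x)) := by
  obtain ⟨C, hC⟩ := K.isCompact_carrier.exists_bound_of_continuousOn hf.continuousOn
  rw [← setIntegral_congr_set K.openCarrier_ae_eq,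
    ← integral_indicator K.isOpen_openCarrier.measurableSet]
  apply tendsto_integral_filter_of_dominated_convergence (K.carrier.indicator fun _ => C)
  · filter_upwards with ε
    exact (hf.mul (continuous_finsetProd _ fun q _ => continuous_cut ε q)).aestronglyMeasurable
  · filter_upwards [self_mem_nhdsWithin] with ε hε
    filter_upwards with x
    by_cases hx : x ∈ K.carrier
    · rw [indicator_of_mem hx, norm_mul]
      have h1 := prod_cut_mem K.halfspaces ε x
      rw [Real.norm_of_nonneg h1.1]
      exact (mul_le_of_le_one_right (norm_nonneg _) h1.2).trans (hC x hx)
    · have : ∏ p ∈ K.halfspaces, cut ε p x = 0 := by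
        by_contra h; exact hx (mem_of_prod_cut_ne_zero hε h)
      rw [this, indicator_of_notMem hx]; simp
  · exact (integrable_indicator_iff K.measurableSet_carrier).mpr
      (integrableOn_const K.isCompact_carrier.measure_lt_top.ne)
  · filter_upwards with x
    by_cases hx : x ∈ K.openCarrier
    · rw [indicator_of_mem hx]
      apply tendsto_const_nhds.congr'
      filter_upwards [tendsto_prod_cut_one (x := fun _ => x) tendsto_const_nhds hx] with ε h
      rw [h, mul_one]
    · rw [indicator_of_notMem hx]
      obtain ⟨p, hp, hpx⟩ : ∃ p ∈ K.halfspaces, p.2 ≤ ⟪p.1, x⟫ := by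
        simpa [openCarrier] using hx
      apply tendsto_const_nhds.congr'
      filter_upwards [self_mem_nhdsWithin] with ε hε
      rw [Finset.prod_eq_zero hp (cut_eq_zero hε hpx), mul_zero]

end IBP

/-! ### The limit of vanishing smoothing: layers become surface measures. -/

section surfaceLimit

variable {m : ℕ} (K : Cell (m + 1))

/-- Fubini along the normal, with the normal coordinate written as `c - ε z.1`; the prefactor `ε` is
the Jacobian, and it will cancel the `1/ε` in the layer. -/
theorem integral_eq_integral_chart {F : Vec (m + 1) → ℝ} (hc : Continuous F)
    (hsupp : ∀ x, F x ≠ 0 → x ∈ K.carrier) {n : Vec (m + 1)} (hn : ‖n‖ = 1) (c : ℝ) {ε : ℝ}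
    (hε : 0 < ε) :
    ∫ x, F x = ∫ z : ℝ × Vec m, ε * F (chart hn (c - ε * z.1) z.2) ∂(volume.prod volume) := by
  have hint : Integrable F :=
    hc.integrable_of_hasCompactSupport (K.hasCompactSupport_of_ne_zero hsupp)
  have hmp := measurePreserving_frame hn
  have hint1 : Integrable (fun z : ℝ × Vec m => F (chart hn z.1 z.2)) (volume.prod volume) :=
    hmp.integrable_comp_of_integrable hint
  have hc2 : Continuous fun z : ℝ × Vec m => F (chart hn (c - ε * z.1) z.2) :=
    hc.comp ((continuous_chart hn).comp (by fun_prop : Continuous fun z : ℝ × Vec m =>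
      (c - ε * z.1, z.2)))
  obtain ⟨R, hR⟩ := K.isCompact_carrier.isBounded.exists_norm_le
  have hint2 : Integrable (fun z : ℝ × Vec m => F (chart hn (c - ε * z.1) z.2))
      (volume.prod volume) := by
    apply hc2.integrable_of_hasCompactSupport
    refine HasCompactSupport.intro
      ((isCompact_Icc (a := (c - R) / ε) (b := (c + R) / ε)).prod
        (isCompact_closedBall (0 : Vec m) R)) fun z hz => ?_
    by_contra h0
    have hx := hR _ (hsupp _ h0)
    refine hz ⟨?_, by
      simpa using (norm_le_norm_chart hn _ z.2).trans hx⟩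
    -- The normal coordinate of a point of norm at most `R` is at most `R` in absolute value, which
    -- confines `z.1`.
    have h1 : |⟪n, chart hn (c - ε * z.1) z.2⟫| ≤ R :=
      (abs_real_inner_le_norm _ _).trans (by rw [hn, one_mul]; exact hx)
    rw [inner_chart] at h1
    rw [mem_Icc, div_le_iff₀ hε, le_div_iff₀ hε]
    constructor <;> nlinarith [abs_le.mp h1]
  rw [integral_const_mul, integral_prod _ hint2,
    ← hmp.map_eq, integral_map hmp.aemeasurable hc.aestronglyMeasurable]
  change ∫ z : ℝ × Vec m, F (chart hn z.1 z.2) ∂(volume.prod volume) = _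
  rw [integral_prod _ hint1]
  have h3 := Measure.integral_comp_mul_left
    (fun s => (fun s => ∫ y : Vec m, F (chart hn s y)) (c - s)) ε
  rw [integral_sub_left_eq_self (fun s => ∫ y : Vec m, F (chart hn s y)) volume c] at h3
  simp only at h3
  rw [h3, abs_of_pos (inv_pos.mpr hε), smul_eq_mul, mul_inv_cancel_left₀ hε.ne']

theorem integral_mul_layer {g : Vec (m + 1) → ℝ} (hg : Continuous g) {p : Vec (m + 1) × ℝ}
    (hp : p ∈ K.halfspaces) {ε : ℝ} (hε : 0 < ε) :
    ∫ x, g x * K.layer ε p x =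
      ∫ z : ℝ × Vec m, ε * (g (chart (K.unit_normal p hp) (p.2 - ε * z.1) z.2) *
        K.layer ε p (chart (K.unit_normal p hp) (p.2 - ε * z.1) z.2)) ∂(volume.prod volume) :=
  K.integral_eq_integral_chart (hg.mul (K.continuous_layer ε p))
    (fun _ hx => K.mem_carrier_of_layer_ne_zero hε (right_ne_zero_of_mul hx)) _ _ hε

/-- In the rescaled normal variable the layer of `p` becomes `stepDeriv z.1`, of total mass one,
times the cut-offs of the other constraints. The latter tend almost everywhere to the indicator of
the facet. -/
theorem tendsto_integral_mul_layer {g : Vec (m + 1) → ℝ} (hg : Continuous g)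
    {p : Vec (m + 1) × ℝ} (hp : p ∈ K.halfspaces) :
    Tendsto (fun ε => ∫ x, g x * K.layer ε p x) (𝓝[>] 0)
      (𝓝 (∫ x in K.facet p, g x ∂(Measure.euclideanHausdorffMeasure m))) := by
  classical
  set hn := K.unit_normal p hp
  have hval : ∀ ε : ℝ, 0 < ε → ∀ z : ℝ × Vec m,
      ε * (g (chart hn (p.2 - ε * z.1) z.2) * K.layer ε p (chart hn (p.2 - ε * z.1) z.2)) =
      stepDeriv z.1 * (g (chart hn (p.2 - ε * z.1) z.2) *
        ∏ q ∈ K.halfspaces.erase p, cut ε q (chart hn (p.2 - ε * z.1) z.2)) := by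
    intro ε hε z
    rw [layer_def, inner_chart, show (p.2 - (p.2 - ε * z.1)) / ε = z.1 by field_simp; ring]
    field_simp
  have hlim : ∫ x in K.facet p, g x ∂(Measure.euclideanHausdorffMeasure m) =
      ∫ z : ℝ × Vec m, stepDeriv z.1 *
        (chart hn p.2 ⁻¹' K.facet p).indicator (fun y => g (chart hn p.2 y)) z.2
        ∂(volume.prod volume) := by
    rw [integral_prod_mul stepDeriv, integral_stepDeriv, one_mul, integral_indicator
      ((K.isCompact_chart_preimage hn).measurableSet), K.integral_facet hn]
  rw [hlim]
  obtain ⟨C, hC⟩ := K.isCompact_carrier.exists_bound_of_continuousOn hg.continuousOn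
  obtain ⟨D, hD⟩ := (isCompact_Icc (a := (0 : ℝ)) (b := 1)).exists_bound_of_continuousOn
    continuous_stepDeriv.continuousOn
  obtain ⟨R, hR⟩ := K.isCompact_carrier.isBounded.exists_norm_le
  have hD0 : 0 ≤ D := (norm_nonneg _).trans (hD 0 (by simp))
  have key : Tendsto (fun ε => ∫ z : ℝ × Vec m, ε * (g (chart hn (p.2 - ε * z.1) z.2) *
        K.layer ε p (chart hn (p.2 - ε * z.1) z.2)) ∂(volume.prod volume)) (𝓝[>] 0)
      (𝓝 (∫ z : ℝ × Vec m, stepDeriv z.1 *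
        (chart hn p.2 ⁻¹' K.facet p).indicator (fun y => g (chart hn p.2 y)) z.2
        ∂(volume.prod volume))) := by
    apply tendsto_integral_filter_of_dominated_convergence
      -- The dominating function does not depend on `ε`: `stepDeriv` lives on `[0, 1]`, and the
      -- tangential coordinate is bounded because the layer vanishes off the element.
      ((Icc (0 : ℝ) 1 ×ˢ Metric.closedBall (0 : Vec m) R).indicator fun _ => D * C)
    · filter_upwards with ε
      have h1 : Continuous fun z : ℝ × Vec m => chart hn (p.2 - ε * z.1) z.2 :=
        (continuous_chart hn).comp (by fun_prop : Continuous fun z : ℝ × Vec m =>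
          (p.2 - ε * z.1, z.2))
      exact (continuous_const.mul ((hg.comp h1).mul
        ((K.continuous_layer ε p).comp h1))).aestronglyMeasurable
    · filter_upwards [self_mem_nhdsWithin] with ε hε
      filter_upwards with z
      by_cases h0 : K.layer ε p (chart hn (p.2 - ε * z.1) z.2) = 0
      · rw [h0, mul_zero, mul_zero, norm_zero]
        refine indicator_nonneg (fun z _ => mul_nonneg hD0 ?_) z
        obtain ⟨x, hx⟩ := K.openCarrier_nonempty
        exact (norm_nonneg _).trans (hC x (K.openCarrier_subset hx))
      · have hx := K.mem_carrier_of_layer_ne_zero hε h0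
        have hz1 : z.1 ∈ Icc (0 : ℝ) 1 := by
          apply mem_Icc_of_stepDeriv_ne_zero
          intro hz
          have := hval ε hε z
          rw [layer_def, inner_chart,
            show (p.2 - (p.2 - ε * z.1)) / ε = z.1 by
              rw [sub_sub_cancel, mul_div_cancel_left₀ _ (ne_of_gt hε)], hz] at h0
          simp at h0
        have hz2 : z.2 ∈ Metric.closedBall (0 : Vec m) R := by
          simpa using (norm_le_norm_chart hn _ z.2).trans (hR _ hx)
        have hz : z ∈ Icc (0 : ℝ) 1 ×ˢ Metric.closedBall (0 : Vec m) R := ⟨hz1, hz2⟩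
        rw [hval ε hε, indicator_of_mem hz, norm_mul, norm_mul]
        have h1 := prod_cut_mem (K.halfspaces.erase p) ε (chart hn (p.2 - ε * z.1) z.2)
        rw [Real.norm_of_nonneg h1.1]
        exact mul_le_mul (hD _ hz1)
          ((mul_le_of_le_one_right (norm_nonneg _) h1.2).trans (hC _ hx))
          (mul_nonneg (norm_nonneg _) h1.1) hD0
    · refine (integrable_indicator_iff
        (measurableSet_Icc.prod Metric.isClosed_closedBall.measurableSet)).mpr
        (integrableOn_const ?_)
      exact (isCompact_Icc.prod (isCompact_closedBall (0 : Vec m) R)).measure_lt_top.ne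
    · have hae := Measure.quasiMeasurePreserving_snd (μ := (volume : Measure ℝ)) |>.ae
        (K.chart_relFacet_ae_eq hn hp)
      filter_upwards [hae] with z hz
      have hx : Tendsto (fun ε : ℝ => chart hn (p.2 - ε * z.1) z.2) (𝓝[>] 0)
          (𝓝 (chart hn p.2 z.2)) := by
        have h1 : Continuous fun ε : ℝ => chart hn (p.2 - ε * z.1) z.2 :=
          (continuous_chart hn).comp (by fun_prop : Continuous fun ε : ℝ =>
            (p.2 - ε * z.1, z.2))
        simpa using (h1.tendsto 0).mono_left nhdsWithin_le_nhds
      have hg' := (hg.tendsto _).comp hx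
      by_cases hF : z.2 ∈ chart hn p.2 ⁻¹' K.facet p
      · have hF' : chart hn p.2 z.2 ∈ K.relFacet p := by
          have : (chart hn p.2 ⁻¹' K.relFacet p) z.2 := by rw [hz]; exact hF
          exact this
        rw [indicator_of_mem hF]
        refine (tendsto_const_nhds.mul hg').congr' ?_
        filter_upwards [self_mem_nhdsWithin, tendsto_prod_cut_one (s := K.halfspaces.erase p) hx
          fun q hq => hF'.2 q (Finset.mem_of_mem_erase hq) (Finset.ne_of_mem_erase hq)]
          with ε hε h1
        rw [hval ε hε, h1, mul_one]; rfl
      · rw [indicator_of_notMem hF, mul_zero]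
        obtain ⟨q, hq, hqx⟩ : ∃ q ∈ K.halfspaces, q.2 < ⟪q.1, chart hn p.2 z.2⟫ := by
          by_contra! hcon
          exact hF ⟨hcon, inner_chart hn _ _⟩
        have hqp : q ≠ p := by
          rintro rfl
          rw [inner_chart] at hqx
          exact hqx.false
        refine tendsto_const_nhds.congr' ?_
        filter_upwards [self_mem_nhdsWithin, tendsto_prod_cut_zero hx
          (Finset.mem_erase.mpr ⟨hqp, hq⟩) hqx] with ε hε h1
        rw [hval ε hε, h1]; simp
  refine key.congr' ?_
  filter_upwards [self_mem_nhdsWithin] with ε hε using (K.integral_mul_layer hg hp hε).symm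

/-- The divergence theorem, for the partial derivative in the direction `v`. -/
theorem integral_fderiv {g : Vec (m + 1) → ℝ} (hg : ContDiff ℝ 1 g) (v : Vec (m + 1)) :
    ∫ x in K.carrier, fderiv ℝ g x v =
      ∑ p ∈ K.halfspaces, ⟪p.1, v⟫ *
        ∫ x in K.facet p, g x ∂(Measure.euclideanHausdorffMeasure m) := by
  have hg1 : Continuous fun x => fderiv ℝ g x v :=
    (hg.continuous_fderiv (by simp)).clm_apply continuous_const
  refine tendsto_nhds_unique (K.tendsto_integral_mul_cut hg1) ?_
  refine (tendsto_finsetSum _ fun p hp =>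
    (K.tendsto_integral_mul_layer hg.continuous hp).const_mul ⟪p.1, v⟫).congr' ?_
  filter_upwards [self_mem_nhdsWithin] with ε hε
  exact (K.integral_fderiv_mul_cut hg v hε).symm

/-- The divergence theorem. -/
theorem integral_divergence {w : Vec (m + 1) → Vec (m + 1)} (hw : ContDiff ℝ 1 w) :
    ∫ x in K.carrier, divergence w x =
      ∑ p ∈ K.halfspaces,
        ∫ x in K.facet p, ⟪w x, p.1⟫ ∂(Measure.euclideanHausdorffMeasure m) := by
  have hwa : ∀ a, ContDiff ℝ 1 fun x => w x a := fun a =>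
    (EuclideanSpace.proj (𝕜 := ℝ) a).contDiff.comp hw
  have hdiv : ∀ x, divergence w x =
      ∑ a, fderiv ℝ (fun x => w x a) x (EuclideanSpace.single a 1) := by
    intro x
    unfold divergence Matrix.trace
    refine Finset.sum_congr rfl fun a _ => ?_
    have h1 := (EuclideanSpace.proj (𝕜 := ℝ) a).hasFDerivAt.comp x
      (hw.differentiable (by simp) x).hasFDerivAt
    change _ = fderiv ℝ (⇑(EuclideanSpace.proj (𝕜 := ℝ) a) ∘ w) x _
    rw [h1.fderiv]
    rfl
  simp_rw [hdiv]
  rw [integral_finsetSum]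
  · simp_rw [K.integral_fderiv (hwa _)]
    rw [Finset.sum_comm]
    refine Finset.sum_congr rfl fun p hp => ?_
    have hsum : ∀ x, ⟪w x, p.1⟫ = ∑ a, p.1 a * w x a := fun x => by
      simp [PiLp.inner_apply]
    simp_rw [hsum]
    rw [integral_finsetSum]
    · refine Finset.sum_congr rfl fun a _ => ?_
      rw [integral_const_mul, real_inner_comm, EuclideanSpace.inner_single_left]
      simp
    · intro a _
      exact (K.integrableOn_facet (K.unit_normal p hp) (hwa a).continuous.continuousOn).const_mul _
  · intro a _
    exact K.integrableOn_carrier (((hwa a).continuous_fderiv (by simp)).clm_apply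
      continuous_const).continuousOn

end surfaceLimit

end Cell

/-! ### Combinatorics of the mesh -/

namespace Cell

variable {d : ℕ} {K K' : Cell d} {p q : Vec d × ℝ} {x : Vec d}

theorem eventually_sub_mem_openCarrier (hp : p ∈ K.halfspaces) (hx : x ∈ K.relFacet p) :
    ∀ᶠ t : ℝ in 𝓝[>] 0, x - t • p.1 ∈ K.openCarrier := by
  have hcont : Tendsto (fun t : ℝ => x - t • p.1) (𝓝[>] 0) (𝓝 x) := by
    have : Continuous fun t : ℝ => x - t • p.1 := by fun_prop
    simpa using (this.tendsto 0).mono_left nhdsWithin_le_nhds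
  filter_upwards [hcont.eventually (K.eventually_mem_relFacet hx), self_mem_nhdsWithin]
    with t ht ht0 q hq
  by_cases h : q = p
  · have ht0' : (0 : ℝ) < t := ht0
    rw [h, inner_sub_right, inner_smul_right, real_inner_self_eq_norm_sq, K.unit_normal p hp, hx.1]
    linarith
  · exact ht q hq h

/-- From a relative interior point one can move a little in every tangential direction, and in its
opposite, without leaving the facet and hence `K'`. As `q` is active at `x`, its normal is
orthogonal to all of these directions, so it is `±p.1`. -/
theorem eq_or_eq_neg_of_facet_subset (hx : x ∈ K.relFacet p) (hp : p ∈ K.halfspaces)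
    (hsub : K.facet p ⊆ K'.carrier) (hq : q ∈ K'.halfspaces) (hqx : ⟪q.1, x⟫ = q.2) :
    q = p ∨ q = -p := by
  have hnp := K.unit_normal p hp
  have hnq := K'.unit_normal q hq
  have hle : ∀ v : Vec d, ⟪p.1, v⟫ = 0 → ⟪q.1, v⟫ ≤ 0 := by
    intro v hv
    have hcont : Tendsto (fun t : ℝ => x + t • v) (𝓝[>] 0) (𝓝 x) := by
      have : Continuous fun t : ℝ => x + t • v := by fun_prop
      simpa using (this.tendsto 0).mono_left nhdsWithin_le_nhds
    obtain ⟨t, ht, ht0⟩ :=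
      ((hcont.eventually (K.eventually_mem_relFacet hx)).and self_mem_nhdsWithin).exists
    have ht0' : (0 : ℝ) < t := ht0
    have hmem : x + t • v ∈ K.relFacet p :=
      ⟨by rw [inner_add_right, inner_smul_right, hv, hx.1]; simp, ht⟩
    have := hsub (K.relFacet_subset hmem) q hq
    rw [inner_add_right, inner_smul_right, hqx] at this
    nlinarith
  have hzero : ∀ v : Vec d, ⟪p.1, v⟫ = 0 → ⟪q.1, v⟫ = 0 := by
    intro v hv
    refine le_antisymm (hle v hv) ?_
    have := hle (-v) (by rw [inner_neg_right, hv, neg_zero])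
    rw [inner_neg_right] at this
    linarith
  have hpp : ⟪p.1, p.1⟫ = 1 := by rw [real_inner_self_eq_norm_sq, hnp]; norm_num
  have hqq : ⟪q.1, q.1⟫ = 1 := by rw [real_inner_self_eq_norm_sq, hnq]; norm_num
  set c := ⟪p.1, q.1⟫ with hc
  have h1 : ⟪p.1, q.1 - c • p.1⟫ = 0 := by
    rw [inner_sub_right, inner_smul_right, hpp, ← hc]; ring
  have h2 : q.1 = c • p.1 := by
    rw [← sub_eq_zero, ← inner_self_eq_zero (𝕜 := ℝ), inner_sub_left, hzero _ h1,
      inner_smul_left, h1]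
    simp
  have h3 : c * c = 1 := by
    have := hqq
    rw [h2, inner_smul_left, inner_smul_right, hpp] at this
    simpa using this
  have h4 : q.2 = c * p.2 := by
    rw [← hqx, h2, inner_smul_left, hx.1]; simp
  rcases mul_self_eq_one_iff.mp h3 with h | h
  · left
    exact Prod.ext (by rw [h2, h, one_smul]) (by rw [h4, h, one_mul])
  · right
    exact Prod.ext (by rw [h2, h, neg_one_smul]; rfl) (by rw [h4, h, neg_one_mul]; rfl)

theorem neg_notMem_halfspaces (hp : p ∈ K.halfspaces) : -p ∉ K.halfspaces := by
  intro hn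
  obtain ⟨x, hx⟩ := K.openCarrier_nonempty
  have h1 := hx p hp
  have h2 := hx _ hn
  rw [Prod.fst_neg, Prod.snd_neg, inner_neg_left] at h2
  linarith

/-- A second active constraint of `K'` at `x` would also be `±p`, hence `q` or `-q`; an element
having both a constraint and its negative would have empty interior. -/
theorem mem_relFacet_of_facet_subset (hx : x ∈ K.relFacet p) (hp : p ∈ K.halfspaces)
    (hsub : K.facet p ⊆ K'.carrier) (hq : q ∈ K'.halfspaces) (hqx : ⟪q.1, x⟫ = q.2) :
    x ∈ K'.relFacet q := by
  refine ⟨hqx, fun r hr hrq => lt_of_le_of_ne (hsub (K.relFacet_subset hx) r hr) fun hrx => ?_⟩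
  rcases eq_or_eq_neg_of_facet_subset hx hp hsub hq hqx with h1 | h1 <;>
    rcases eq_or_eq_neg_of_facet_subset hx hp hsub hr hrx with h2 | h2
  · exact hrq (h2.trans h1.symm)
  · exact neg_notMem_halfspaces hq (by rw [h1, ← h2]; exact hr)
  · exact neg_notMem_halfspaces hr (by rw [h2, ← h1]; exact hq)
  · exact hrq (h2.trans h1.symm)

/-- With equal normals, both open elements would contain the points just inside the face near `x`.
The pair `-p` describes the same hyperplane with the opposite normal. -/
theorem eq_neg_of_facet_subset (hdisj : Disjoint K.openCarrier K'.openCarrier)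
    (hx : x ∈ K.relFacet p) (hp : p ∈ K.halfspaces)
    (hsub : K.facet p ⊆ K'.carrier) (hq : q ∈ K'.halfspaces) (hqx : ⟪q.1, x⟫ = q.2) :
    q = -p := by
  rcases eq_or_eq_neg_of_facet_subset hx hp hsub hq hqx with h | h
  · exfalso
    have hx' := mem_relFacet_of_facet_subset hx hp hsub hq hqx
    obtain ⟨t, h1, h2⟩ := ((eventually_sub_mem_openCarrier hp hx).and
      (eventually_sub_mem_openCarrier hq hx')).exists
    rw [h] at h2
    exact hdisj.notMem_of_mem_left h1 h2
  · exact h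

/-- For `y` in the facet, the segment from `y` to `x` can be prolonged slightly beyond `x` within
the facet; `x` is then inside a segment ending at `y`, and extremality puts `y` in `E`. -/
theorem facet_subset_of_isExtreme {E : Set (Vec d)} (hE : IsExtreme ℝ K.carrier E)
    (hx : x ∈ K.relFacet p) (hxE : x ∈ E) : K.facet p ⊆ E := by
  intro y hy
  have hcont : Tendsto (fun t : ℝ => x + t • (x - y)) (𝓝[>] 0) (𝓝 x) := by
    have : Continuous fun t : ℝ => x + t • (x - y) := by fun_prop
    simpa using (this.tendsto 0).mono_left nhdsWithin_le_nhds
  obtain ⟨t, ht, ht0⟩ :=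
    ((hcont.eventually (K.eventually_mem_relFacet hx)).and self_mem_nhdsWithin).exists
  have ht0' : (0 : ℝ) < t := ht0
  have hz : x + t • (x - y) ∈ K.relFacet p :=
    ⟨by rw [inner_add_right, inner_smul_right, inner_sub_right, hx.1, hy.2]; ring, ht⟩
  refine hE.left_mem_of_mem_openSegment hy.1 (K.relFacet_subset hz).1 hxE ?_
  refine ⟨t / (1 + t), 1 / (1 + t), by positivity, by positivity, by field_simp; ring, ?_⟩
  rw [← smul_right_inj (show (1 + t) ≠ 0 by positivity), smul_add, smul_smul, smul_smul,
    mul_div_cancel₀ _ (by positivity), mul_div_cancel₀ _ (by positivity)]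
  module

theorem exists_active_of_notMem_openCarrier (hx : x ∈ K.carrier) (hx' : x ∉ K.openCarrier) :
    ∃ q ∈ K.halfspaces, ⟪q.1, x⟫ = q.2 := by
  by_contra! h
  exact hx' fun q hq => lt_of_le_of_ne (hx q hq) (h q hq)

end Cell

namespace Mesh

variable {d : ℕ} {M : Mesh d} {i j : Fin M.numCells} {p : Vec d × ℝ} {x : Vec d}

theorem disjoint_openCarrier (hij : i ≠ j) :
    Disjoint (M.cell i).openCarrier (M.cell j).openCarrier := by
  rw [← Cell.interior_carrier, ← Cell.interior_carrier]
  exact M.disjoint_interior i j hij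

theorem disjoint_openCarrier_carrier (hij : i ≠ j) :
    Disjoint (M.cell i).openCarrier (M.cell j).carrier := by
  have h : (M.cell j).carrier ⊆ closure (M.cell j).openCarrier := by
    rw [← Cell.interior_carrier,
      (M.cell j).convex_carrier.closure_interior_eq_closure_of_nonempty_interior
        (M.cell j).nonempty_interior]
    exact subset_closure
  exact ((disjoint_openCarrier hij).closure_right
    (M.cell i).isOpen_openCarrier).mono_right h

/-- This is where the absence of hanging nodes enters. The intersection of the two elements is
extreme in both, so a single relative interior point forces each of the two facets into the other
element. -/
theorem isNeighbor_of_mem_carrier (hij : j ≠ i) (hp : p ∈ (M.cell i).halfspaces)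
    (hx : x ∈ (M.cell i).relFacet p) (hxj : x ∈ (M.cell j).carrier) : M.IsNeighbor i p j := by
  have hE := M.face_to_face i j hij.symm
  have hE' := M.face_to_face j i hij
  have hxi := (Cell.relFacet_subset _ hx).1
  have hsub : (M.cell i).facet p ⊆ (M.cell j).carrier :=
    (Cell.facet_subset_of_isExtreme hE hx ⟨hxi, hxj⟩).trans inter_subset_right
  obtain ⟨q, hq, hqx⟩ := Cell.exists_active_of_notMem_openCarrier hxj
    ((disjoint_openCarrier_carrier hij).notMem_of_mem_right hxi)
  have hqp := Cell.eq_neg_of_facet_subset (disjoint_openCarrier hij.symm) hx hp hsub hq hqx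
  have hx' := Cell.mem_relFacet_of_facet_subset hx hp hsub hq hqx
  have hsub' : (M.cell j).facet q ⊆ (M.cell i).carrier :=
    (Cell.facet_subset_of_isExtreme hE' hx' ⟨hxj, hxi⟩).trans inter_subset_right
  refine ⟨hij, q, hq, Subset.antisymm (fun y hy => ⟨hsub' hy, ?_⟩) (fun y hy => ⟨hsub hy, ?_⟩)⟩
  · have := hy.2
    rw [hqp, Prod.fst_neg, Prod.snd_neg, inner_neg_left] at this
    linarith
  · have := hy.2
    rw [hqp, Prod.fst_neg, Prod.snd_neg, inner_neg_left, this]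

theorem IsNeighbor.neg_mem (h : M.IsNeighbor i p j) (hp : p ∈ (M.cell i).halfspaces) :
    -p ∈ (M.cell j).halfspaces ∧ (M.cell j).facet (-p) = (M.cell i).facet p := by
  obtain ⟨hij, q, hq, hqp⟩ := h
  obtain ⟨x, hx⟩ := (M.cell i).relFacet_nonempty hp
  have hsub : (M.cell i).facet p ⊆ (M.cell j).carrier := by
    rw [← hqp]; exact Cell.facet_subset _ _
  have hxq : x ∈ (M.cell j).facet q := by rw [hqp]; exact Cell.relFacet_subset _ hx
  have := Cell.eq_neg_of_facet_subset (disjoint_openCarrier hij.symm) hx hp hsub hq hxq.2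
  exact this ▸ ⟨hq, hqp⟩

theorem IsNeighbor.mem_relFacet (h : M.IsNeighbor i p j) (hp : p ∈ (M.cell i).halfspaces)
    (hx : x ∈ (M.cell i).relFacet p) : x ∈ (M.cell j).relFacet (-p) := by
  obtain ⟨h1, h2⟩ := h.neg_mem hp
  refine Cell.mem_relFacet_of_facet_subset hx hp (by rw [← h2]; exact Cell.facet_subset _ _) h1 ?_
  rw [Prod.fst_neg, Prod.snd_neg, inner_neg_left, hx.1]

/-- Both candidates lie on the side of the face opposite to `i`, so near a relative interior point
their interiors would meet. Uniqueness makes the arbitrary choice in `neighbor` harmless and the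
relation symmetric. -/
theorem IsNeighbor.unique {j' : Fin M.numCells} (h : M.IsNeighbor i p j)
    (h' : M.IsNeighbor i p j') (hp : p ∈ (M.cell i).halfspaces) : j = j' := by
  by_contra hne
  obtain ⟨x, hx⟩ := (M.cell i).relFacet_nonempty hp
  obtain ⟨t, h1, h2⟩ := ((Cell.eventually_sub_mem_openCarrier (h.neg_mem hp).1
    (h.mem_relFacet hp hx)).and (Cell.eventually_sub_mem_openCarrier (h'.neg_mem hp).1
    (h'.mem_relFacet hp hx))).exists
  exact (disjoint_openCarrier hne).notMem_of_mem_left h1 h2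

theorem IsNeighbor.symm (h : M.IsNeighbor i p j) (hp : p ∈ (M.cell i).halfspaces) :
    M.IsNeighbor j (-p) i :=
  ⟨h.1.symm, p, hp, (h.neg_mem hp).2.symm⟩

theorem isNeighbor_of_neighbor (h : M.neighbor i p = some j) : M.IsNeighbor i p j := by
  unfold neighbor at h
  split_ifs at h with hex
  obtain rfl := Option.some.inj h
  exact hex.choose_spec

theorem neighbor_eq_some_iff (hp : p ∈ (M.cell i).halfspaces) :
    M.neighbor i p = some j ↔ M.IsNeighbor i p j := by
  refine ⟨isNeighbor_of_neighbor, fun h => ?_⟩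
  have hex : ∃ j, M.IsNeighbor i p j := ⟨j, h⟩
  unfold neighbor
  rw [dif_pos hex]
  exact congrArg some (hex.choose_spec.unique h hp)

theorem neighbor_symm (hp : p ∈ (M.cell i).halfspaces) (h : M.neighbor i p = some j) :
    M.neighbor j (-p) = some i :=
  (neighbor_eq_some_iff ((isNeighbor_of_neighbor h).neg_mem hp).1).mpr
    ((isNeighbor_of_neighbor h).symm hp)

theorem neg_mem_halfspaces (hp : p ∈ (M.cell i).halfspaces) (h : M.neighbor i p = some j) :
    -p ∈ (M.cell j).halfspaces :=
  ((isNeighbor_of_neighbor h).neg_mem hp).1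

theorem facet_neg (hp : p ∈ (M.cell i).halfspaces) (h : M.neighbor i p = some j) :
    (M.cell j).facet (-p) = (M.cell i).facet p :=
  ((isNeighbor_of_neighbor h).neg_mem hp).2

theorem facet_subset_neighbor (hp : p ∈ (M.cell i).halfspaces) (h : M.neighbor i p = some j) :
    (M.cell i).facet p ⊆ (M.cell j).carrier := by
  rw [← facet_neg hp h]
  exact Cell.facet_subset _ _

theorem facetInt_neg (hp : p ∈ (M.cell i).halfspaces) (h : M.neighbor i p = some j)
    (g : Vec d → ℝ) : M.facetInt j (-p) g = M.facetInt i p g := by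
  unfold facetInt; rw [facet_neg hp h]

theorem faceDiam_neg (hp : p ∈ (M.cell i).halfspaces) (h : M.neighbor i p = some j) :
    M.faceDiam j (-p) = M.faceDiam i p := by
  unfold faceDiam; rw [facet_neg hp h]

theorem neighbor_ne (h : M.neighbor i p = some j) : j ≠ i := (isNeighbor_of_neighbor h).1

theorem notMem_carrier_of_neighbor {l : Fin M.numCells} (hp : p ∈ (M.cell i).halfspaces)
    (hx : x ∈ (M.cell i).relFacet p) (hl : l ≠ i) (hlj : M.neighbor i p ≠ some l) :
    x ∉ (M.cell l).carrier := fun hxl =>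
  hlj ((neighbor_eq_some_iff hp).mpr (isNeighbor_of_mem_carrier hl hp hx hxl))

/-! ### Sums over faces -/

variable {G H : Fin M.numCells → Vec d × ℝ → ℝ}

/-- The value on the other side of a face. -/
def opposite (G : Fin M.numCells → Vec d × ℝ → ℝ) (i : Fin M.numCells) (p : Vec d × ℝ) : ℝ :=
  match M.neighbor i p with
  | some j => G j (-p)
  | none => 0

theorem opposite_eq (h : M.neighbor i p = some j) : opposite G i p = G j (-p) := by
  unfold opposite; rw [h]

theorem interiorFaceSum_mono
    (h : ∀ i, ∀ p ∈ (M.cell i).halfspaces, ∀ j, M.neighbor i p = some j → G i p ≤ H i p) :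
    M.interiorFaceSum G ≤ M.interiorFaceSum H := by
  refine Finset.sum_le_sum fun i _ => Finset.sum_le_sum fun p hp => ?_
  rcases hn : M.neighbor i p with _ | j
  · simp
  · simp only
    split_ifs
    · exact h i p hp j hn
    · rfl

theorem interiorFaceSum_congr
    (h : ∀ i, ∀ p ∈ (M.cell i).halfspaces, ∀ j, M.neighbor i p = some j → G i p = H i p) :
    M.interiorFaceSum G = M.interiorFaceSum H :=
  le_antisymm (interiorFaceSum_mono fun i p hp j hj => (h i p hp j hj).le)
    (interiorFaceSum_mono fun i p hp j hj => (h i p hp j hj).ge)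

theorem boundaryFaceSum_mono
    (h : ∀ i, ∀ p ∈ (M.cell i).halfspaces, M.neighbor i p = none → G i p ≤ H i p) :
    M.boundaryFaceSum G ≤ M.boundaryFaceSum H := by
  refine Finset.sum_le_sum fun i _ => Finset.sum_le_sum fun p hp => ?_
  rcases hn : M.neighbor i p with _ | j
  · exact h i p hp hn
  · simp

theorem boundaryFaceSum_congr
    (h : ∀ i, ∀ p ∈ (M.cell i).halfspaces, M.neighbor i p = none → G i p = H i p) :
    M.boundaryFaceSum G = M.boundaryFaceSum H :=
  le_antisymm (boundaryFaceSum_mono fun i p hp hj => (h i p hp hj).le)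
    (boundaryFaceSum_mono fun i p hp hj => (h i p hp hj).ge)

theorem interiorFaceSum_add :
    M.interiorFaceSum (fun i p => G i p + H i p) = M.interiorFaceSum G + M.interiorFaceSum H := by
  simp only [interiorFaceSum, ← Finset.sum_add_distrib]
  refine Finset.sum_congr rfl fun i _ => Finset.sum_congr rfl fun p _ => ?_
  rcases M.neighbor i p with _ | j
  · simp
  · simp only; split_ifs <;> simp

theorem boundaryFaceSum_add :
    M.boundaryFaceSum (fun i p => G i p + H i p) = M.boundaryFaceSum G + M.boundaryFaceSum H := by
  simp only [boundaryFaceSum, ← Finset.sum_add_distrib]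
  refine Finset.sum_congr rfl fun i _ => Finset.sum_congr rfl fun p _ => ?_
  rcases M.neighbor i p with _ | j <;> simp

theorem interiorFaceSum_const_mul (c : ℝ) :
    M.interiorFaceSum (fun i p => c * G i p) = c * M.interiorFaceSum G := by
  simp only [interiorFaceSum, Finset.mul_sum]
  refine Finset.sum_congr rfl fun i _ => Finset.sum_congr rfl fun p _ => ?_
  rcases M.neighbor i p with _ | j
  · simp
  · simp only; split_ifs <;> simp

theorem boundaryFaceSum_const_mul (c : ℝ) :
    M.boundaryFaceSum (fun i p => c * G i p) = c * M.boundaryFaceSum G := by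
  simp only [boundaryFaceSum, Finset.mul_sum]
  refine Finset.sum_congr rfl fun i _ => Finset.sum_congr rfl fun p _ => ?_
  rcases M.neighbor i p with _ | j <;> simp

theorem interiorFaceSum_zero : M.interiorFaceSum (fun _ _ => 0) = 0 := by
  simpa using interiorFaceSum_const_mul (M := M) (G := fun _ _ => 0) 0

theorem boundaryFaceSum_zero : M.boundaryFaceSum (fun _ _ => 0) = 0 := by
  simpa using boundaryFaceSum_const_mul (M := M) (G := fun _ _ => 0) 0

/-- The sum over the sides of all faces, rearranged as a sum over faces. -/
theorem sum_facets_eq (G : Fin M.numCells → Vec d × ℝ → ℝ) :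
    ∑ i, ∑ p ∈ (M.cell i).halfspaces, G i p =
      M.interiorFaceSum (fun i p => G i p + opposite G i p) + M.boundaryFaceSum G := by
  let S : Finset (Σ _ : Fin M.numCells, Vec d × ℝ) := Finset.univ.sigma fun i => (M.cell i).halfspaces
  -- The involution exchanging the two sides of an interior face and fixing boundary faces.
  let σ : (Σ _ : Fin M.numCells, Vec d × ℝ) → (Σ _ : Fin M.numCells, Vec d × ℝ) := fun z =>
    match M.neighbor z.1 z.2 with
    | some j => ⟨j, -z.2⟩
    | none => z
  have hσS : ∀ z ∈ S, σ z ∈ S := by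
    rintro ⟨i, p⟩ hz
    have hp : p ∈ (M.cell i).halfspaces := by simpa [S] using hz
    rcases h : M.neighbor i p with _ | j
    · simpa [σ, h] using hz
    · simpa [σ, h, S] using neg_mem_halfspaces hp h
  have hσσ : ∀ z ∈ S, σ (σ z) = z := by
    rintro ⟨i, p⟩ hz
    have hp : p ∈ (M.cell i).halfspaces := by simpa [S] using hz
    rcases h : M.neighbor i p with _ | j
    · simp [σ, h]
    · simp [σ, h, neighbor_symm hp h]
  -- `f` keeps the contributions of the sides with the larger index; reindexing by `σ` moves them to
  -- the sides with the smaller index, where `interiorFaceSum` counts.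
  let f : (Σ _ : Fin M.numCells, Vec d × ℝ) → ℝ := fun z =>
    match M.neighbor z.1 z.2 with
    | some j => if j < z.1 then G z.1 z.2 else 0
    | none => 0
  have hinv : ∑ z ∈ S, f z = ∑ z ∈ S, f (σ z) :=
    Finset.sum_nbij' σ σ hσS hσS hσσ hσσ fun z hz => by rw [hσσ z hz]
  have hfσ : ∀ i, ∀ p ∈ (M.cell i).halfspaces, f (σ ⟨i, p⟩) =
      match M.neighbor i p with
      | some j => if i < j then opposite G i p else 0
      | none => 0 := by
    intro i p hp
    rcases h : M.neighbor i p with _ | j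
    · simp [f, σ, h]
    · simp [f, σ, h, neighbor_symm hp h, opposite_eq h]
  rw [Finset.sum_sigma, Finset.sum_sigma] at hinv
  have h1 : M.interiorFaceSum (opposite G) =
      ∑ i, ∑ p ∈ (M.cell i).halfspaces, f ⟨i, p⟩ := by
    rw [hinv]
    exact Finset.sum_congr rfl fun i _ => Finset.sum_congr rfl fun p hp => (hfσ i p hp).symm
  rw [interiorFaceSum_add, h1]
  simp only [interiorFaceSum, boundaryFaceSum, ← Finset.sum_add_distrib]
  refine Finset.sum_congr rfl fun i _ => Finset.sum_congr rfl fun p hp => ?_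
  rcases h : M.neighbor i p with _ | j
  · simp [f, h]
  · have hne := neighbor_ne h
    rcases lt_or_gt_of_ne hne with hlt | hlt
    · simp [f, h, hlt, hlt.not_gt]
    · simp [f, h, hlt, hlt.not_gt]

end Mesh

/-! ### Polynomial functions -/

section polynomials

variable {d k : ℕ}

namespace IsPoly

theorem hasFDerivAt_eval (P : MvPolynomial (Fin d) ℝ) (x : Vec d) :
    HasFDerivAt (fun x : Vec d => MvPolynomial.eval (fun a => x a) P)
      (∑ b, MvPolynomial.eval (fun a => x a) (MvPolynomial.pderiv b P) •
        (EuclideanSpace.proj (𝕜 := ℝ) b : Vec d →L[ℝ] ℝ)) x := by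
  induction P using MvPolynomial.induction_on with
  | C a => simpa using hasFDerivAt_const a x
  | add P Q hP hQ =>
    simp only [map_add, add_smul, Finset.sum_add_distrib]
    exact hP.add hQ
  | mul_X P c hP =>
    have h2 : HasFDerivAt (fun x : Vec d => x c) (EuclideanSpace.proj (𝕜 := ℝ) c : Vec d →L[ℝ] ℝ) x :=
      (EuclideanSpace.proj (𝕜 := ℝ) c : Vec d →L[ℝ] ℝ).hasFDerivAt
    have h3 := hP.mul h2
    simp only [map_mul, MvPolynomial.eval_X]
    refine h3.congr_fderiv ?_
    ext v
    simp only [Derivation.leibniz, MvPolynomial.pderiv_X, smul_eq_mul, map_add, map_mul,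
      MvPolynomial.eval_X, add_smul, Finset.sum_add_distrib, add_apply,
      smul_apply, sum_apply, PiLp.proj_apply, Finset.mul_sum]
    congr 1
    · rw [Finset.sum_eq_single c] <;> simp +contextual
    · exact Finset.sum_congr rfl fun _ _ => by ring

theorem totalDegree_pderiv_le (P : MvPolynomial (Fin d) ℝ) (b : Fin d) :
    (MvPolynomial.pderiv b P).totalDegree ≤ P.totalDegree := by
  refine Finset.sup_le fun s hs => ?_
  have h1 : s + Finsupp.single b 1 ∈ P.support := by
    rw [MvPolynomial.mem_support_iff, MvPolynomial.coeff_pderiv] at hs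
    exact MvPolynomial.mem_support_iff.mpr (left_ne_zero_of_mul hs)
  refine le_trans ?_ (MvPolynomial.le_totalDegree h1)
  rw [Finsupp.sum_add_index' (by simp) (by simp)]
  exact Nat.le_add_right _ _

variable {f g : Vec d → ℝ}

theorem zero : IsPoly k fun _ : Vec d => (0 : ℝ) := ⟨0, by simp, by simp⟩

theorem add (hf : IsPoly k f) (hg : IsPoly k g) : IsPoly k fun x => f x + g x := by
  obtain ⟨P, hP, hP'⟩ := hf
  obtain ⟨Q, hQ, hQ'⟩ := hg
  exact ⟨P + Q, (MvPolynomial.totalDegree_add P Q).trans (max_le hP hQ), fun x => by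
    simp [hP', hQ']⟩

theorem const_mul (c : ℝ) (hf : IsPoly k f) : IsPoly k fun x => c * f x := by
  obtain ⟨P, hP, hP'⟩ := hf
  exact ⟨c • P, (MvPolynomial.totalDegree_smul_le c P).trans hP, fun x => by
    simp [hP', MvPolynomial.smul_eval]⟩

theorem sum {ι : Type*} {s : Finset ι} {f : ι → Vec d → ℝ} (hf : ∀ i ∈ s, IsPoly k (f i)) :
    IsPoly k fun x => ∑ i ∈ s, f i x := by
  classical
  induction s using Finset.induction_on with
  | empty => simpa using zero
  | insert i s hi ih =>
    simp only [Finset.sum_insert hi]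
    exact (hf i (Finset.mem_insert_self i s)).add
      (ih fun j hj => hf j (Finset.mem_insert_of_mem hj))

theorem fderiv (hf : IsPoly k f) (b : Fin d) :
    IsPoly k fun x => fderiv ℝ f x (EuclideanSpace.single b 1) := by
  obtain ⟨P, hP, hP'⟩ := hf
  refine ⟨MvPolynomial.pderiv b P, (totalDegree_pderiv_le P b).trans hP, fun x => ?_⟩
  beta_reduce
  rw [show f = fun x => MvPolynomial.eval (fun a => x a) P from funext hP',
    (hasFDerivAt_eval P x).fderiv]
  rw [sum_apply, Finset.sum_eq_single b]
  · simp
  · intro c _ hc; simp [hc]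
  · simp

theorem contDiff {n : WithTop ℕ∞} (hf : IsPoly k f) : ContDiff ℝ n f := by
  obtain ⟨P, hP, hP'⟩ := hf
  rw [show f = fun x => MvPolynomial.eval (fun a => x a) P from funext hP']
  clear hP hP'
  induction P using MvPolynomial.induction_on with
  | C a => simpa using contDiff_const
  | add P Q hP hQ => simpa using hP.add hQ
  | mul_X P c hP =>
    simpa using hP.mul (EuclideanSpace.proj (𝕜 := ℝ) c : Vec d →L[ℝ] ℝ).contDiff

theorem continuous (hf : IsPoly k f) : Continuous f := (hf.contDiff (n := 0)).continuous

theorem comp_affine (hf : IsPoly k f) (x₀ : Vec d) (h : ℝ) :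
    IsPoly k fun y => f (x₀ + h • y) := by
  obtain ⟨P, hP, hP'⟩ := hf
  let A : Fin d → MvPolynomial (Fin d) ℝ := fun a =>
    MvPolynomial.C (x₀ a) + MvPolynomial.C h * MvPolynomial.X a
  have hA : ∀ a, (A a).totalDegree ≤ 1 := fun a => by
    refine (MvPolynomial.totalDegree_add _ _).trans (max_le (by simp) ?_)
    refine (MvPolynomial.totalDegree_mul _ _).trans ?_
    simp [MvPolynomial.totalDegree_X]
  refine ⟨∑ s ∈ P.support, MvPolynomial.C (P.coeff s) * ∏ a, A a ^ s a, ?_, fun y => ?_⟩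
  · refine MvPolynomial.totalDegree_finsetSum_le fun s hs => ?_
    refine (MvPolynomial.totalDegree_mul _ _).trans ?_
    rw [MvPolynomial.totalDegree_C, zero_add]
    refine (MvPolynomial.totalDegree_finsetProd _ _).trans ?_
    have h1 : ∑ a, (A a ^ s a).totalDegree ≤ ∑ a, s a := Finset.sum_le_sum fun a _ =>
      (MvPolynomial.totalDegree_pow _ _).trans (by simpa using Nat.mul_le_mul_left (s a) (hA a))
    refine h1.trans (le_trans (le_of_eq ?_) ((MvPolynomial.le_totalDegree hs).trans hP))
    rw [Finsupp.sum_fintype _ _ (by simp)]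
  · beta_reduce
    rw [hP', MvPolynomial.eval_eq']
    simp [A]

end IsPoly

/-- An open set contains a box, that is a product of infinite sets, on which a nonzero polynomial
cannot vanish identically. -/
theorem polynomial_eq_zero_of_eqOn {U : Set (Vec d)} (hU : IsOpen U) (hne : U.Nonempty)
    {P : MvPolynomial (Fin d) ℝ} (h : ∀ x ∈ U, MvPolynomial.eval (fun a => x a) P = 0) :
    P = 0 := by
  obtain ⟨x, hx⟩ := hne
  have hU' : IsOpen ((WithLp.toLp 2 : (Fin d → ℝ) → Vec d) ⁻¹' U) :=
    hU.preimage (PiLp.continuous_toLp 2 _)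
  obtain ⟨r, hr, hball⟩ := Metric.isOpen_iff.mp hU' x.ofLp hx
  refine MvPolynomial.funext_set (fun a => Metric.ball (x a) r) (fun a => ?_) fun y hy => ?_
  · rw [Real.ball_eq_Ioo]
    exact Set.Ioo_infinite (by linarith)
  · rw [map_zero]
    have : WithLp.toLp 2 y ∈ U := by
      apply hball
      rw [ball_pi _ hr]
      exact hy
    exact h _ this

/-- The dimension of the space of polynomials of degree at most `k`. -/
def polyDim (d k : ℕ) : ℕ := Module.finrank ℝ (MvPolynomial.restrictTotalDegree (Fin d) ℝ k)

/-- A basis of the space of polynomials of degree at most `k`. -/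
def polyBasis (d k : ℕ) : Module.Basis (Fin (polyDim d k)) ℝ
    (MvPolynomial.restrictTotalDegree (Fin d) ℝ k) := Module.finBasis ℝ _

/-- The functions of the polynomial basis. -/
def polyFun (j : Fin (polyDim d k)) (x : Vec d) : ℝ :=
  MvPolynomial.eval (fun a => x a) (polyBasis d k j : MvPolynomial (Fin d) ℝ)

theorem isPoly_polyFun (j : Fin (polyDim d k)) : IsPoly k (polyFun (d := d) j) :=
  ⟨polyBasis d k j, (MvPolynomial.mem_restrictTotalDegree _ _ _).mp (polyBasis d k j).2,
    fun _ => rfl⟩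

/-- The polynomial function with given coefficients. -/
def polyOf (c : Fin (polyDim d k) → ℝ) (x : Vec d) : ℝ := ∑ j, c j * polyFun j x

theorem polyOf_eq_eval (c : Fin (polyDim d k) → ℝ) (x : Vec d) :
    polyOf c x = MvPolynomial.eval (fun a => x a)
      ((∑ j, c j • polyBasis d k j : MvPolynomial.restrictTotalDegree (Fin d) ℝ k) :
        MvPolynomial (Fin d) ℝ) := by
  simp [polyOf, polyFun, MvPolynomial.smul_eval]

theorem isPoly_polyOf (c : Fin (polyDim d k) → ℝ) : IsPoly k (polyOf (d := d) c) :=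
  IsPoly.sum fun j _ => (isPoly_polyFun j).const_mul (c j)

theorem exists_polyOf_eq {g : Vec d → ℝ} (hg : IsPoly k g) :
    ∃ c : Fin (polyDim d k) → ℝ, g = polyOf c := by
  obtain ⟨P, hP, hP'⟩ := hg
  let P' : MvPolynomial.restrictTotalDegree (Fin d) ℝ k :=
    ⟨P, (MvPolynomial.mem_restrictTotalDegree _ _ _).mpr hP⟩
  refine ⟨(polyBasis d k).repr P', funext fun x => ?_⟩
  rw [polyOf_eq_eval, (polyBasis d k).sum_repr, hP']

theorem polyOf_injOn {U : Set (Vec d)} (hU : IsOpen U) (hne : U.Nonempty)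
    {c : Fin (polyDim d k) → ℝ} (h : ∀ x ∈ U, polyOf c x = 0) : c = 0 := by
  have h1 := polynomial_eq_zero_of_eqOn hU hne fun x hx => (polyOf_eq_eval c x).symm.trans (h x hx)
  have h2 : ∑ j, c j • polyBasis d k j = 0 := Subtype.ext h1
  funext j
  exact Fintype.linearIndependent_iff.mp (polyBasis d k).linearIndependent c h2 j

/-- The coefficients of a polynomial are linear combinations of finitely many of its values. -/
theorem exists_coeff_eq_sum {D : Set (Vec d)} (hD : (interior D).Nonempty)
    (j : Fin (polyDim d k)) :
    ∃ (s : ℕ) (α : Fin s → ℝ) (x : Fin s → Vec d), (∀ l, x l ∈ D) ∧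
      ∀ c : Fin (polyDim d k) → ℝ, c j = ∑ l, α l * polyOf c (x l) := by
  let Φ : Vec d → EuclideanSpace ℝ (Fin (polyDim d k)) := fun x => WithLp.toLp 2 fun j => polyFun j x
  have hΦ : ∀ (c : Fin (polyDim d k) → ℝ) x, ⟪Φ x, WithLp.toLp 2 c⟫ = polyOf c x := fun c x => by
    simp [Φ, polyOf, PiLp.inner_apply]
  -- A vector orthogonal to all evaluation vectors `Φ x` is the coefficient vector of a polynomial
  -- vanishing on `D`, hence zero. So the coordinate vector `j` is a combination of evaluations.
  have htop : Submodule.span ℝ (Φ '' D) = ⊤ := by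
    rw [← Submodule.orthogonal_eq_bot_iff, eq_bot_iff]
    intro c hc
    rw [Submodule.mem_orthogonal] at hc
    have : c.ofLp = 0 := polyOf_injOn isOpen_interior hD fun x hx => by
      rw [← hΦ]
      exact hc _ (Submodule.subset_span ⟨x, interior_subset hx, rfl⟩)
    rw [Submodule.mem_bot]
    ext i; exact congrFun this i
  obtain ⟨s, α, y, hy⟩ := Submodule.mem_span_set'.mp
    (htop ▸ Submodule.mem_top : EuclideanSpace.single j (1 : ℝ) ∈ Submodule.span ℝ (Φ '' D))
  choose x hx hxy using fun l => (y l).2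
  refine ⟨s, α, x, hx, fun c => ?_⟩
  have h1 : c j = ⟪(EuclideanSpace.single j (1 : ℝ) : EuclideanSpace ℝ (Fin (polyDim d k))),
      WithLp.toLp 2 c⟫ := by
    rw [EuclideanSpace.inner_single_left]; simp
  rw [h1, ← hy, sum_inner]
  refine Finset.sum_congr rfl fun l _ => ?_
  rw [inner_smul_left, ← hxy, hΦ]; simp

end polynomials

/-! ### The discrete trace inequality -/

section trace

variable {d k : ℕ}

/-- The map from coefficients to `L²` of the small ball is linear and injective on a
finite-dimensional space, hence bounded below. The coefficients in turn bound the values on the unit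
ball. -/
theorem exists_sq_le_integral_sq {ρ : ℝ} (hρ : 0 < ρ) :
    ∃ A : ℝ, 0 ≤ A ∧ ∀ g : Vec d → ℝ, IsPoly k g → ∀ x ∈ Metric.closedBall (0 : Vec d) 1,
      g x ^ 2 ≤ A * ∫ y in Metric.closedBall (0 : Vec d) ρ, g y ^ 2 := by
  set B := Metric.closedBall (0 : Vec d) ρ
  have hBc : IsCompact B := isCompact_closedBall _ _
  have hfin : IsFiniteMeasure (volume.restrict B) :=
    isFiniteMeasure_restrict.mpr hBc.measure_lt_top.ne
  have hmem : ∀ c : Fin (polyDim d k) → ℝ, MemLp (polyOf (d := d) c) 2 (volume.restrict B) := by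
    intro c
    obtain ⟨C, hC⟩ := hBc.exists_bound_of_continuousOn (isPoly_polyOf (d := d) c).continuous.continuousOn
    refine MemLp.of_bound (isPoly_polyOf c).continuous.aestronglyMeasurable C ?_
    filter_upwards [ae_restrict_mem hBc.measurableSet] with x hx using hC x hx
  let T : (Fin (polyDim d k) → ℝ) →ₗ[ℝ] Lp ℝ 2 (volume.restrict B) :=
    { toFun := fun c => (hmem c).toLp _
      map_add' := fun c c' => by
        rw [← MemLp.toLp_add]
        congr 1
        funext x; simp [polyOf, add_mul, Finset.sum_add_distrib]
      map_smul' := fun r c => by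
        rw [RingHom.id_apply, ← MemLp.toLp_const_smul]
        congr 1
        funext x; simp [polyOf, mul_assoc, Finset.mul_sum] }
  have hTn : ∀ c, ‖T c‖ ^ 2 = ∫ y in B, polyOf c y ^ 2 := by
    intro c
    rw [← real_inner_self_eq_norm_sq, L2.inner_def]
    apply integral_congr_ae
    filter_upwards [(hmem c).coeFn_toLp] with x hx
    change ⟪((hmem c).toLp _ : Vec d → ℝ) x, ((hmem c).toLp _ : Vec d → ℝ) x⟫ = _
    rw [hx, real_inner_self_eq_norm_sq, Real.norm_eq_abs, sq_abs]
  have hker : T.ker = ⊥ := by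
    rw [LinearMap.ker_eq_bot']
    intro c hc
    have h0 : ∫ y in B, polyOf c y ^ 2 = 0 := by rw [← hTn, hc]; simp
    have hcont : Continuous fun y => polyOf (d := d) c y ^ 2 := (isPoly_polyOf c).continuous.pow 2
    rw [setIntegral_eq_zero_iff_of_nonneg_ae (ae_of_all _ fun _ => sq_nonneg _)
      (hcont.continuousOn.integrableOn_compact hBc)] at h0
    refine polyOf_injOn Metric.isOpen_ball ⟨(0 : Vec d), Metric.mem_ball_self hρ⟩ fun x hx => ?_
    have h1 : (fun y => polyOf (d := d) c y ^ 2) =ᵐ[volume.restrict (Metric.ball (0 : Vec d) ρ)] 0 :=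
      ae_restrict_of_ae_restrict_of_subset Metric.ball_subset_closedBall h0
    have h2 := Measure.eqOn_open_of_ae_eq h1 Metric.isOpen_ball hcont.continuousOn
      continuousOn_const hx
    exact pow_eq_zero_iff two_ne_zero |>.mp h2
  obtain ⟨K, -, hK⟩ := T.exists_antilipschitzWith hker
  have hbd : ∀ j : Fin (polyDim d k), ∃ C, ∀ x ∈ Metric.closedBall (0 : Vec d) 1,
      ‖polyFun j x‖ ≤ C := fun j =>
    (isCompact_closedBall _ _).exists_bound_of_continuousOn
      (isPoly_polyFun j).continuous.continuousOn
  choose C hC using hbd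
  refine ⟨((∑ j, C j) * K) ^ 2, sq_nonneg _, fun g hg x hx => ?_⟩
  obtain ⟨c, rfl⟩ := exists_polyOf_eq hg
  have h1 : ‖c‖ ≤ K * ‖T c‖ := by
    simpa using hK.le_mul_dist c 0
  have h2 : |polyOf c x| ≤ (∑ j, C j) * ‖c‖ := by
    rw [Finset.sum_mul]
    refine (Finset.abs_sum_le_sum_abs _ _).trans (Finset.sum_le_sum fun j _ => ?_)
    rw [abs_mul, mul_comm]
    exact mul_le_mul (hC j x hx) (norm_le_pi_norm c j) (abs_nonneg _)
      ((norm_nonneg _).trans (hC j x hx))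
  have h3 : 0 ≤ ∑ j, C j := Finset.sum_nonneg fun j _ => (norm_nonneg _).trans (hC j x hx)
  rw [← hTn, ← sq_abs, ← mul_pow]
  refine pow_le_pow_left₀ (abs_nonneg _) (h2.trans ?_) 2
  rw [mul_assoc]
  exact mul_le_mul_of_nonneg_left h1 h3

theorem nontrivial_of_isOpen (hd : d ≠ 0) {U : Set (Vec d)} (hU : IsOpen U) (hne : U.Nonempty) :
    U.Nontrivial := by
  obtain ⟨x, hx⟩ := hne
  have : NeZero d := ⟨hd⟩
  have : Nontrivial (Vec d) := ⟨0, EuclideanSpace.single 0 1, fun h => by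
    have := congrArg (fun v : Vec d => v 0) h
    simp at this⟩
  have := Module.punctured_nhds_neBot ℝ (Vec d) x
  exact (infinite_of_mem_nhds x (hU.mem_nhds hx)).nontrivial

theorem Cell.diam_pos (hd : d ≠ 0) (K : Cell d) : 0 < Metric.diam K.carrier :=
  Metric.diam_pos ((nontrivial_of_isOpen hd K.isOpen_openCarrier K.openCarrier_nonempty).mono
    K.openCarrier_subset) K.isCompact_carrier.isBounded

theorem Cell.isOpen_chart_strict {m : ℕ} (K : Cell (m + 1)) {p : Vec (m + 1) × ℝ}
    (hn : ‖p.1‖ = 1) : IsOpen (chart hn p.2 ⁻¹' K.relFacet p) := by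
  classical
  have : chart hn p.2 ⁻¹' K.relFacet p =
      ⋂ q ∈ K.halfspaces.erase p, {y | ⟪q.1, chart hn p.2 y⟫ < q.2} := by
    ext y
    simp only [mem_preimage, relFacet, mem_ofPred_eq, inner_chart, true_and, mem_iInter,
      Finset.mem_erase]
    exact ⟨fun h q hq => h q hq.2 hq.1, fun h q hq hqp => h q ⟨hqp, hq⟩⟩
  rw [this]
  exact isOpen_biInter_finset fun q _ =>
    isOpen_lt (continuous_const.inner (isometry_chart hn p.2).continuous) continuous_const

theorem Cell.diam_facet_pos {m : ℕ} (hm : m ≠ 0) (K : Cell (m + 1)) {p : Vec (m + 1) × ℝ}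
    (hp : p ∈ K.halfspaces) : 0 < Metric.diam (K.facet p) := by
  have hn := K.unit_normal p hp
  obtain ⟨x, hx⟩ := K.relFacet_nonempty hp
  obtain ⟨y, rfl⟩ := exists_chart_eq hn hx.1
  have h1 := nontrivial_of_isOpen hm (K.isOpen_chart_strict hn) ⟨y, hx⟩
  refine Metric.diam_pos ((h1.image (isometry_chart hn p.2).injective).mono ?_)
    (K.isCompact_facet p).isBounded
  rintro _ ⟨z, hz, rfl⟩
  exact K.relFacet_subset hz

open scoped Pointwise in
theorem setIntegral_closedBall_comp_affine (f : Vec d → ℝ) (x₀ : Vec d) {h ρ : ℝ} (hh : 0 < h)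
    (hρ : 0 ≤ ρ) :
    ∫ y in Metric.closedBall (0 : Vec d) ρ, f (x₀ + h • y) =
      (h ^ d)⁻¹ * ∫ x in Metric.closedBall x₀ (ρ * h), f x := by
  have hball : h • Metric.closedBall (0 : Vec d) ρ = (fun y => x₀ + y) ⁻¹' Metric.closedBall x₀ (ρ * h) := by
    rw [smul_closedBall _ _ hρ, smul_zero, Real.norm_of_nonneg hh.le]
    ext y
    simp [mul_comm, dist_eq_norm]
  have h1 := Measure.setIntegral_comp_smul_of_pos (volume : Measure (Vec d)) (fun y => f (x₀ + y))
    (Metric.closedBall 0 ρ) hh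
  have h2 := (measurePreserving_add_left (volume : Measure (Vec d)) x₀).setIntegral_preimage_emb
    (measurableEmbedding_addLeft x₀) f (Metric.closedBall x₀ (ρ * h))
  rw [hball, h2, finrank_euclideanSpace, Fintype.card_fin] at h1
  exact h1

/-- Trace constants exist. -/
theorem exists_isTraceConst {m : ℕ} (k : ℕ) {ρ : ℝ} (hρ : 0 < ρ) :
    ∃ C, IsTraceConst (m + 1) k ρ C := by
  obtain ⟨A, hA, hA'⟩ := exists_sq_le_integral_sq (d := m + 1) (k := k) hρ
  set κ := volume.real (Metric.closedBall (0 : Vec m) 1) with hκ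
  -- `√(κ A)` already satisfies the inequality; the added `1` only ensures strict positivity.
  refine ⟨√(κ * A) + 1, by positivity, fun K ⟨x₀, hx₀⟩ p hp g hg => ?_⟩
  set h := Metric.diam K.carrier with hh
  have hpos : 0 < h := K.diam_pos (Nat.succ_ne_zero m)
  have hn := K.unit_normal p hp
  have hx₀K : x₀ ∈ K.carrier := hx₀ (Metric.mem_closedBall_self (by positivity))
  have hgc : Continuous fun x => g x ^ 2 := hg.continuous.pow 2
  set I := ∫ x in K.carrier, g x ^ 2 with hI
  have hI0 : 0 ≤ I := integral_nonneg fun _ => sq_nonneg _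
  -- Rescale by `h` about `x₀`: the element then lies in the unit ball, and shape regularity places
  -- the ball of radius `ρ` inside it.
  have hsup : ∀ x ∈ K.carrier, g x ^ 2 ≤ A * ((h ^ (m + 1))⁻¹ * I) := by
    intro x hx
    have h1 := hA' _ (hg.comp_affine x₀ h) (h⁻¹ • (x - x₀)) (by
      rw [mem_closedBall_zero_iff, norm_smul, norm_inv, Real.norm_of_nonneg hpos.le, ← dist_eq_norm,
        inv_mul_le_iff₀ hpos, mul_one]
      exact Metric.dist_le_diam_of_mem K.isCompact_carrier.isBounded hx hx₀K)
    rw [setIntegral_closedBall_comp_affine (fun x => g x ^ 2) x₀ hpos hρ.le, smul_smul,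
      mul_inv_cancel₀ hpos.ne', one_smul, add_sub_cancel] at h1
    refine h1.trans (mul_le_mul_of_nonneg_left (mul_le_mul_of_nonneg_left ?_ (by positivity)) hA)
    exact setIntegral_mono_set (K.integrableOn_carrier hgc.continuousOn)
      (ae_of_all _ fun _ => sq_nonneg _) (LE.le.eventuallyLE hx₀)
  -- The facet has diameter at most `h`, so in the chart it lies in a ball of radius `h`. In the
  -- final bound the powers `h`, `h^(-(m+1))` and `h^m` cancel, which makes the constant independent
  -- of the element.
  have harea : volume.real (chart hn p.2 ⁻¹' K.facet p) ≤ h ^ m * κ := by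
    obtain ⟨z, hz⟩ := K.relFacet_nonempty hp
    obtain ⟨y, rfl⟩ := exists_chart_eq hn hz.1
    have hsub : chart hn p.2 ⁻¹' K.facet p ⊆ Metric.closedBall y h := by
      intro w hw
      rw [Metric.mem_closedBall, ← (isometry_chart hn p.2).dist_eq]
      exact Metric.dist_le_diam_of_mem K.isCompact_carrier.isBounded hw.1
        (K.relFacet_subset hz).1
    refine (measureReal_mono hsub (isCompact_closedBall y h).measure_lt_top.ne).trans (le_of_eq ?_)
    rw [measureReal_def, Measure.addHaar_closedBall' _ _ hpos.le, ENNReal.toReal_mul,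
      finrank_euclideanSpace, Fintype.card_fin, ENNReal.toReal_ofReal (by positivity), hκ,
      measureReal_def]
  have hface : ∫ x in K.facet p, g x ^ 2 ∂(Measure.euclideanHausdorffMeasure m) ≤
      A * ((h ^ (m + 1))⁻¹ * I) * (h ^ m * κ) := by
    rw [K.integral_facet hn]
    have hc := K.isCompact_chart_preimage hn
    refine (setIntegral_mono_on (g := fun _ => A * ((h ^ (m + 1))⁻¹ * I))
      ((hgc.comp (isometry_chart hn p.2).continuous).continuousOn.integrableOn_compact hc)
      (integrableOn_const hc.measure_lt_top.ne) hc.measurableSet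
      fun y hy => hsup _ hy.1).trans ?_
    rw [setIntegral_const, smul_eq_mul, mul_comm]
    exact mul_le_mul_of_nonneg_left harea (by positivity)
  rw [Nat.add_sub_cancel, ← Real.sqrt_mul hpos.le]
  calc √(h * ∫ x in K.facet p, g x ^ 2 ∂(Measure.euclideanHausdorffMeasure m))
      ≤ √(κ * A * I) := by
        refine Real.sqrt_le_sqrt ((mul_le_mul_of_nonneg_left hface hpos.le).trans (le_of_eq ?_))
        field_simp
        ring
    _ = √(κ * A) * √I := Real.sqrt_mul (by positivity) I
    _ ≤ (√(κ * A) + 1) * √I := by gcongr; linarith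

end trace

/-! ### The divergence of products -/

section divergence

variable {d k : ℕ}

theorem divergence_eq_sum (v : Vec d → Vec d) (x : Vec d) :
    divergence v x = ∑ a, fderiv ℝ v x (EuclideanSpace.single a 1) a := rfl

theorem sum_smul_single (v : Vec d) : ∑ a, v a • (EuclideanSpace.single a (1 : ℝ) : Vec d) = v := by
  ext b
  simp [Pi.single_apply]

theorem divergence_smul {φ : Vec d → ℝ} {w : Vec d → Vec d} {x : Vec d}
    (hφ : DifferentiableAt ℝ φ x) (hw : DifferentiableAt ℝ w x) :
    divergence (fun x => φ x • w x) x = φ x * divergence w x + fderiv ℝ φ x (w x) := by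
  have h1 : fderiv ℝ φ x (w x) = ∑ a, fderiv ℝ φ x (EuclideanSpace.single a 1) * w x a := by
    conv_lhs => rw [← sum_smul_single (w x), map_sum]
    exact Finset.sum_congr rfl fun a _ => by rw [map_smul, smul_eq_mul, mul_comm]
  rw [h1, divergence_eq_sum, divergence_eq_sum, Finset.mul_sum, ← Finset.sum_add_distrib]
  refine Finset.sum_congr rfl fun a _ => ?_
  rw [fderiv_fun_smul hφ hw]
  simp

theorem contDiff_of_isPoly {n : WithTop ℕ∞} {w : Vec d → Vec d}
    (hw : ∀ a, IsPoly k fun x => w x a) : ContDiff ℝ n w :=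
  contDiff_euclidean.mpr fun a => (hw a).contDiff

theorem continuous_divergence {w : Vec d → Vec d} (hw : ContDiff ℝ 1 w) :
    Continuous (divergence w) := by
  have : divergence w = fun x => ∑ a, EuclideanSpace.proj (𝕜 := ℝ) a
      (fderiv ℝ w x (EuclideanSpace.single a 1)) := funext fun x => divergence_eq_sum w x
  rw [this]
  refine continuous_finsetSum _ fun a _ => (EuclideanSpace.proj (𝕜 := ℝ) a).continuous.comp ?_
  exact (hw.continuous_fderiv (by simp)).clm_apply continuous_const

end divergence

namespace Mesh

/-! ### Integrals over the domain as sums over elements. -/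

section domain

variable {d : ℕ} {M : Mesh d}

theorem openCarrier_subset_domain (i : Fin M.numCells) : (M.cell i).openCarrier ⊆ M.domain :=
  interior_maximal ((Cell.openCarrier_subset _).trans (subset_iUnion_of_subset i subset_rfl))
    (M.cell i).isOpen_openCarrier

theorem domain_ae_eq : M.domain =ᵐ[volume] ⋃ i, (M.cell i).openCarrier := by
  refine EventuallyLE.antisymm ?_ (LE.le.eventuallyLE (iUnion_subset openCarrier_subset_domain))
  exact (LE.le.eventuallyLE interior_subset).trans
    (Filter.EventuallyEq.countable_iUnion fun i => (M.cell i).openCarrier_ae_eq).symm.le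

theorem pairwise_disjoint_openCarrier :
    Pairwise (Function.onFun Disjoint fun i => (M.cell i).openCarrier) :=
  fun _ _ hij => disjoint_openCarrier hij

theorem measure_domain_lt_top : volume M.domain < ⊤ := by
  rw [measure_congr domain_ae_eq]
  refine (measure_iUnion_fintype_le _ _).trans_lt (ENNReal.sum_lt_top.mpr fun i _ => ?_)
  exact (measure_mono (Cell.openCarrier_subset _)).trans_lt
    (M.cell i).isCompact_carrier.measure_lt_top

/-- The integral over the domain is the sum of the integrals over the elements. -/
theorem integral_domain_eq {h : Vec d → ℝ} {H : Broken M ℝ}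
    (hH : ∀ i, ∀ᵐ x ∂volume.restrict (M.cell i).openCarrier, h x = H i x)
    (hint : ∀ i, IntegrableOn (H i) (M.cell i).carrier) :
    ∫ x in M.domain, h x = M.cellInt H := by
  have hint' : ∀ i, IntegrableOn h (M.cell i).openCarrier := fun i =>
    ((hint i).mono_set (Cell.openCarrier_subset _)).congr ((hH i).mono fun _ hx => hx.symm)
  rw [setIntegral_congr_set domain_ae_eq, integral_iUnion_fintype
    (fun i => (M.cell i).isOpen_openCarrier.measurableSet) pairwise_disjoint_openCarrier hint']
  refine Finset.sum_congr rfl fun i _ => ?_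
  rw [← setIntegral_congr_set (M.cell i).openCarrier_ae_eq]
  exact integral_congr_ae (hH i)

theorem glue_eq (v : Broken M (Vec d)) {i : Fin M.numCells} {x : Vec d}
    (hx : x ∈ (M.cell i).openCarrier) : M.glue v x = v i x := by
  classical
  unfold glue
  rw [Finset.sum_eq_single i]
  · rw [Cell.interior_carrier, if_pos hx]
  · intro j _ hj
    rw [Cell.interior_carrier, if_neg]
    exact (disjoint_openCarrier hj.symm).notMem_of_mem_left hx
  · simp

end domain

/-! ### Continuity of the normal component -/

section normal

variable {m : ℕ} {M : Mesh (m + 1)} {w : Broken M (Vec (m + 1))}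

/-- The divergence theorem for `φ w` on each element. It serves twice: with a test function, to
recover normal traces, and with `φ = |u|²`, for the convective terms. -/
theorem bdryInt_mul_inner_eq (hw : ∀ i, ContDiff ℝ 1 (w i)) {φ : Broken M ℝ}
    (hφ : ∀ i, ContDiff ℝ 1 (φ i)) :
    M.bdryInt (fun i p x => φ i x * ⟪w i x, p.1⟫) =
      M.cellInt (fun i x => φ i x * divergence (w i) x) +
        M.cellInt (fun i x => fderiv ℝ (φ i) x (w i x)) := by
  unfold bdryInt cellInt
  rw [← Finset.sum_add_distrib]
  refine Finset.sum_congr rfl fun i _ => ?_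
  have h1 : ∫ x in (M.cell i).carrier, divergence (fun x => φ i x • w i x) x = _ :=
    (M.cell i).integral_divergence ((hφ i).smul (hw i))
  have h2 : ∀ x, divergence (fun x => φ i x • w i x) x =
      φ i x * divergence (w i) x + fderiv ℝ (φ i) x (w i x) := fun x =>
    divergence_smul ((hφ i).differentiable (by simp) x) ((hw i).differentiable (by simp) x)
  simp_rw [h2] at h1
  simp only [inner_smul_left, conj_trivial] at h1
  rw [integral_add] at h1
  · exact h1.symm
  · exact (M.cell i).integrableOn_carrier
      ((hφ i).continuous.mul (continuous_divergence (hw i))).continuousOn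
  · exact (M.cell i).integrableOn_carrier
      (((hφ i).continuous_fderiv (by simp)).clm_apply (hw i).continuous).continuousOn

theorem facetInt_eq_zero {i : Fin M.numCells} {p : Vec (m + 1) × ℝ} {g : Vec (m + 1) → ℝ}
    (h : ∀ x ∈ (M.cell i).facet p, g x = 0) : M.facetInt i p g = 0 :=
  setIntegral_eq_zero_of_forall_eq_zero h

/-- Comparing the elementwise divergence theorem with the definition of `H₀(div)` leaves `∑ ∫ φ (div
w - g)`. The weak divergence `g` agrees almost everywhere with the elementwise one, so this is zero,
even for test functions not vanishing on the boundary of the domain. -/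
theorem bdryInt_mul_inner_eq_zero (hw : ∀ i, ContDiff ℝ 1 (w i))
    (hdiv : MemHdivZero M.domain (M.glue w)) {φ : Vec (m + 1) → ℝ} (hφ : ContDiff ℝ ∞ φ)
    (hφc : HasCompactSupport φ) :
    M.bdryInt (fun i p x => φ x * ⟪w i x, p.1⟫) = 0 := by
  obtain ⟨-, g, hg, hgφ⟩ := hdiv
  have hfin : IsFiniteMeasure (volume.restrict M.domain) :=
    isFiniteMeasure_restrict.mpr measure_domain_lt_top.ne
  have hgint : IntegrableOn g M.domain := hg.integrable (by norm_num)
  have hgi : ∀ i, IntegrableOn g (M.cell i).carrier := fun i =>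
    (hgint.mono_set (openCarrier_subset_domain i)).congr_set_ae
      (M.cell i).openCarrier_ae_eq.symm
  have hgr : ∀ φ : Vec (m + 1) → ℝ, ContDiff ℝ ∞ φ → HasCompactSupport φ → ∀ i,
      IntegrableOn (fun x => g x * φ x) (M.cell i).carrier := fun φ hφ _ i =>
    (hgi i).mul_continuousOn hφ.continuous.continuousOn (M.cell i).isCompact_carrier
  have hdr : ∀ φ : Vec (m + 1) → ℝ, ContDiff ℝ ∞ φ → ∀ i,
      IntegrableOn (fun x => φ x * divergence (w i) x) (M.cell i).carrier := fun φ hφ i =>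
    (M.cell i).integrableOn_carrier
      (hφ.continuous.mul (continuous_divergence (hw i))).continuousOn
  have key : ∀ φ : Vec (m + 1) → ℝ, ContDiff ℝ ∞ φ → HasCompactSupport φ →
      M.bdryInt (fun i p x => φ x * ⟪w i x, p.1⟫) =
        M.cellInt (fun i x => φ x * (divergence (w i) x - g x)) := by
    intro φ hφ hφc
    have hφ1 : ContDiff ℝ 1 φ := hφ.of_le (by exact_mod_cast le_top)
    have h1 := hgφ φ hφ hφc
    rw [integral_domain_eq (H := fun i x => fderiv ℝ φ x (w i x)),
      integral_domain_eq (H := fun i x => g x * φ x)] at h1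
    · rw [bdryInt_mul_inner_eq hw fun _ => hφ1, h1]
      unfold cellInt
      rw [← Finset.sum_neg_distrib, ← Finset.sum_add_distrib]
      refine Finset.sum_congr rfl fun i _ => ?_
      rw [← sub_eq_add_neg, ← integral_sub (hdr φ hφ i) (hgr φ hφ hφc i)]
      congr 1
      funext x; ring
    · exact fun i => ae_of_all _ fun x => rfl
    · exact hgr φ hφ hφc
    · intro i
      filter_upwards [ae_restrict_mem (M.cell i).isOpen_openCarrier.measurableSet] with x hx
      rw [glue_eq w hx, real_inner_comm, ← InnerProductSpace.toDual_apply_apply (𝕜 := ℝ),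
        toDual_gradient]
    · exact fun i => (M.cell i).integrableOn_carrier
        ((hφ1.continuous_fderiv (by simp)).clm_apply (hw i).continuous).continuousOn
  -- Test functions supported in one open element see no face, so `key` reduces to the fundamental
  -- lemma of the calculus of variations there.
  have hzero : ∀ i, ∀ᵐ x, x ∈ (M.cell i).openCarrier → divergence (w i) x - g x = 0 := by
    intro i
    have hri : IntegrableOn (fun x => divergence (w i) x - g x) (M.cell i).carrier :=
      ((M.cell i).integrableOn_carrier (continuous_divergence (hw i)).continuousOn).sub (hgi i)
    apply (M.cell i).isOpen_openCarrier.ae_eq_zero_of_integral_contDiff_smul_eq_zero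
    · exact (hri.mono_set (Cell.openCarrier_subset _)).locallyIntegrableOn
    · intro φ hφ hφc hφs
      have hout : ∀ x ∉ (M.cell i).openCarrier, φ x = 0 := fun x hx =>
        image_eq_zero_of_notMem_tsupport fun h => hx (hφs h)
      have h1 := key φ hφ hφc
      have h2 : M.bdryInt (fun i p x => φ x * ⟪w i x, p.1⟫) = 0 := by
        refine Finset.sum_eq_zero fun j _ => Finset.sum_eq_zero fun p hp =>
          facetInt_eq_zero fun x hx => ?_
        beta_reduce
        rw [hout x, zero_mul]
        intro hxi
        by_cases hij : i = j
        · subst hij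
          exact (hxi p hp).ne hx.2
        · exact (disjoint_openCarrier_carrier hij).notMem_of_mem_left hxi hx.1
      rw [h2, cellInt, Finset.sum_eq_single i] at h1
      · rw [← setIntegral_eq_integral_of_forall_compl_eq_zero (s := (M.cell i).carrier)]
        · exact h1.symm
        · intro x hx
          rw [hout x fun h => hx (Cell.openCarrier_subset _ h), zero_smul]
      · intro j _ hj
        refine setIntegral_eq_zero_of_forall_eq_zero fun x hx => ?_
        rw [hout x, zero_mul]
        exact (disjoint_openCarrier_carrier hj.symm).notMem_of_mem_right hx
      · simp
  rw [key φ hφ hφc]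
  refine Finset.sum_eq_zero fun i _ => ?_
  rw [← setIntegral_congr_set (M.cell i).openCarrier_ae_eq]
  apply integral_eq_zero_of_ae
  rw [EventuallyEq, ae_restrict_iff' (M.cell i).isOpen_openCarrier.measurableSet]
  filter_upwards [hzero i] with x hx hxi
  rw [hx hxi]; simp

theorem continuous_jump {V : Type} [NormedAddCommGroup V] [NormedSpace ℝ V] {v : Broken M V}
    (hv : ∀ i, Continuous (v i)) (i : Fin M.numCells) (p : Vec (m + 1) × ℝ) :
    Continuous (jump v i p) := by
  unfold jump
  rcases M.neighbor i p with _ | j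
  · exact hv i
  · exact (hv i).sub (hv j)

/-- The integral against a test function concentrated at a single face. -/
theorem bdryInt_eq_facetInt_jump (hw : ∀ i, Continuous (w i)) {φ : Vec (m + 1) → ℝ}
    (hφ : Continuous φ) {i : Fin M.numCells} {p : Vec (m + 1) × ℝ}
    (hp : p ∈ (M.cell i).halfspaces)
    (hout : ∀ l, ∀ q ∈ (M.cell l).halfspaces, (l, q) ≠ (i, p) →
      (∀ j, M.neighbor i p = some j → (l, q) ≠ (j, -p)) → ∀ x ∈ (M.cell l).facet q, φ x = 0) :
    M.bdryInt (fun i p x => φ x * ⟪w i x, p.1⟫) =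
      M.facetInt i p fun x => φ x * ⟪jump w i p x, p.1⟫ := by
  have hz : ∀ l, ∀ q ∈ (M.cell l).halfspaces, (l, q) ≠ (i, p) →
      (∀ j, M.neighbor i p = some j → (l, q) ≠ (j, -p)) →
      M.facetInt l q (fun x => φ x * ⟪w l x, q.1⟫) = 0 := fun l q hq h1 h2 =>
    facetInt_eq_zero fun x hx => by rw [hout l q hq h1 h2 x hx, zero_mul]
  unfold bdryInt
  rcases hn : M.neighbor i p with _ | j
  · rw [Finset.sum_eq_single i, Finset.sum_eq_single p]
    · simp only [jump, hn]
    · intro q hq hqp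
      exact hz i q hq (by simpa using hqp) (by simp [hn])
    · exact fun h => absurd hp h
    · intro l _ hl
      exact Finset.sum_eq_zero fun q hq => hz l q hq (by simp [hl]) (by simp [hn])
    · simp
  · have hji := neighbor_ne hn
    have hint : ∀ l, IntegrableOn (fun x => φ x * ⟪w l x, p.1⟫) ((M.cell i).facet p)
        (Measure.euclideanHausdorffMeasure m) := fun l =>
      (M.cell i).integrableOn_facet ((M.cell i).unit_normal p hp)
        (hφ.mul ((hw l).inner continuous_const)).continuousOn
    have hj : ∀ x, jump w i p x = w i x - w j x := fun x => by simp only [jump, hn]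
    rw [Finset.sum_eq_add i j hji.symm, Finset.sum_eq_single p, Finset.sum_eq_single (-p)]
    · rw [facetInt_neg hp hn]
      unfold facetInt
      simp only [Nat.add_sub_cancel]
      simp_rw [hj, inner_sub_left, mul_sub]
      rw [integral_sub (hint i) (hint j), sub_eq_add_neg, ← integral_neg]
      simp
    · intro q hq hqp
      exact hz j q hq (by simp [hji]) (by intro j' hj'; obtain rfl := Option.some.inj (hn.symm.trans hj'); simpa using hqp)
    · exact fun h => absurd (neg_mem_halfspaces hp hn) h
    · intro q hq hqp
      exact hz i q hq (by simpa using hqp) (by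
        intro j' hj'; obtain rfl := Option.some.inj (hn.symm.trans hj'); simp [hji.symm])
    · exact fun h => absurd hp h
    · intro l _ hl
      refine Finset.sum_eq_zero fun q hq => hz l q hq (by simp [hl.1]) ?_
      intro j' hj'; obtain rfl := Option.some.inj (hn.symm.trans hj'); simp [hl.2]
    · simp
    · simp

/-- A relative interior point lies on no facet except `p` itself and its twin `-p` in the neighbour.
The remaining facets are finitely many closed sets, so a whole neighbourhood avoids them. -/
theorem eventually_notMem_facet {i : Fin M.numCells} {p : Vec (m + 1) × ℝ}
    (hp : p ∈ (M.cell i).halfspaces) {x : Vec (m + 1)} (hx : x ∈ (M.cell i).relFacet p) :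
    ∀ᶠ z in 𝓝 x, ∀ l, ∀ q ∈ (M.cell l).halfspaces, (l, q) ≠ (i, p) →
      (∀ j, M.neighbor i p = some j → (l, q) ≠ (j, -p)) → z ∉ (M.cell l).facet q := by
  rw [eventually_all]
  intro l
  rw [Filter.eventually_all_finset]
  intro q hq
  by_cases h1 : (l, q) = (i, p)
  · simp [h1]
  by_cases h2 : ∀ j, M.neighbor i p = some j → (l, q) ≠ (j, -p)
  · have hnot : x ∉ (M.cell l).facet q := by
      intro hxq
      by_cases hli : l = i
      · subst hli
        exact (hx.2 q hq fun h => h1 (by rw [h])).ne hxq.2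
      · by_cases hnl : M.neighbor i p = some l
        · have hx' := (isNeighbor_of_neighbor hnl).mem_relFacet hp hx
          exact (hx'.2 q hq fun h => h2 l hnl (by rw [h])).ne hxq.2
        · exact notMem_carrier_of_neighbor hp hx hli hnl hxq.1
    filter_upwards [((M.cell l).isClosed_facet q).isOpen_compl.mem_nhds hnot] with z hz _ _
      using hz
  · exact Eventually.of_forall fun z _ h => absurd h h2

/-- If the normal jump `s` were nonzero at `x`, a bump function supported where `s` keeps its sign
and meeting no other facet would give a nonnegative continuous integrand with zero integral over the
face, yet positive at `x`. -/
theorem inner_jump_eq_zero_of_mem_relFacet (hw : ∀ i, ContDiff ℝ 1 (w i))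
    (hdiv : MemHdivZero M.domain (M.glue w)) {i : Fin M.numCells} {p : Vec (m + 1) × ℝ}
    (hp : p ∈ (M.cell i).halfspaces) {x : Vec (m + 1)} (hx : x ∈ (M.cell i).relFacet p) :
    ⟪jump w i p x, p.1⟫ = 0 := by
  have hn := (M.cell i).unit_normal p hp
  have hwc : ∀ i, Continuous (w i) := fun i => (hw i).continuous
  set s : Vec (m + 1) → ℝ := fun x => ⟪jump w i p x, p.1⟫ with hs
  have hsc : Continuous s := (continuous_jump hwc i p).inner continuous_const
  by_contra hsx
  have hpos : 0 < s x * s x := mul_self_pos.mpr hsx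
  have hev : ∀ᶠ z in 𝓝 x, 0 < s x * s z :=
    ((continuous_const.mul hsc).tendsto x).eventually (lt_mem_nhds hpos)
  obtain ⟨φ, hφs, hφc, hφ, hφr, hφx⟩ := exists_contDiff_tsupport_subset (n := ⊤)
    (hev.and (eventually_notMem_facet hp hx))
  have h0 := bdryInt_mul_inner_eq_zero hw hdiv hφ hφc
  rw [bdryInt_eq_facetInt_jump hwc hφ.continuous hp] at h0
  · have h1 : M.facetInt i p (fun z => s x * (φ z * s z)) = 0 := by
      unfold facetInt at h0 ⊢
      rw [integral_const_mul, h0, mul_zero]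
    have hnonneg : ∀ z, 0 ≤ s x * (φ z * s z) := by
      intro z
      by_cases hz : z ∈ tsupport φ
      · have h2 : 0 < s x * s z := (hφs hz).1
        have h3 : 0 ≤ φ z := (hφr (mem_range_self z)).1
        have := mul_nonneg h3 h2.le
        linarith
      · rw [image_eq_zero_of_notMem_tsupport hz]; simp
    have hcont : Continuous fun z => s x * (φ z * s z) :=
      continuous_const.mul (hφ.continuous.mul hsc)
    unfold facetInt at h1
    rw [Nat.add_sub_cancel, (M.cell i).integral_facet hn] at h1
    have hcy := hcont.comp (isometry_chart hn p.2).continuous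
    have hcpt := (M.cell i).isCompact_chart_preimage hn
    rw [setIntegral_eq_zero_iff_of_nonneg_ae (ae_of_all _ fun _ => hnonneg _)
      (hcy.continuousOn.integrableOn_compact hcpt)] at h1
    obtain ⟨y, rfl⟩ := exists_chart_eq hn hx.1
    have h2 := ae_restrict_of_ae_restrict_of_subset
      (preimage_mono (f := chart hn p.2) ((M.cell i).relFacet_subset (p := p))) h1
    have h3 := Measure.eqOn_open_of_ae_eq h2 ((M.cell i).isOpen_chart_strict hn)
      hcy.continuousOn continuousOn_const hx
    have h4 : s (chart hn p.2 y) * (φ (chart hn p.2 y) * s (chart hn p.2 y)) = 0 := h3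
    rw [hφx, one_mul] at h4
    exact hpos.ne' h4
  · intro l q hq h1 h2 z hz
    by_contra hne
    have := hφs (subset_tsupport φ hne)
    exact this.2 l q hq h1 h2 hz

/-- The normal component of a field in `H₀(div)` is continuous across interior faces and vanishes
on boundary faces. -/
theorem inner_jump_eq_zero (hw : ∀ i, ContDiff ℝ 1 (w i))
    (hdiv : MemHdivZero M.domain (M.glue w)) {i : Fin M.numCells} {p : Vec (m + 1) × ℝ}
    (hp : p ∈ (M.cell i).halfspaces) {x : Vec (m + 1)} (hx : x ∈ (M.cell i).facet p) :
    ⟪jump w i p x, p.1⟫ = 0 := by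
  have hc : Continuous fun x => ⟪jump w i p x, p.1⟫ :=
    (continuous_jump (fun i => (hw i).continuous) i p).inner continuous_const
  have hcl : IsClosed {x | ⟪jump w i p x, p.1⟫ = 0} := isClosed_eq hc continuous_const
  exact hcl.closure_subset_iff.mpr
    (fun z hz => inner_jump_eq_zero_of_mem_relFacet hw hdiv hp hz)
    ((M.cell i).facet_subset_closure_relFacet hp hx)

end normal

end Mesh

/-! ### Tensor algebra -/

section tensors

variable {d k : ℕ}

theorem act_add (A B : Matrix (Fin d) (Fin d) ℝ) (n : Vec d) : act (A + B) n = act A n + act B n := by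
  ext a; simp [act, Matrix.add_mulVec]

theorem act_sub (A B : Matrix (Fin d) (Fin d) ℝ) (n : Vec d) : act (A - B) n = act A n - act B n := by
  ext a; simp [act, Matrix.sub_mulVec]

theorem act_smul (c : ℝ) (A : Matrix (Fin d) (Fin d) ℝ) (n : Vec d) :
    act (c • A) n = c • act A n := by
  ext a; simp [act, Matrix.smul_mulVec]

theorem act_one (n : Vec d) : act 1 n = n := by
  ext a; simp [act]

theorem act_neg_right (A : Matrix (Fin d) (Fin d) ℝ) (n : Vec d) : act A (-n) = -act A n := by
  ext a; simp [act, Matrix.mulVec_neg]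

theorem act_vecMulVec (a b n : Vec d) : act (Matrix.vecMulVec a.ofLp b.ofLp) n = ⟪b, n⟫ • a := by
  ext c
  simp [act, Matrix.mulVec, Matrix.vecMulVec_apply, dotProduct, PiLp.inner_apply, Finset.sum_mul]
  exact Finset.sum_congr rfl fun _ _ => by ring

theorem frob_self_nonneg (A : Matrix (Fin d) (Fin d) ℝ) : 0 ≤ frob A A :=
  Finset.sum_nonneg fun _ _ => Finset.sum_nonneg fun _ _ => mul_self_nonneg _

theorem norm_act_sq_le (A : Matrix (Fin d) (Fin d) ℝ) {n : Vec d} (hn : ‖n‖ = 1) :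
    ‖act A n‖ ^ 2 ≤ frob A A := by
  rw [EuclideanSpace.norm_sq_eq]
  refine Finset.sum_le_sum fun a _ => ?_
  have h1 := Finset.sum_mul_sq_le_sq_mul_sq Finset.univ (fun b => A a b) (fun b => n b)
  have h2 : ∑ b, n b ^ 2 = 1 := by
    have := EuclideanSpace.real_norm_sq_eq n
    rw [hn] at this; rw [← this]; norm_num
  rw [h2, mul_one] at h1
  rw [Real.norm_eq_abs, sq_abs]
  refine le_trans h1 (le_of_eq ?_)
  exact Finset.sum_congr rfl fun _ _ => sq _

theorem frob_average_le (A B : Matrix (Fin d) (Fin d) ℝ) :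
    frob ((1 / 2 : ℝ) • (A + B)) ((1 / 2 : ℝ) • (A + B)) ≤ 1 / 2 * (frob A A + frob B B) := by
  unfold frob
  rw [← Finset.sum_add_distrib, Finset.mul_sum]
  refine Finset.sum_le_sum fun a _ => ?_
  rw [← Finset.sum_add_distrib, Finset.mul_sum]
  refine Finset.sum_le_sum fun b _ => ?_
  simp only [Matrix.smul_apply, Matrix.add_apply, smul_eq_mul]
  nlinarith [sq_nonneg (A a b - B a b)]

/-- The difference of the two sides is `(2/3) (1 - d/3) (div v)²`: zero for `d = 3`, nonnegative for
`d = 2`. Only the symmetric part of the gradient meets `τ`. -/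
theorem frob_tau_le (hd : d = 2 ∨ d = 3) (v : Vec d → Vec d) (x : Vec d) :
    1 / 2 * frob (tau v x) (tau v x) ≤ frob (tau v x) (grad v x) := by
  unfold tau divergence
  generalize grad v x = G
  rcases hd with rfl | rfl
  · simp only [frob, Fin.sum_univ_two, Matrix.sub_apply, Matrix.add_apply, Matrix.transpose_apply,
      Matrix.smul_apply, Matrix.one_apply, Matrix.trace, Matrix.diag_apply, smul_eq_mul]
    simp
    nlinarith [sq_nonneg (G 0 0 + G 1 1)]
  · simp only [frob, Fin.sum_univ_three, Matrix.sub_apply, Matrix.add_apply, Matrix.transpose_apply,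
      Matrix.smul_apply, Matrix.one_apply, Matrix.trace, Matrix.diag_apply, smul_eq_mul]
    simp
    nlinarith [sq_nonneg (G 0 0 + G 1 1 + G 2 2)]

theorem frob_vecMulVec_grad (v : Vec d → Vec d) (x a : Vec d) :
    frob (Matrix.vecMulVec a.ofLp a.ofLp) (grad v x) = ⟪a, fderiv ℝ v x a⟫ := by
  have h1 : fderiv ℝ v x a = ∑ b, a b • fderiv ℝ v x (EuclideanSpace.single b 1) := by
    conv_lhs => rw [← sum_smul_single a, map_sum]
    exact Finset.sum_congr rfl fun b _ => by rw [map_smul]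
  rw [h1]
  simp [frob, grad, Matrix.vecMulVec_apply, PiLp.inner_apply]
  refine Finset.sum_congr rfl fun c _ => ?_
  rw [Finset.sum_mul]
  exact Finset.sum_congr rfl fun b _ => by ring

theorem grad_apply_eq {v : Vec d → Vec d} (hv : Differentiable ℝ v) (x : Vec d) (a b : Fin d) :
    grad v x a b = fderiv ℝ (fun x => v x a) x (EuclideanSpace.single b 1) := by
  have h1 := (EuclideanSpace.proj (𝕜 := ℝ) a).hasFDerivAt.comp x (hv x).hasFDerivAt
  change _ = fderiv ℝ (⇑(EuclideanSpace.proj (𝕜 := ℝ) a) ∘ v) x _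
  rw [h1.fderiv]
  rfl

theorem isPoly_grad {v : Vec d → Vec d} (hv : ∀ a, IsPoly k fun x => v x a) (a b : Fin d) :
    IsPoly k fun x => grad v x a b := by
  have h1 : Differentiable ℝ v := (contDiff_of_isPoly (n := 1) hv).differentiable (by simp)
  simp_rw [grad_apply_eq h1]
  exact (hv a).fderiv b

theorem isPoly_tau {v : Vec d → Vec d} (hv : ∀ a, IsPoly k fun x => v x a) (a b : Fin d) :
    IsPoly k fun x => tau v x a b := by
  have h1 : IsPoly k (divergence v) :=
    IsPoly.sum (s := Finset.univ) fun a _ => isPoly_grad hv a a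
  have h2 := ((isPoly_grad hv a b).add (isPoly_grad hv b a)).add
    (h1.const_mul (-(2 / 3) * (1 : Matrix (Fin d) (Fin d) ℝ) a b))
  convert! h2 using 2
  simp [tau]
  ring

theorem continuous_tau {v : Vec d → Vec d} (hv : ∀ a, IsPoly k fun x => v x a) :
    Continuous (tau v) :=
  continuous_matrix fun a b => (isPoly_tau hv a b).continuous

theorem continuous_grad {v : Vec d → Vec d} (hv : ∀ a, IsPoly k fun x => v x a) :
    Continuous (grad v) :=
  continuous_matrix fun a b => (isPoly_grad hv a b).continuous

theorem _root_.Continuous.act {X : Type*} [TopologicalSpace X] {A : X → Matrix (Fin d) (Fin d) ℝ}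
    (hA : Continuous A) (n : Vec d) : Continuous fun x => act (A x) n :=
  (PiLp.continuous_toLp 2 _).comp (hA.matrix_mulVec continuous_const)

theorem _root_.Continuous.frob {X : Type*} [TopologicalSpace X] {A B : X → Matrix (Fin d) (Fin d) ℝ}
    (hA : Continuous A) (hB : Continuous B) : Continuous fun x => frob (A x) (B x) :=
  continuous_finsetSum _ fun a _ => continuous_finsetSum _ fun b _ =>
    (hA.matrix_elem a b).mul (hB.matrix_elem a b)

end tensors

namespace Mesh

/-! ### Averages, jumps and face integrals -/

section faces

variable {m : ℕ} {M : Mesh (m + 1)} {i j : Fin M.numCells} {p : Vec (m + 1) × ℝ}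

theorem avg_eq {V : Type} [AddCommGroup V] [Module ℝ V] (v : Broken M V)
    (h : M.neighbor i p = some j) (x : Vec (m + 1)) :
    avg v i p x = (1 / 2 : ℝ) • (v i x + v j x) := by
  simp only [avg, h]

theorem avg_eq_of_none {V : Type} [AddCommGroup V] [Module ℝ V] (v : Broken M V)
    (h : M.neighbor i p = none) (x : Vec (m + 1)) : avg v i p x = v i x := by
  simp only [avg, h]

theorem avg_neg {V : Type} [AddCommGroup V] [Module ℝ V] (v : Broken M V)
    (hp : p ∈ (M.cell i).halfspaces) (h : M.neighbor i p = some j) (x : Vec (m + 1)) :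
    avg v j (-p) x = avg v i p x := by
  rw [avg_eq v h, avg_eq v (neighbor_symm hp h), add_comm]

theorem jump_eq {V : Type} [AddCommGroup V] [Module ℝ V] (v : Broken M V)
    (h : M.neighbor i p = some j) (x : Vec (m + 1)) : jump v i p x = v i x - v j x := by
  simp only [jump, h]

theorem jump_eq_of_none {V : Type} [AddCommGroup V] [Module ℝ V] (v : Broken M V)
    (h : M.neighbor i p = none) (x : Vec (m + 1)) : jump v i p x = v i x := by
  simp only [jump, h]

theorem jump_neg {V : Type} [AddCommGroup V] [Module ℝ V] (v : Broken M V)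
    (hp : p ∈ (M.cell i).halfspaces) (h : M.neighbor i p = some j) (x : Vec (m + 1)) :
    jump v j (-p) x = -jump v i p x := by
  rw [jump_eq v h, jump_eq v (neighbor_symm hp h), neg_sub]

theorem continuousOn_avg {V : Type} [AddCommGroup V] [Module ℝ V] [TopologicalSpace V]
    [ContinuousAdd V] [ContinuousConstSMul ℝ V] {v : Broken M V}
    (hv : ∀ i, ContinuousOn (v i) (M.cell i).carrier) (hp : p ∈ (M.cell i).halfspaces) :
    ContinuousOn (avg v i p) ((M.cell i).facet p) := by
  rcases h : M.neighbor i p with _ | j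
  · exact ((hv i).mono (Cell.facet_subset _ _)).congr fun x _ => avg_eq_of_none v h x
  · exact (((hv i).mono (Cell.facet_subset _ _)).add
      ((hv j).mono (facet_subset_neighbor hp h))).const_smul (1 / 2 : ℝ) |>.congr
        fun x _ => avg_eq v h x

theorem continuous_avg {V : Type} [AddCommGroup V] [Module ℝ V] [TopologicalSpace V]
    [ContinuousAdd V] [ContinuousConstSMul ℝ V] {v : Broken M V}
    (hv : ∀ i, Continuous (v i)) (i : Fin M.numCells) (p : Vec (m + 1) × ℝ) :
    Continuous (avg v i p) := by
  unfold avg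
  rcases M.neighbor i p with _ | j
  · exact hv i
  · exact ((hv i).add (hv j)).const_smul (1 / 2 : ℝ)

theorem act_jumpTensorNormal (v : Broken M (Vec (m + 1))) (i : Fin M.numCells)
    (p : Vec (m + 1) × ℝ) (x n : Vec (m + 1)) :
    act (jumpTensorNormal v i p x) n = ⟪p.1, n⟫ • jump v i p x := by
  unfold jumpTensorNormal jump
  rcases M.neighbor i p with _ | j
  · exact act_vecMulVec _ _ _
  · simp only
    rw [act_add, act_vecMulVec]
    have := act_vecMulVec (v j x) (-p.1) n
    rw [this, inner_neg_left, smul_sub, neg_smul, sub_eq_add_neg]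

theorem act_fluxInv (ζ : ℝ) (u : Broken M (Vec (m + 1))) (π : Broken M ℝ) (i : Fin M.numCells)
    (p : Vec (m + 1) × ℝ) (x n : Vec (m + 1)) :
    act (M.fluxInv ζ u π i p x) n = ⟪avg u i p x, n⟫ • avg u i p x + avg π i p x • n +
      (ζ * |⟪avg u i p x, p.1⟫| * ⟪p.1, n⟫) • jump u i p x := by
  unfold fluxInv
  rw [act_add, act_add, act_vecMulVec, act_smul, act_one, act_smul, act_jumpTensorNormal, smul_smul]

theorem act_fluxVis (η : ℝ) (u : Broken M (Vec (m + 1))) (i : Fin M.numCells)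
    (p : Vec (m + 1) × ℝ) (x n : Vec (m + 1)) :
    act (M.fluxVis η u i p x) n = act (avg (fun j => tau (u j)) i p x) n -
      (η / M.faceDiam i p * ⟪p.1, n⟫) • jump u i p x := by
  unfold fluxVis
  rw [act_sub, act_smul, act_jumpTensorNormal, smul_smul]

variable {f g : Vec (m + 1) → ℝ}

theorem integrableOn_facet (hp : p ∈ (M.cell i).halfspaces)
    (hf : ContinuousOn f ((M.cell i).facet p)) :
    IntegrableOn f ((M.cell i).facet p) (Measure.euclideanHausdorffMeasure (m + 1 - 1)) :=
  (M.cell i).integrableOn_facet ((M.cell i).unit_normal p hp) hf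

theorem facetInt_congr (h : ∀ x ∈ (M.cell i).facet p, f x = g x) :
    M.facetInt i p f = M.facetInt i p g :=
  setIntegral_congr_fun ((M.cell i).isClosed_facet p).measurableSet h

theorem facetInt_const_mul (c : ℝ) : M.facetInt i p (fun x => c * f x) = c * M.facetInt i p f :=
  integral_const_mul _ _

theorem facetInt_nonneg (h : ∀ x, 0 ≤ f x) : 0 ≤ M.facetInt i p f := integral_nonneg h

theorem facetInt_add (hp : p ∈ (M.cell i).halfspaces)
    (hf : ContinuousOn f ((M.cell i).facet p)) (hg : ContinuousOn g ((M.cell i).facet p)) :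
    M.facetInt i p (fun x => f x + g x) = M.facetInt i p f + M.facetInt i p g :=
  integral_add (integrableOn_facet hp hf) (integrableOn_facet hp hg)

theorem facetInt_sub (hp : p ∈ (M.cell i).halfspaces)
    (hf : ContinuousOn f ((M.cell i).facet p)) (hg : ContinuousOn g ((M.cell i).facet p)) :
    M.facetInt i p (fun x => f x - g x) = M.facetInt i p f - M.facetInt i p g :=
  integral_sub (integrableOn_facet hp hf) (integrableOn_facet hp hg)

theorem facetInt_mono (hp : p ∈ (M.cell i).halfspaces)
    (hf : ContinuousOn f ((M.cell i).facet p)) (hg : ContinuousOn g ((M.cell i).facet p))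
    (h : ∀ x ∈ (M.cell i).facet p, f x ≤ g x) : M.facetInt i p f ≤ M.facetInt i p g :=
  setIntegral_mono_on (integrableOn_facet hp hf) (integrableOn_facet hp hg)
    ((M.cell i).isClosed_facet p).measurableSet h

variable {G : Fin M.numCells → Vec (m + 1) × ℝ → Vec (m + 1) → ℝ}

/-- Integrals over the boundaries of all elements, rearranged as integrals over the faces. -/
theorem bdryInt_eq_faceSum {H H' : Fin M.numCells → Vec (m + 1) × ℝ → Vec (m + 1) → ℝ}
    (hG : ∀ i, ∀ p ∈ (M.cell i).halfspaces, ContinuousOn (G i p) ((M.cell i).facet p))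
    (hint : ∀ i, ∀ p ∈ (M.cell i).halfspaces, ∀ j, M.neighbor i p = some j →
      ∀ x ∈ (M.cell i).facet p, G i p x + G j (-p) x = H i p x)
    (hbd : ∀ i, ∀ p ∈ (M.cell i).halfspaces, M.neighbor i p = none →
      ∀ x ∈ (M.cell i).facet p, G i p x = H' i p x) :
    M.bdryInt G = M.interiorFaceSum (fun i p => M.facetInt i p (H i p)) +
      M.boundaryFaceSum fun i p => M.facetInt i p (H' i p) := by
  unfold bdryInt
  rw [sum_facets_eq]
  congr 1
  · refine interiorFaceSum_congr fun i p hp j h => ?_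
    have hc : ContinuousOn (G j (-p)) ((M.cell i).facet p) := by
      rw [← facet_neg hp h]
      exact hG j (-p) (neg_mem_halfspaces hp h)
    rw [opposite_eq h, facetInt_neg hp h, ← facetInt_add hp (hG i p hp) hc]
    exact facetInt_congr (hint i p hp j h)
  · exact boundaryFaceSum_congr fun i p hp h => facetInt_congr (hbd i p hp h)

theorem bdryInt_const_mul (c : ℝ) :
    M.bdryInt (fun i p x => c * G i p x) = c * M.bdryInt G := by
  unfold bdryInt
  simp_rw [facetInt_const_mul, Finset.mul_sum]

theorem bdryInt_add {H : Fin M.numCells → Vec (m + 1) × ℝ → Vec (m + 1) → ℝ}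
    (hG : ∀ i, ∀ p ∈ (M.cell i).halfspaces, ContinuousOn (G i p) ((M.cell i).facet p))
    (hH : ∀ i, ∀ p ∈ (M.cell i).halfspaces, ContinuousOn (H i p) ((M.cell i).facet p)) :
    M.bdryInt (fun i p x => G i p x + H i p x) = M.bdryInt G + M.bdryInt H := by
  unfold bdryInt
  rw [← Finset.sum_add_distrib]
  refine Finset.sum_congr rfl fun i _ => ?_
  rw [← Finset.sum_add_distrib]
  exact Finset.sum_congr rfl fun p hp => facetInt_add hp (hG i p hp) (hH i p hp)

theorem faceDiam_pos (hm : m ≠ 0) (hp : p ∈ (M.cell i).halfspaces) : 0 < M.faceDiam i p :=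
  (M.cell i).diam_facet_pos hm hp

end faces

/-! ### The inviscid terms -/

section inviscid

variable {m k : ℕ} {M : Mesh (m + 1)} {u : Broken M (Vec (m + 1))} {π : Broken M ℝ}

/-- Write the two traces as `A ± J/2` with `J·n = 0`. Then half the jump of `|u|² u·n` is
`(A·J)(A·n)`, exactly the contribution of the central flux; the pressure contributes a multiple of
`J·n = 0`, and only the upwind term is left. -/
theorem inner_fluxInv_add (ζ : ℝ) {i j : Fin M.numCells} {p : Vec (m + 1) × ℝ}
    (hp : p ∈ (M.cell i).halfspaces) (h : M.neighbor i p = some j) {x : Vec (m + 1)}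
    (hx : ⟪jump u i p x, p.1⟫ = 0) :
    (⟪act (M.fluxInv ζ u π i p x) p.1, u i x⟫ - 1 / 2 * (‖u i x‖ ^ 2 * ⟪u i x, p.1⟫)) +
      (⟪act (M.fluxInv ζ u π j (-p) x) (-p).1, u j x⟫ -
        1 / 2 * (‖u j x‖ ^ 2 * ⟪u j x, (-p).1⟫)) =
      ζ * (|⟪avg u i p x, p.1⟫| * ‖jump u i p x‖ ^ 2) := by
  have hnn : ⟪p.1, p.1⟫ = 1 := by
    rw [real_inner_self_eq_norm_sq, (M.cell i).unit_normal p hp]; norm_num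
  rw [act_fluxInv, act_fluxInv, avg_neg u hp h, avg_neg π hp h, jump_neg u hp h]
  have h1 : u i x = avg u i p x + (1 / 2 : ℝ) • jump u i p x := by
    rw [avg_eq u h, jump_eq u h]; module
  have h2 : u j x = avg u i p x - (1 / 2 : ℝ) • jump u i p x := by
    rw [avg_eq u h, jump_eq u h]; module
  rw [h1, h2]
  generalize avg u i p x = A at *
  generalize jump u i p x = J at *
  have hx' : ⟪p.1, J⟫ = 0 := by rw [real_inner_comm]; exact hx
  have hAn := real_inner_comm A p.1
  simp only [Prod.fst_neg, inner_add_left, inner_add_right, inner_sub_left, inner_sub_right,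
    inner_neg_left, inner_neg_right, inner_smul_left, inner_smul_right, norm_add_sq_real,
    norm_sub_sq_real, norm_smul, conj_trivial, abs_neg, hnn, hx, hx',
    real_inner_self_eq_norm_sq, real_inner_comm A J, smul_neg, Real.norm_eq_abs, mul_pow, sq_abs]
  rw [hAn]
  ring

theorem cellInt_const_mul (c : ℝ) (f : Broken M ℝ) :
    M.cellInt (fun i x => c * f i x) = c * M.cellInt f := by
  unfold cellInt
  rw [Finset.mul_sum]
  exact Finset.sum_congr rfl fun i _ => integral_const_mul _ _

/-- The derivative of `|u|²` along `u` is twice `(u ⊗ u) : ∇u`. The extra term `-1/2 ((∇·u) u, w)`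
of the method is what completes the pair to a full divergence without requiring `∇·u = 0` pointwise.
-/
theorem convective_cells_eq (hu : ∀ i a, IsPoly k fun x => u i x a) :
    (M.cellInt fun i x => frob (Matrix.vecMulVec (u i x) (u i x)) (grad (u i) x)) +
      1 / 2 * (M.cellInt fun i x => ⟪divergence (u i) x • u i x, u i x⟫) =
      1 / 2 * M.bdryInt fun i p x => ‖u i x‖ ^ 2 * ⟪u i x, p.1⟫ := by
  have huc : ∀ i, ContDiff ℝ 1 (u i) := fun i => contDiff_of_isPoly (hu i)
  rw [bdryInt_mul_inner_eq huc (φ := fun i x => ‖u i x‖ ^ 2) fun i => (huc i).norm_sq ℝ,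
    mul_add, add_comm]
  congr 1
  · congr 2
    funext i x
    rw [inner_smul_left, real_inner_self_eq_norm_sq, conj_trivial, mul_comm]
  · rw [← cellInt_const_mul]
    congr 1
    funext i x
    rw [frob_vecMulVec_grad]
    have h1 := (((huc i).differentiable (by simp) x).hasFDerivAt).norm_sq
    rw [h1.fderiv]
    simp

theorem continuousOn_inner_fluxInv (hcont : ∀ i, Continuous (u i))
    (hπ : ∀ i, ContinuousOn (π i) (M.cell i).carrier) (ζ : ℝ) {i : Fin M.numCells}
    {p : Vec (m + 1) × ℝ} (hp : p ∈ (M.cell i).halfspaces) :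
    ContinuousOn (fun x => ⟪act (M.fluxInv ζ u π i p x) p.1, u i x⟫) ((M.cell i).facet p) := by
  simp_rw [act_fluxInv]
  have h0 := (hcont i).continuousOn (s := (M.cell i).facet p)
  have h1 := (continuous_avg hcont i p).continuousOn (s := (M.cell i).facet p)
  have h2 := (continuous_jump hcont i p).continuousOn (s := (M.cell i).facet p)
  have h3 := continuousOn_avg hπ hp
  generalize (M.cell i).facet p = F at *
  generalize avg u i p = A at *
  generalize avg π i p = P at *
  generalize jump u i p = J at *
  generalize u i = U at *
  fun_prop

/-- Tested with the velocity itself, the convective and pressure terms reduce to the seminorm. -/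
theorem inviscid_eq (hu : ∀ i a, IsPoly k fun x => u i x a)
    (hn : ∀ i, ∀ p ∈ (M.cell i).halfspaces, ∀ x ∈ (M.cell i).facet p, ⟪jump u i p x, p.1⟫ = 0)
    (hπ : ∀ i, ContinuousOn (π i) (M.cell i).carrier) {ζ : ℝ} (hζ : 0 ≤ ζ) :
    -(M.cellInt fun i x => frob (Matrix.vecMulVec (u i x) (u i x)) (grad (u i) x))
      + (M.bdryInt fun i p x => ⟪act (M.fluxInv ζ u π i p x) p.1, u i x⟫)
      - 1 / 2 * (M.cellInt fun i x => ⟪divergence (u i) x • u i x, u i x⟫) =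
    M.convSeminorm ζ u u ^ 2 := by
  have hcont : ∀ i, Continuous (u i) := fun i => (contDiff_of_isPoly (n := 0) (hu i)).continuous
  have hflux : ∀ i, ∀ p ∈ (M.cell i).halfspaces,
      ContinuousOn (fun x => ⟪act (M.fluxInv ζ u π i p x) p.1, u i x⟫) ((M.cell i).facet p) :=
    fun i p hp => continuousOn_inner_fluxInv hcont hπ ζ hp
  have hcub : ∀ i, ∀ p ∈ (M.cell i).halfspaces,
      ContinuousOn (fun x => (-(1 / 2)) * (‖u i x‖ ^ 2 * ⟪u i x, p.1⟫)) ((M.cell i).facet p) :=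
    fun i p hp => (continuous_const.mul (((hcont i).norm.pow 2).mul
      ((hcont i).inner continuous_const))).continuousOn
  have hfaces : (M.bdryInt fun i p x => ⟪act (M.fluxInv ζ u π i p x) p.1, u i x⟫) +
      (-(1 / 2)) * (M.bdryInt fun i p x => ‖u i x‖ ^ 2 * ⟪u i x, p.1⟫) =
      ζ * M.interiorFaceSum fun i p =>
        M.facetInt i p fun x => |⟪avg u i p x, p.1⟫| * ‖jump u i p x‖ ^ 2 := by
    rw [← bdryInt_const_mul, ← bdryInt_add hflux hcub, bdryInt_eq_faceSum
      (G := fun i p x => ⟪act (M.fluxInv ζ u π i p x) p.1, u i x⟫ +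
        (-(1 / 2)) * (‖u i x‖ ^ 2 * ⟪u i x, p.1⟫))
      (H := fun i p x => ζ * (|⟪avg u i p x, p.1⟫| * ‖jump u i p x‖ ^ 2)) (H' := fun _ _ _ => 0)
      (fun i p hp => (hflux i p hp).add (hcub i p hp))]
    · have h0 : (M.boundaryFaceSum fun i p => M.facetInt i p fun _ => 0) = 0 := by
        simp only [facetInt, integral_zero, boundaryFaceSum_zero]
      rw [h0, add_zero, ← interiorFaceSum_const_mul]
      exact interiorFaceSum_congr fun i p hp j h => facetInt_const_mul ζ
    · intro i p hp j h x hx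
      rw [← inner_fluxInv_add ζ hp h (hn i p hp x hx)]
      ring
    · intro i p hp h x hx
      have h3 := hn i p hp x hx
      rw [jump_eq_of_none u h] at h3
      have h3' : ⟪p.1, u i x⟫ = 0 := by rw [real_inner_comm]; exact h3
      rw [act_fluxInv, avg_eq_of_none u h, h3, inner_add_left, inner_add_left, inner_smul_left,
        inner_smul_left, inner_smul_left, h3']
      simp
  have hnonneg : 0 ≤ ζ * M.interiorFaceSum fun i p =>
      M.facetInt i p fun x => |⟪avg u i p x, p.1⟫| * ‖jump u i p x‖ ^ 2 := by
    refine mul_nonneg hζ ?_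
    rw [← interiorFaceSum_zero (M := M)]
    exact interiorFaceSum_mono fun i p hp j h => facetInt_nonneg fun x => by positivity
  have hcells := convective_cells_eq hu
  rw [convSeminorm, Real.sq_sqrt hnonneg, ← hfaces]
  linarith

end inviscid

end Mesh

namespace Mesh

/-! ### Coercivity of the viscous form -/

section viscous

variable {m k : ℕ} {M : Mesh (m + 1)} {u : Broken M (Vec (m + 1))}

/-- The broken tensor `τ(u)`. -/
def brokenTau (u : Broken M (Vec (m + 1))) : Broken M (Matrix (Fin (m + 1)) (Fin (m + 1)) ℝ) :=
  fun i => tau (u i)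

/-- The side integrand of the viscous form. -/
def viscousSide (η : ℝ) (u : Broken M (Vec (m + 1))) (i : Fin M.numCells) (p : Vec (m + 1) × ℝ)
    (x : Vec (m + 1)) : ℝ :=
  -⟪act (M.fluxVis η u i p x) p.1, u i x⟫ + ⟪avg u i p x - u i x, act (tau (u i) x) p.1⟫

/-- The face integrand of the viscous form: penalty term minus `c` consistency terms. -/
def viscousFace (η c : ℝ) (u : Broken M (Vec (m + 1))) (i : Fin M.numCells)
    (p : Vec (m + 1) × ℝ) (x : Vec (m + 1)) : ℝ :=
  η / M.faceDiam i p * ‖jump u i p x‖ ^ 2 -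
    c * ⟪jump u i p x, act (avg (brokenTau u) i p x) p.1⟫

/-- One copy of `-J·{τ}n` comes from the stress flux; the other comes from the velocity flux,
because `{u} - u` equals `-J/2` on one side and `J/2` on the other. On a boundary face `{u} - u`
vanishes, so the factor there is `1` until the `θ` term is added. -/
theorem viscousSide_add (η : ℝ) {i j : Fin M.numCells} {p : Vec (m + 1) × ℝ}
    (hp : p ∈ (M.cell i).halfspaces) (h : M.neighbor i p = some j) (x : Vec (m + 1)) :
    viscousSide η u i p x + viscousSide η u j (-p) x = viscousFace η 2 u i p x := by
  have hnn : ⟪p.1, p.1⟫ = 1 := by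
    rw [real_inner_self_eq_norm_sq, (M.cell i).unit_normal p hp]; norm_num
  unfold viscousSide viscousFace
  rw [act_fluxVis, act_fluxVis]
  change -⟪act (avg (brokenTau u) i p x) p.1 - _, _⟫ + _ +
    (-⟪act (avg (brokenTau u) j (-p) x) (-p).1 - _, _⟫ + _) = _
  rw [avg_neg u hp h, avg_neg (brokenTau u) hp h, jump_neg u hp h, faceDiam_neg hp h]
  have hT : act (avg (brokenTau u) i p x) p.1 =
      (1 / 2 : ℝ) • (act (tau (u i) x) p.1 + act (tau (u j) x) p.1) := by
    rw [avg_eq (brokenTau u) h, act_smul, act_add]; rfl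
  have h1 : u i x = avg u i p x + (1 / 2 : ℝ) • jump u i p x := by
    rw [avg_eq u h, jump_eq u h]; module
  have h2 : u j x = avg u i p x - (1 / 2 : ℝ) • jump u i p x := by
    rw [avg_eq u h, jump_eq u h]; module
  rw [Prod.fst_neg, act_neg_right, act_neg_right, hT]
  generalize act (tau (u i) x) p.1 = S at *
  generalize act (tau (u j) x) p.1 = T at *
  rw [h1, h2]
  generalize avg u i p x = A at *
  generalize jump u i p x = J at *
  generalize η / M.faceDiam i p = e
  simp only [inner_add_left, inner_add_right, inner_sub_left, inner_sub_right, inner_neg_left,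
    inner_neg_right, inner_smul_left, inner_smul_right, conj_trivial, hnn,
    real_inner_self_eq_norm_sq, real_inner_comm A J, real_inner_comm S J, real_inner_comm T J,
    real_inner_comm S A, real_inner_comm T A, smul_neg]
  ring

theorem viscousSide_of_none (η : ℝ) {i : Fin M.numCells} {p : Vec (m + 1) × ℝ}
    (hp : p ∈ (M.cell i).halfspaces) (h : M.neighbor i p = none) (x : Vec (m + 1)) :
    viscousSide η u i p x = viscousFace η 1 u i p x := by
  have hnn : ⟪p.1, p.1⟫ = 1 := by
    rw [real_inner_self_eq_norm_sq, (M.cell i).unit_normal p hp]; norm_num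
  unfold viscousSide viscousFace
  rw [act_fluxVis, hnn]
  change -⟪act (avg (brokenTau u) i p x) p.1 - _, _⟫ + _ = _
  rw [avg_eq_of_none u h, avg_eq_of_none (brokenTau u) h,
    jump_eq_of_none u h, inner_sub_left, inner_smul_left, real_inner_self_eq_norm_sq,
    real_inner_comm (u i x), sub_self, inner_zero_left, conj_trivial]
  ring

theorem continuous_brokenTau (hu : ∀ i a, IsPoly k fun x => u i x a) (i : Fin M.numCells) :
    Continuous (brokenTau u i) := continuous_tau (hu i)

theorem continuous_act_fluxVis (hu : ∀ i a, IsPoly k fun x => u i x a) (η : ℝ)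
    (i : Fin M.numCells) (p : Vec (m + 1) × ℝ) :
    Continuous fun x => act (M.fluxVis η u i p x) p.1 := by
  have hj := continuous_jump
    (fun i => (contDiff_of_isPoly (n := 0) (hu i)).continuous) i p
  simp_rw [act_fluxVis]
  exact Continuous.sub ((continuous_avg (continuous_brokenTau hu) i p).act p.1)
    (Continuous.const_smul hj (η / M.faceDiam i p * ⟪p.1, p.1⟫))

theorem continuous_viscousSide (hu : ∀ i a, IsPoly k fun x => u i x a) (η : ℝ)
    (i : Fin M.numCells) (p : Vec (m + 1) × ℝ) : Continuous (viscousSide η u i p) := by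
  have hcont : ∀ i, Continuous (u i) := fun i => (contDiff_of_isPoly (n := 0) (hu i)).continuous
  refine ((continuous_act_fluxVis hu η i p).inner (hcont i)).neg.add (Continuous.inner ?_ ?_)
  · exact (continuous_avg hcont i p).sub (hcont i)
  · exact (continuous_tau (hu i)).act p.1

theorem continuous_viscousFace (hu : ∀ i a, IsPoly k fun x => u i x a) (η c : ℝ)
    (i : Fin M.numCells) (p : Vec (m + 1) × ℝ) : Continuous (viscousFace η c u i p) := by
  have hcont : ∀ i, Continuous (u i) := fun i => (contDiff_of_isPoly (n := 0) (hu i)).continuous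
  have hj := continuous_jump hcont i p
  exact (continuous_const.mul (hj.norm.pow 2)).sub (continuous_const.mul
    (hj.inner ((continuous_avg (continuous_brokenTau hu) i p).act p.1)))

theorem viscousForm_eq (hu : ∀ i a, IsPoly k fun x => u i x a) (η θ : ℝ) :
    M.viscousForm η θ u u = (M.cellInt fun i x => frob (tau (u i) x) (grad (u i) x)) +
      M.interiorFaceSum (fun i p => M.facetInt i p (viscousFace η 2 u i p)) +
      M.boundaryFaceSum fun i p => M.facetInt i p (viscousFace η (1 + θ) u i p) := by
  have hcont : ∀ i, Continuous (u i) := fun i => (contDiff_of_isPoly (n := 0) (hu i)).continuous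
  have hs : -(M.bdryInt fun i p x => ⟪act (M.fluxVis η u i p x) p.1, u i x⟫)
      + (M.bdryInt fun i p x => ⟪avg u i p x - u i x, act (tau (u i) x) p.1⟫) =
      M.bdryInt (viscousSide η u) := by
    have h1 : ∀ i p, Continuous fun x => (-1) * ⟪act (M.fluxVis η u i p x) p.1, u i x⟫ :=
      fun i p => continuous_const.mul ((continuous_act_fluxVis hu η i p).inner (hcont i))
    have h2 : ∀ i p, Continuous fun x => ⟪avg u i p x - u i x, act (tau (u i) x) p.1⟫ :=
      fun i p => ((continuous_avg hcont i p).sub (hcont i)).inner ((continuous_tau (hu i)).act p.1)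
    rw [← neg_one_mul, ← bdryInt_const_mul,
      ← bdryInt_add (fun i p _ => (h1 i p).continuousOn) fun i p _ => (h2 i p).continuousOn]
    unfold viscousSide
    simp only [neg_one_mul]
  rw [bdryInt_eq_faceSum (H := viscousFace η 2 u) (H' := viscousFace η 1 u)
    (fun i p _ => (continuous_viscousSide hu η i p).continuousOn)
    (fun i p hp j h x _ => viscousSide_add η hp h x)
    (fun i p hp h x _ => viscousSide_of_none η hp h x)] at hs
  have hb : (M.boundaryFaceSum fun i p => M.facetInt i p (viscousFace η 1 u i p)) -
      θ * (M.boundaryFaceSum fun i p =>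
        M.facetInt i p fun x => ⟪u i x, act (tau (u i) x) p.1⟫) =
      M.boundaryFaceSum fun i p => M.facetInt i p (viscousFace η (1 + θ) u i p) := by
    rw [sub_eq_add_neg, ← neg_mul, ← boundaryFaceSum_const_mul, ← boundaryFaceSum_add]
    refine boundaryFaceSum_congr fun i p hp h => ?_
    rw [← facetInt_const_mul, ← facetInt_add hp (continuous_viscousFace hu η 1 i p).continuousOn]
    · refine facetInt_congr fun x _ => ?_
      unfold viscousFace
      rw [avg_eq_of_none (brokenTau u) h, jump_eq_of_none u h, brokenTau]
      ring
    · exact (continuous_const.mul ((hcont i).inner ((continuous_tau (hu i)).act p.1))).continuousOn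
  unfold viscousForm
  rw [← hb]
  linarith

/-- The squared norm of `τ(u)` on an element. -/
def tauNormSq (u : Broken M (Vec (m + 1))) (i : Fin M.numCells) : ℝ :=
  ∫ x in (M.cell i).carrier, frob (tau (u i) x) (tau (u i) x)

theorem tauNormSq_nonneg (i : Fin M.numCells) : 0 ≤ tauNormSq u i :=
  integral_nonneg fun _ => frob_self_nonneg _

theorem continuous_frob_tau (hu : ∀ i a, IsPoly k fun x => u i x a) (i : Fin M.numCells) :
    Continuous fun x => frob (tau (u i) x) (tau (u i) x) :=
  (continuous_tau (hu i)).frob (continuous_tau (hu i))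

/-- The trace inequality for `τ(u)`. -/
theorem faceDiam_mul_facetInt_frob_le {ρ C : ℝ} (hC : IsTraceConst (m + 1) k ρ C)
    (hreg : ∀ i, (M.cell i).ShapeRegular ρ) (hu : ∀ i a, IsPoly k fun x => u i x a)
    {i : Fin M.numCells} {p : Vec (m + 1) × ℝ} (hp : p ∈ (M.cell i).halfspaces) :
    M.faceDiam i p * M.facetInt i p (fun x => frob (tau (u i) x) (tau (u i) x)) ≤
      C ^ 2 * tauNormSq u i := by
  have hpoly := isPoly_tau (hu i)
  have h1 : ∀ a b, Metric.diam (M.cell i).carrier * M.facetInt i p (fun x => tau (u i) x a b ^ 2) ≤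
      C ^ 2 * ∫ x in (M.cell i).carrier, tau (u i) x a b ^ 2 := by
    intro a b
    have h2 := hC.2 (M.cell i) (hreg i) p hp _ (hpoly a b)
    have h3 := pow_le_pow_left₀ (by positivity) h2 2
    rwa [mul_pow, mul_pow, Real.sq_sqrt Metric.diam_nonneg,
      Real.sq_sqrt (integral_nonneg fun _ => sq_nonneg _),
      Real.sq_sqrt (integral_nonneg fun _ => sq_nonneg _)] at h3
  have hfr : ∀ x, frob (tau (u i) x) (tau (u i) x) = ∑ a, ∑ b, tau (u i) x a b ^ 2 := fun x => by
    simp only [frob, sq]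
  have hface : M.facetInt i p (fun x => frob (tau (u i) x) (tau (u i) x)) =
      ∑ a, ∑ b, M.facetInt i p (fun x => tau (u i) x a b ^ 2) := by
    unfold facetInt
    simp_rw [hfr]
    rw [integral_finsetSum]
    · refine Finset.sum_congr rfl fun a _ => integral_finsetSum _ fun b _ => ?_
      exact integrableOn_facet hp ((hpoly a b).continuous.pow 2).continuousOn
    · intro a _
      exact integrableOn_facet hp (continuous_finsetSum _ fun b _ =>
        (hpoly a b).continuous.pow 2).continuousOn
  have hcell : tauNormSq u i = ∑ a, ∑ b, ∫ x in (M.cell i).carrier, tau (u i) x a b ^ 2 := by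
    unfold tauNormSq
    simp_rw [hfr]
    rw [integral_finsetSum]
    · refine Finset.sum_congr rfl fun a _ => integral_finsetSum _ fun b _ => ?_
      exact (M.cell i).integrableOn_carrier ((hpoly a b).continuous.pow 2).continuousOn
    · intro a _
      exact (M.cell i).integrableOn_carrier (continuous_finsetSum _ fun b _ =>
        (hpoly a b).continuous.pow 2).continuousOn
  -- The trace inequality carries the weight `h_K`, the penalty norm the smaller `h_F`.
  have hdiam : M.faceDiam i p ≤ Metric.diam (M.cell i).carrier :=
    Metric.diam_mono (Cell.facet_subset _ _) (M.cell i).isCompact_carrier.isBounded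
  refine (mul_le_mul_of_nonneg_right hdiam (facetInt_nonneg fun _ => frob_self_nonneg _)).trans ?_
  rw [hface, hcell, Finset.mul_sum, Finset.mul_sum]
  refine Finset.sum_le_sum fun a _ => ?_
  rw [Finset.mul_sum, Finset.mul_sum]
  exact Finset.sum_le_sum fun b _ => h1 a b

/-- The jump part of the norm on one face. -/
def jumpTerm (u : Broken M (Vec (m + 1))) (i : Fin M.numCells) (p : Vec (m + 1) × ℝ) : ℝ :=
  M.facetInt i p fun x => 1 / M.faceDiam i p * ‖jump u i p x‖ ^ 2

/-- Young's inequality with weight `B / h`. The bound `|c| ≤ 2` covers interior faces and both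
boundary variants at once. -/
theorem facetInt_viscousFace_ge (hm : m ≠ 0) (hu : ∀ i a, IsPoly k fun x => u i x a)
    {η c B : ℝ} (hB : 0 < B) (hc : |c| ≤ 2) {i : Fin M.numCells} {p : Vec (m + 1) × ℝ}
    (hp : p ∈ (M.cell i).halfspaces) :
    (η - B) * jumpTerm u i p - B⁻¹ * (M.faceDiam i p *
        M.facetInt i p fun x => ‖act (avg (brokenTau u) i p x) p.1‖ ^ 2) ≤
      M.facetInt i p (viscousFace η c u i p) := by
  have hcont : ∀ i, Continuous (u i) := fun i => (contDiff_of_isPoly (n := 0) (hu i)).continuous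
  have hj := continuous_jump hcont i p
  have hT := (continuous_avg (continuous_brokenTau hu) i p).act p.1
  have hh := faceDiam_pos (M := M) hm hp
  have h1 : Continuous fun x => (η - B) * (1 / M.faceDiam i p * ‖jump u i p x‖ ^ 2) :=
    continuous_const.mul (continuous_const.mul (hj.norm.pow 2))
  have h2 : Continuous fun x =>
      B⁻¹ * (M.faceDiam i p * ‖act (avg (brokenTau u) i p x) p.1‖ ^ 2) :=
    continuous_const.mul (continuous_const.mul (hT.norm.pow 2))
  unfold jumpTerm
  rw [← facetInt_const_mul, ← facetInt_const_mul, ← facetInt_const_mul,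
    ← facetInt_sub hp h1.continuousOn h2.continuousOn]
  refine facetInt_mono hp (h1.sub h2).continuousOn (continuous_viscousFace hu η c i p).continuousOn
    fun x _ => ?_
  unfold viscousFace
  set h := M.faceDiam i p
  generalize act (avg (brokenTau u) i p x) p.1 = T
  generalize jump u i p x = J
  have h1 : c * ⟪J, T⟫ ≤ 2 * (‖J‖ * ‖T‖) := by
    refine (le_abs_self _).trans ?_
    rw [abs_mul]
    exact mul_le_mul hc (abs_real_inner_le_norm J T) (abs_nonneg _) (by norm_num)
  have h2 : 2 * (‖J‖ * ‖T‖) ≤ B / h * ‖J‖ ^ 2 + h / B * ‖T‖ ^ 2 := by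
    have h3 : 0 ≤ (B * ‖J‖ - h * ‖T‖) ^ 2 / (B * h) := by positivity
    have h4 : (B * ‖J‖ - h * ‖T‖) ^ 2 / (B * h) =
        B / h * ‖J‖ ^ 2 + h / B * ‖T‖ ^ 2 - 2 * (‖J‖ * ‖T‖) := by
      field_simp
      ring
    linarith
  have h5 : (η - B) * (1 / h * ‖J‖ ^ 2) - B⁻¹ * (h * ‖T‖ ^ 2) =
      η / h * ‖J‖ ^ 2 - (B / h * ‖J‖ ^ 2 + h / B * ‖T‖ ^ 2) := by
    field_simp
    ring
  rw [h5]
  linarith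

/-- Charge `C² ‖τ‖²` of the adjacent element to each side of a face; every element is then charged
at most `N` times. Averaging would save a factor `1/2` on interior faces, but boundary faces have no
such gain. -/
theorem sum_face_tau_le {ρ C : ℝ} (hC : IsTraceConst (m + 1) k ρ C)
    (hreg : ∀ i, (M.cell i).ShapeRegular ρ) {N : ℕ} (hN : ∀ i, (M.cell i).halfspaces.card ≤ N)
    (hu : ∀ i a, IsPoly k fun x => u i x a) :
    (M.faceSum fun i p => M.faceDiam i p *
        M.facetInt i p fun x => ‖act (avg (brokenTau u) i p x) p.1‖ ^ 2) ≤
      C ^ 2 * N * ∑ i, tauNormSq u i := by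
  have htr : ∀ i, ∀ p ∈ (M.cell i).halfspaces, M.faceDiam i p *
      M.facetInt i p (fun x => frob (tau (u i) x) (tau (u i) x)) ≤ C ^ 2 * tauNormSq u i :=
    fun i p hp => faceDiam_mul_facetInt_frob_le hC hreg hu hp
  have hnn : ∀ i, 0 ≤ C ^ 2 * tauNormSq u i := fun i => mul_nonneg (sq_nonneg _) (tauNormSq_nonneg i)
  have hT : ∀ i p, Continuous fun x => ‖act (avg (brokenTau u) i p x) p.1‖ ^ 2 := fun i p =>
    ((continuous_avg (continuous_brokenTau hu) i p).act p.1).norm.pow 2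
  have hfr := continuous_frob_tau hu
  have h1 : (M.faceSum fun i p => M.faceDiam i p *
        M.facetInt i p fun x => ‖act (avg (brokenTau u) i p x) p.1‖ ^ 2) ≤
      ∑ i, ∑ p ∈ (M.cell i).halfspaces, C ^ 2 * tauNormSq u i := by
    rw [sum_facets_eq fun i _ => C ^ 2 * tauNormSq u i]
    refine add_le_add (interiorFaceSum_mono fun i p hp j h => ?_)
      (boundaryFaceSum_mono fun i p hp h => ?_)
    · rw [opposite_eq h]
      have h2 : M.facetInt i p (fun x => ‖act (avg (brokenTau u) i p x) p.1‖ ^ 2) ≤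
          1 / 2 * (M.facetInt i p (fun x => frob (tau (u i) x) (tau (u i) x)) +
            M.facetInt i p (fun x => frob (tau (u j) x) (tau (u j) x))) := by
        rw [← facetInt_add hp (hfr i).continuousOn (hfr j).continuousOn, ← facetInt_const_mul]
        refine facetInt_mono hp (hT i p).continuousOn
          (continuous_const.mul ((hfr i).add (hfr j))).continuousOn fun x _ => ?_
        refine (norm_act_sq_le _ ((M.cell i).unit_normal p hp)).trans ?_
        rw [avg_eq (brokenTau u) h]
        exact frob_average_le _ _
      have h3 := htr i p hp
      have h4 := htr j (-p) (neg_mem_halfspaces hp h)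
      rw [faceDiam_neg hp h, facetInt_neg hp h] at h4
      have h5 : 0 ≤ M.faceDiam i p := Metric.diam_nonneg
      have h6 := mul_le_mul_of_nonneg_left h2 h5
      have := hnn i
      have := hnn j
      nlinarith
    · refine le_trans (mul_le_mul_of_nonneg_left ?_ Metric.diam_nonneg) (htr i p hp)
      refine facetInt_mono hp (hT i p).continuousOn (hfr i).continuousOn fun x _ => ?_
      refine (norm_act_sq_le _ ((M.cell i).unit_normal p hp)).trans ?_
      rw [avg_eq_of_none (brokenTau u) h]
      rfl
  refine h1.trans ?_
  rw [Finset.mul_sum]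
  refine Finset.sum_le_sum fun i _ => ?_
  rw [Finset.sum_const, nsmul_eq_mul]
  have : ((M.cell i).halfspaces.card : ℝ) ≤ N := by exact_mod_cast hN i
  nlinarith [hnn i]

theorem symNorm_sq (u : Broken M (Vec (m + 1))) :
    M.symNorm u ^ 2 = ∑ i, tauNormSq u i + M.faceSum (jumpTerm u) := by
  refine Real.sq_sqrt (add_nonneg (Finset.sum_nonneg fun i _ => tauNormSq_nonneg i)
    (add_nonneg ?_ ?_))
  · rw [← interiorFaceSum_zero (M := M)]
    exact interiorFaceSum_mono fun i p hp j h => facetInt_nonneg fun x =>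
      mul_nonneg (div_nonneg zero_le_one Metric.diam_nonneg) (sq_nonneg _)
  · rw [← boundaryFaceSum_zero (M := M)]
    exact boundaryFaceSum_mono fun i p hp h => facetInt_nonneg fun x =>
      mul_nonneg (div_nonneg zero_le_one Metric.diam_nonneg) (sq_nonneg _)

theorem _root_.MixedNS.coercConst_pos {C η : ℝ} {N : ℕ} (hη : 2 * C ^ 2 * N < η) :
    0 < coercConst C N η := by
  have : 0 ≤ 2 * C ^ 2 * N := by positivity
  exact div_pos (by linarith) (by linarith)

/-- Coercivity of the viscous form. -/
theorem viscousForm_ge (hm : m + 1 = 2 ∨ m + 1 = 3) {ρ C : ℝ} (hC : IsTraceConst (m + 1) k ρ C)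
    (hreg : ∀ i, (M.cell i).ShapeRegular ρ) {N : ℕ} (hN : ∀ i, (M.cell i).halfspaces.card ≤ N)
    {η θ : ℝ} (hη : 2 * C ^ 2 * N < η) (hθ : θ = 0 ∨ θ = 1)
    (hu : ∀ i a, IsPoly k fun x => u i x a) :
    coercConst C N η * M.symNorm u ^ 2 ≤ M.viscousForm η θ u u := by
  set a : ℝ := C ^ 2 * N with ha
  set c := coercConst C N η with hc
  have ha0 : 0 ≤ a := by positivity
  have hη' : 2 * a < η := by rw [ha, ← mul_assoc]; exact hη
  have hc' : c = (η - 2 * a) / (1 + 2 * η) := by rw [hc, coercConst, ha, ← mul_assoc]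
  have hden : 0 < 1 + 2 * η := by linarith
  -- The Young weight for which the jump part retains exactly the coefficient `c`.
  set B := η - c with hBdef
  have hB' : B = (2 * η ^ 2 + 2 * a) / (1 + 2 * η) := by
    rw [hBdef, hc', eq_div_iff hden.ne', sub_mul, div_mul_cancel₀ _ hden.ne']; ring
  have hη0 : 0 < η := by linarith
  have hB : 0 < B := by rw [hB']; positivity
  -- What remains of the `τ` part must also be at least `c`. Multiplied by `B`, the slack is the
  -- perfect square `((η - 2a) / (1 + 2η))²`.
  have hAB : B⁻¹ * a ≤ 1 / 2 - c := by
    rw [inv_mul_le_iff₀ hB, hB', hc']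
    have h1 : (2 * η ^ 2 + 2 * a) / (1 + 2 * η) * (1 / 2 - (η - 2 * a) / (1 + 2 * η)) - a =
        (η - 2 * a) ^ 2 / (1 + 2 * η) ^ 2 := by field_simp; ring
    have h2 : 0 ≤ (η - 2 * a) ^ 2 / (1 + 2 * η) ^ 2 := by positivity
    linarith
  have hm0 : m ≠ 0 := by omega
  have hcell : 1 / 2 * ∑ i, tauNormSq u i ≤
      M.cellInt fun i x => frob (tau (u i) x) (grad (u i) x) := by
    unfold cellInt tauNormSq
    rw [Finset.mul_sum]
    refine Finset.sum_le_sum fun i _ => ?_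
    rw [← integral_const_mul]
    refine setIntegral_mono ?_ ?_ fun x => frob_tau_le hm (u i) x
    · exact (M.cell i).integrableOn_carrier
        (continuous_const.mul (continuous_frob_tau hu i)).continuousOn
    · exact (M.cell i).integrableOn_carrier
        ((continuous_tau (hu i)).frob (continuous_grad (hu i))).continuousOn
  have hface : c * M.faceSum (jumpTerm u) - B⁻¹ * (M.faceSum fun i p => M.faceDiam i p *
        M.facetInt i p fun x => ‖act (avg (brokenTau u) i p x) p.1‖ ^ 2) ≤
      M.interiorFaceSum (fun i p => M.facetInt i p (viscousFace η 2 u i p)) +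
      M.boundaryFaceSum fun i p => M.facetInt i p (viscousFace η (1 + θ) u i p) := by
    have h1 := interiorFaceSum_mono (M := M) fun i p hp j _ =>
      facetInt_viscousFace_ge (η := η) (c := 2) hm0 hu hB (by norm_num) (i := i) hp
    have h2 := boundaryFaceSum_mono (M := M) fun i p hp _ =>
      facetInt_viscousFace_ge (η := η) (c := 1 + θ) hm0 hu hB
        (by rcases hθ with rfl | rfl <;> norm_num) (i := i) hp
    have hcB : η - B = c := by rw [hBdef]; ring
    simp only [hcB, sub_eq_add_neg, ← neg_mul] at h1 h2
    rw [interiorFaceSum_add, interiorFaceSum_const_mul, interiorFaceSum_const_mul] at h1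
    rw [boundaryFaceSum_add, boundaryFaceSum_const_mul, boundaryFaceSum_const_mul] at h2
    unfold faceSum
    linarith
  have htau := mul_le_mul_of_nonneg_left (sum_face_tau_le hC hreg hN hu) (inv_pos.mpr hB).le
  have hsum : 0 ≤ ∑ i, tauNormSq u i := Finset.sum_nonneg fun i _ => tauNormSq_nonneg i
  have hfin := mul_le_mul_of_nonneg_right hAB hsum
  rw [viscousForm_eq hu, symNorm_sq]
  rw [← mul_assoc] at htau
  linarith

end viscous

/-! ### The energy inequality at a fixed time -/

theorem energy_inequality {m k : ℕ} {M : Mesh (m + 1)} {u ut : Broken M (Vec (m + 1))}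
    {π g : Broken M ℝ} (hm : m + 1 = 2 ∨ m + 1 = 3) {ρ C : ℝ} (hC : IsTraceConst (m + 1) k ρ C)
    (hreg : ∀ i, (M.cell i).ShapeRegular ρ) {N : ℕ} (hN : ∀ i, (M.cell i).halfspaces.card ≤ N)
    {η θ ν ζ : ℝ} (hη : 2 * C ^ 2 * N < η) (hθ : θ = 0 ∨ θ = 1) (hν : 0 ≤ ν) (hζ : 0 ≤ ζ)
    (hu : ∀ i a, IsPoly k fun x => u i x a) (hdiv : MemHdivZero M.domain (M.glue u))
    (hπ : ∀ i, ContinuousOn (π i) (M.cell i).carrier) (hmass : M.massForm u π = 0)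
    (hmom : M.momentumForm ν ζ η θ ut u π u = M.cellInt g) :
    M.cellInt (fun i x => ⟪ut i x, u i x⟫) +
      (M.convSeminorm ζ u u ^ 2 + ν * coercConst C N η * M.symNorm u ^ 2) ≤ M.cellInt g := by
  have huc : ∀ i, ContDiff ℝ 1 (u i) := fun i => contDiff_of_isPoly (hu i)
  have h1 := inviscid_eq hu (fun i p hp x hx => inner_jump_eq_zero huc hdiv hp hx) hπ hζ
  have h2 := mul_le_mul_of_nonneg_left (viscousForm_ge hm hC hreg hN hη hθ hu) hν
  have h3 : (M.cellInt fun i x => π i x * divergence (u i) x) = 0 := by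
    rw [← hmass]
    unfold massForm
    simp_rw [mul_comm]
  rw [← hmom]
  unfold momentumForm
  linarith

end Mesh

/-! ### Absolutely continuous functions of time -/

section absolutelyContinuous

theorem absolutelyContinuous_of_dist_le {X Y : Type*} [PseudoMetricSpace X] [PseudoMetricSpace Y]
    {f : ℝ → X} {g : ℝ → Y} {a b L : ℝ} (hf : AbsolutelyContinuousOnInterval f a b)
    (h : ∀ s ∈ uIcc a b, ∀ t ∈ uIcc a b, dist (g s) (g t) ≤ L * dist (f s) (f t)) :
    AbsolutelyContinuousOnInterval g a b := by
  unfold AbsolutelyContinuousOnInterval at hf ⊢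
  refine squeeze_zero' ?_ ?_ (by simpa using hf.const_mul L)
  · exact Eventually.of_forall fun _ => Finset.sum_nonneg fun _ _ => dist_nonneg
  · rw [eventually_inf_principal]
    filter_upwards with E hE
    rw [Finset.mul_sum]
    exact Finset.sum_le_sum fun i hi => h _ (hE.1 i hi).1 _ (hE.1 i hi).2

theorem absolutelyContinuous_sum {ι : Type*} {s : Finset ι} {f : ι → ℝ → ℝ} {a b : ℝ}
    (hf : ∀ i ∈ s, AbsolutelyContinuousOnInterval (f i) a b) :
    AbsolutelyContinuousOnInterval (fun t => ∑ i ∈ s, f i t) a b := by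
  classical
  induction s using Finset.induction_on with
  | empty =>
    simp only [Finset.sum_empty]
    exact (LipschitzWith.const (0 : ℝ)).lipschitzOnWith.absolutelyContinuousOnInterval
  | insert i s hi ih =>
    simp only [Finset.sum_insert hi]
    exact (hf i (Finset.mem_insert_self i s)).fun_add
      (ih fun j hj => hf j (Finset.mem_insert_of_mem hj))

/-- The square root is not Lipschitz at zero; the shift by `ε` makes it Lipschitz, with constant at
most `1 / √ε`. -/
theorem absolutelyContinuous_sqrt {y : ℝ → ℝ} {a b ε : ℝ} (hε : 0 < ε)
    (hy : AbsolutelyContinuousOnInterval y a b) (hy0 : ∀ t ∈ uIcc a b, 0 ≤ y t) :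
    AbsolutelyContinuousOnInterval (fun t => √(y t + ε)) a b := by
  refine absolutelyContinuous_of_dist_le (L := 1 / √ε) hy fun s hs t ht => ?_
  have hs0 := hy0 s hs
  have ht0 := hy0 t ht
  have h1 : √ε ≤ √(y s + ε) := Real.sqrt_le_sqrt (by linarith)
  have h2 : 0 ≤ √(y t + ε) := Real.sqrt_nonneg _
  have h3 : 0 < √ε := Real.sqrt_pos.mpr hε
  rw [Real.dist_eq, Real.dist_eq, one_div, ← div_eq_inv_mul, le_div_iff₀ h3]
  have h4 : y s - y t = (√(y s + ε) - √(y t + ε)) * (√(y s + ε) + √(y t + ε)) := by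
    have h5 := Real.sq_sqrt (by linarith : 0 ≤ y s + ε)
    have h6 := Real.sq_sqrt (by linarith : 0 ≤ y t + ε)
    linear_combination h6 - h5
  rw [h4, abs_mul, abs_of_nonneg (by linarith : 0 ≤ √(y s + ε) + √(y t + ε))]
  exact mul_le_mul_of_nonneg_left (by linarith) (abs_nonneg _)

variable {y D F : ℝ → ℝ} {a b : ℝ}

/-- A nonnegative function with `y' ≤ 2 F √y` satisfies `√y ≤ √(y a) + ∫ F`. -/
theorem sqrt_le_of_deriv_le (hab : a ≤ b) (hy : AbsolutelyContinuousOnInterval y a b)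
    (hy0 : ∀ t ∈ Icc a b, 0 ≤ y t) (hF : IntervalIntegrable F volume a b) (hF0 : ∀ t, 0 ≤ F t)
    (h : ∀ᵐ t ∂volume.restrict (Ioo a b), 1 / 2 * deriv y t ≤ F t * √(y t)) :
    ∀ t ∈ Icc a b, √(y t) ≤ √(y a) + ∫ s in a..b, F s := by
  intro t ht
  refine le_of_forall_pos_le_add fun δ hδ => ?_
  have hsub : uIcc a t ⊆ uIcc a b := by
    rw [uIcc_of_le ht.1, uIcc_of_le hab]; exact Icc_subset_Icc_right ht.2
  -- The shift is `δ²` because `√(y a + δ²) ≤ √(y a) + δ`, so the regularisation costs only `δ`,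
  -- which is arbitrary.
  have hz := absolutelyContinuous_sqrt (ε := δ ^ 2) (by positivity) hy
    (by rwa [uIcc_of_le hab])
  have hzt := hz.mono hsub
  have h1 : ∫ s in a..t, deriv (fun s => √(y s + δ ^ 2)) s ≤ ∫ s in a..t, F s := by
    refine intervalIntegral.integral_mono_ae_restrict ht.1 hzt.intervalIntegrable_deriv
      (hF.mono_set hsub) ?_
    rw [← restrict_Ioo_eq_restrict_Icc]
    have h2 := ae_restrict_of_ae_restrict_of_subset (Ioo_subset_Ioo_right ht.2) h
    filter_upwards [h2, ae_restrict_of_ae hy.ae_differentiableAt,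
      ae_restrict_mem measurableSet_Ioo] with s hs hd hsm
    have hsI : s ∈ Icc a b := ⟨hsm.1.le, hsm.2.le.trans ht.2⟩
    have hys := hy0 s hsI
    have hpos : 0 < y s + δ ^ 2 := by positivity
    have hder := ((hd (by rwa [uIcc_of_le hab])).hasDerivAt.add_const (δ ^ 2)).sqrt hpos.ne'
    rw [hder.deriv, div_le_iff₀ (by positivity)]
    have h3 : √(y s) ≤ √(y s + δ ^ 2) := Real.sqrt_le_sqrt (by nlinarith)
    nlinarith [mul_le_mul_of_nonneg_left h3 (hF0 s)]
  rw [hzt.integral_deriv_eq_sub] at h1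
  have h2 : ∫ s in a..t, F s ≤ ∫ s in a..b, F s :=
    intervalIntegral.integral_mono_interval le_rfl ht.1 ht.2 (Eventually.of_forall hF0) hF
  have h3 : √(y a + δ ^ 2) ≤ √(y a) + δ := by
    refine Real.sqrt_le_iff.mpr ⟨by positivity, ?_⟩
    nlinarith [Real.sq_sqrt (hy0 a ⟨le_rfl, hab⟩), Real.sqrt_nonneg (y a)]
  have h4 : √(y t) ≤ √(y t + δ ^ 2) := Real.sqrt_le_sqrt (by nlinarith)
  linarith

/-- The energy estimate in abstract form. -/
theorem energy_estimate (hab : a ≤ b) (hy : AbsolutelyContinuousOnInterval y a b)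
    (hy0 : ∀ t ∈ Icc a b, 0 ≤ y t) (hF : IntervalIntegrable F volume a b) (hF0 : ∀ t, 0 ≤ F t)
    (hD : IntervalIntegrable D volume a b) (hD0 : ∀ t, 0 ≤ D t)
    (h : ∀ᵐ t ∂volume.restrict (Ioo a b), 1 / 2 * deriv y t + D t ≤ F t * √(y t)) :
    1 / 2 * y b + ∫ t in a..b, D t ≤ y a + 3 / 2 * (∫ t in a..b, F t) ^ 2 := by
  -- First pass, without the dissipation: a uniform bound on `√y`, to be inserted in the right-hand
  -- side of the second pass.
  have hbound := sqrt_le_of_deriv_le hab hy hy0 hF hF0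
    (h.mono fun t ht => by linarith [hD0 t])
  set B := ∫ t in a..b, F t
  have h1 : ∫ t in a..b, (1 / 2 * deriv y t + D t) ≤ ∫ t in a..b, F t * (√(y a) + B) := by
    refine intervalIntegral.integral_mono_ae_restrict hab
      ((hy.intervalIntegrable_deriv.const_mul _).add hD) (hF.mul_const _) ?_
    rw [← restrict_Ioo_eq_restrict_Icc]
    filter_upwards [h, ae_restrict_mem measurableSet_Ioo] with t ht htm
    exact ht.trans (mul_le_mul_of_nonneg_left (hbound t (Ioo_subset_Icc_self htm)) (hF0 t))
  rw [intervalIntegral.integral_add (hy.intervalIntegrable_deriv.const_mul _) hD,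
    intervalIntegral.integral_const_mul, intervalIntegral.integral_mul_const,
    hy.integral_deriv_eq_sub] at h1
  have h2 := Real.sq_sqrt (hy0 a ⟨le_rfl, hab⟩)
  -- The second pass gives `1/2 y(a) + √(y a) B + B²`; the square splits the mixed term in halves,
  -- whence `1` and `3/2`.
  nlinarith [sq_nonneg (√(y a) - B)]

end absolutelyContinuous

/-! ### Coefficients of piecewise polynomial fields -/

section coefficients

variable {d k : ℕ}

/-- The basis of the polynomial vector fields. -/
def polyVec (q : Fin d × Fin (polyDim d k)) (x : Vec d) : Vec d :=
  polyFun q.2 x • (EuclideanSpace.single q.1 1 : Vec d)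

theorem contDiff_polyVec {n : WithTop ℕ∞} (q : Fin d × Fin (polyDim d k)) :
    ContDiff ℝ n (polyVec q) := (isPoly_polyFun q.2).contDiff.smul contDiff_const

theorem continuous_polyVec (q : Fin d × Fin (polyDim d k)) : Continuous (polyVec q) :=
  (contDiff_polyVec (n := 0) q).continuous

/-- The coefficients of the piecewise polynomial vector fields. -/
abbrev Coeffs (d k : ℕ) (M : Mesh d) := Fin M.numCells → Fin d × Fin (polyDim d k) → ℝ

/-- The piecewise polynomial vector field with given coefficients. -/
def fieldOf {M : Mesh d} (c : Coeffs d k M) : Broken M (Vec d) :=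
  fun i x => ∑ q, c i q • polyVec q x

variable {M : Mesh d}

theorem fieldOf_apply (c : Coeffs d k M) (i : Fin M.numCells) (x : Vec d) (a : Fin d) :
    fieldOf c i x a = polyOf (fun j => c i (a, j)) x := by
  simp only [fieldOf, polyVec, WithLp.ofLp_sum, Finset.sum_apply, PiLp.single_apply,
    Fintype.sum_prod_type, polyOf, smul_eq_mul, WithLp.ofLp_smul,
    Pi.smul_apply]
  rw [Finset.sum_eq_single a (fun b _ hb => by simp [hb.symm]) (by simp)]
  simp

theorem continuous_fieldOf (i : Fin M.numCells) :
    Continuous fun z : Coeffs d k M × Vec d => fieldOf z.1 i z.2 := by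
  refine continuous_finsetSum _ fun q _ => ?_
  have h : Continuous fun z : Coeffs d k M × Vec d => polyVec q z.2 :=
    (continuous_polyVec q).comp continuous_snd
  exact ((continuous_apply q).comp ((continuous_apply i).comp continuous_fst)).smul h

theorem tau_fieldOf (c : Coeffs d k M) (i : Fin M.numCells) (x : Vec d) :
    tau (fieldOf c i) x = ∑ q, c i q • tau (polyVec q) x := by
  have hd : ∀ q : Fin d × Fin (polyDim d k), DifferentiableAt ℝ (polyVec q) x := fun q =>
    ((contDiff_polyVec (n := 1) q).differentiable (by simp)).differentiableAt
  have hf : fderiv ℝ (fieldOf c i) x = ∑ q, c i q • fderiv ℝ (polyVec q) x :=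
    (HasFDerivAt.fun_sum fun q _ => (hd q).hasFDerivAt.const_smul (c i q)).fderiv
  have hg : grad (fieldOf c i) x = ∑ q, c i q • grad (polyVec q) x := by
    ext a b
    simp [grad, hf, Matrix.sum_apply]
  have hdiv : divergence (fieldOf c i) x = ∑ q, c i q * divergence (polyVec q) x := by
    simp [divergence, hg, Matrix.trace_sum, Matrix.trace_smul]
  unfold tau
  rw [hg, hdiv, Matrix.transpose_sum, ← Finset.sum_add_distrib, Finset.mul_sum, Finset.sum_smul,
    ← Finset.sum_sub_distrib]
  refine Finset.sum_congr rfl fun q _ => ?_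
  rw [Matrix.transpose_smul]
  module

/-- A family of piecewise polynomial fields which is absolutely continuous in time at every point
has absolutely continuous coefficients. -/
theorem exists_coeffs {u : ℝ → Broken M (Vec d)} {t0 tn : ℝ}
    (hu : ∀ t ∈ Icc t0 tn, ∀ i a, IsPoly k fun x => u t i x a)
    (hac : ∀ i, ∀ x ∈ (M.cell i).carrier, AbsolutelyContinuousOnInterval (fun t => u t i x) t0 tn) :
    ∃ c : ℝ → Coeffs d k M, (∀ i q, AbsolutelyContinuousOnInterval (fun t => c t i q) t0 tn) ∧
      ∀ t ∈ Icc t0 tn, u t = fieldOf (c t) := by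
  -- The sampling points and weights depend on the element only, not on time, so each coefficient is
  -- a fixed linear combination of absolutely continuous functions.
  choose s α x hx hc using fun (i : Fin M.numCells) (j : Fin (polyDim d k)) =>
    exists_coeff_eq_sum (M.cell i).nonempty_interior j
  refine ⟨fun t i q => ∑ l, α i q.2 l * u t i (x i q.2 l) q.1, fun i q => ?_, fun t ht => ?_⟩
  · refine absolutelyContinuous_sum fun l _ => AbsolutelyContinuousOnInterval.const_mul _ ?_
    refine absolutelyContinuous_of_dist_le (L := 1) (hac i _ (hx i q.2 l)) fun s _ t _ => ?_
    rw [one_mul, dist_eq_norm, dist_eq_norm]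
    exact PiLp.norm_apply_le (u s i (x i q.2 l) - u t i (x i q.2 l)) q.1
  · funext i y
    ext a
    obtain ⟨c', hc'⟩ := exists_polyOf_eq (hu t ht i a)
    rw [fieldOf_apply, congrFun hc' y]
    congr 1
    funext j
    rw [hc i j c']
    exact Finset.sum_congr rfl fun l _ => by rw [← hc']

end coefficients

namespace Mesh

/-! ### Continuity of the norms -/

section continuity

variable {m k : ℕ} {M : Mesh (m + 1)} {X : Type*} [TopologicalSpace X]

theorem continuous_facetInt [FirstCountableTopology X] [LocallyCompactSpace X]
    {g : X → Vec (m + 1) → ℝ} (hg : Continuous (Function.uncurry g)) {i : Fin M.numCells}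
    {p : Vec (m + 1) × ℝ} (hp : p ∈ (M.cell i).halfspaces) :
    Continuous fun c => M.facetInt i p (g c) := by
  have hn := (M.cell i).unit_normal p hp
  have h : ∀ c, M.facetInt i p (g c) =
      ∫ y in chart hn p.2 ⁻¹' (M.cell i).facet p, g c (chart hn p.2 y) := fun c =>
    (M.cell i).integral_facet hn (g c)
  simp_rw [h]
  refine continuous_parametric_integral_of_continuous
    (f := fun c y => g c (chart hn p.2 y)) ?_ ((M.cell i).isCompact_chart_preimage hn)
  exact hg.comp (continuous_fst.prodMk ((isometry_chart hn p.2).continuous.comp continuous_snd))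

theorem continuous_cellInt [FirstCountableTopology X] [LocallyCompactSpace X]
    {g : X → Broken M ℝ} (hg : ∀ i, Continuous fun z : X × Vec (m + 1) => g z.1 i z.2) :
    Continuous fun c => M.cellInt (g c) :=
  continuous_finsetSum _ fun i _ => continuous_parametric_integral_of_continuous
    (f := fun c x => g c i x) (hg i) (M.cell i).isCompact_carrier

theorem continuous_interiorFaceSum {g : X → Fin M.numCells → Vec (m + 1) × ℝ → ℝ}
    (hg : ∀ i, ∀ p ∈ (M.cell i).halfspaces, Continuous fun c => g c i p) :
    Continuous fun c => M.interiorFaceSum (g c) := by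
  refine continuous_finsetSum _ fun i _ => continuous_finsetSum _ fun p hp => ?_
  rcases M.neighbor i p with _ | j
  · exact continuous_const
  · by_cases h : i < j
    · simpa only [if_pos h] using hg i p hp
    · simpa only [if_neg h] using continuous_const

theorem continuous_boundaryFaceSum {g : X → Fin M.numCells → Vec (m + 1) × ℝ → ℝ}
    (hg : ∀ i, ∀ p ∈ (M.cell i).halfspaces, Continuous fun c => g c i p) :
    Continuous fun c => M.boundaryFaceSum (g c) := by
  refine continuous_finsetSum _ fun i _ => continuous_finsetSum _ fun p hp => ?_
  rcases M.neighbor i p with _ | j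
  · exact hg i p hp
  · exact continuous_const

theorem continuous_jump_fieldOf (i : Fin M.numCells) (p : Vec (m + 1) × ℝ) :
    Continuous fun z : Coeffs (m + 1) k M × Vec (m + 1) => jump (fieldOf z.1) i p z.2 := by
  unfold jump
  rcases M.neighbor i p with _ | j
  · exact continuous_fieldOf i
  · exact (continuous_fieldOf i).sub (continuous_fieldOf j)

theorem continuous_avg_fieldOf (i : Fin M.numCells) (p : Vec (m + 1) × ℝ) :
    Continuous fun z : Coeffs (m + 1) k M × Vec (m + 1) => avg (fieldOf z.1) i p z.2 := by
  unfold avg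
  rcases M.neighbor i p with _ | j
  · exact continuous_fieldOf i
  · exact Continuous.const_smul ((continuous_fieldOf i).add (continuous_fieldOf j)) (1 / 2 : ℝ)

theorem continuous_tau_fieldOf (i : Fin M.numCells) :
    Continuous fun z : Coeffs (m + 1) k M × Vec (m + 1) => tau (fieldOf z.1 i) z.2 := by
  simp_rw [tau_fieldOf]
  refine continuous_finsetSum _ fun q _ => ?_
  have h1 : Continuous (tau (polyVec (k := k) q)) := by
    refine continuous_tau (k := k) fun a => ?_
    have h : (fun x => polyVec q x a) = fun x =>
        (EuclideanSpace.single q.1 (1 : ℝ) : Vec (m + 1)) a * polyFun q.2 x :=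
      funext fun x => by simp [polyVec, mul_comm]
    rw [h]
    exact (isPoly_polyFun q.2).const_mul _
  have h2 : Continuous fun z : Coeffs (m + 1) k M × Vec (m + 1) => tau (polyVec q) z.2 :=
    h1.comp continuous_snd
  exact ((continuous_apply q).comp ((continuous_apply i).comp continuous_fst)).smul h2

theorem continuous_symNorm_fieldOf :
    Continuous fun c : Coeffs (m + 1) k M => M.symNorm (fieldOf c) := by
  have hj : ∀ i, ∀ p ∈ (M.cell i).halfspaces, Continuous fun c : Coeffs (m + 1) k M =>
      M.facetInt i p fun x => 1 / M.faceDiam i p * ‖jump (fieldOf c) i p x‖ ^ 2 := fun i p hp =>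
    continuous_facetInt (g := fun (c : Coeffs (m + 1) k M) x =>
      1 / M.faceDiam i p * ‖jump (fieldOf c) i p x‖ ^ 2)
      (continuous_const.mul ((continuous_jump_fieldOf i p).norm.pow 2)) hp
  refine Real.continuous_sqrt.comp ((continuous_cellInt fun i => ?_).add
    ((continuous_interiorFaceSum hj).add (continuous_boundaryFaceSum hj)))
  exact (continuous_tau_fieldOf i).frob (continuous_tau_fieldOf i)

theorem continuous_convSeminorm_fieldOf (ζ : ℝ) :
    Continuous fun c : Coeffs (m + 1) k M => M.convSeminorm ζ (fieldOf c) (fieldOf c) := by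
  refine Real.continuous_sqrt.comp (continuous_const.mul (continuous_interiorFaceSum
    fun i p hp => ?_))
  exact continuous_facetInt (g := fun (c : Coeffs (m + 1) k M) x =>
    |⟪avg (fieldOf c) i p x, p.1⟫| * ‖jump (fieldOf c) i p x‖ ^ 2)
    ((((continuous_avg_fieldOf i p).inner continuous_const).abs).mul
      ((continuous_jump_fieldOf i p).norm.pow 2)) hp

end continuity

/-! ### The kinetic energy -/

section energy

variable {d k : ℕ} {M : Mesh d}

/-- The `L²` product is a bilinear form in the coefficients with a Gram matrix constant in time, so
the energy inherits absolute continuity and the product rule from scalar functions. -/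
theorem cellInt_inner_fieldOf (c c' : Coeffs d k M) :
    (M.cellInt fun i x => ⟪fieldOf c i x, fieldOf c' i x⟫) = ∑ i, ∑ q, ∑ q',
      c i q * c' i q' * ∫ x in (M.cell i).carrier, ⟪polyVec (k := k) q x, polyVec (k := k) q' x⟫ := by
  refine Finset.sum_congr rfl fun i _ => ?_
  have hx : ∀ x, ⟪fieldOf c i x, fieldOf c' i x⟫ =
      ∑ q, ∑ q', c i q * (c' i q' * ⟪polyVec (k := k) q x, polyVec (k := k) q' x⟫) := fun x => by
    simp only [fieldOf]
    rw [sum_inner]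
    refine Finset.sum_congr rfl fun q _ => ?_
    rw [inner_sum]
    refine Finset.sum_congr rfl fun q' _ => ?_
    rw [inner_smul_left, inner_smul_right, conj_trivial]
  have hint : ∀ q q' : Fin d × Fin (polyDim d k), IntegrableOn
      (fun x => c i q * (c' i q' * ⟪polyVec q x, polyVec q' x⟫)) (M.cell i).carrier := fun q q' =>
    (M.cell i).integrableOn_carrier (continuous_const.mul (continuous_const.mul
      ((continuous_polyVec q).inner (continuous_polyVec q')))).continuousOn
  have h1 : ∀ q q' : Fin d × Fin (polyDim d k),
      c i q * c' i q' * (∫ x in (M.cell i).carrier, ⟪polyVec (k := k) q x, polyVec (k := k) q' x⟫) =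
      ∫ x in (M.cell i).carrier, c i q * (c' i q' * ⟪polyVec q x, polyVec q' x⟫) := fun q q' => by
    rw [mul_assoc, integral_const_mul, integral_const_mul]
  simp_rw [h1, hx]
  rw [integral_finsetSum _ fun q _ => integrable_finsetSum _ fun q' _ => hint q q']
  exact Finset.sum_congr rfl fun q _ => integral_finsetSum _ fun q' _ => hint q q'

theorem absolutelyContinuous_energy {c : ℝ → Coeffs d k M} {a b : ℝ}
    (hc : ∀ i q, AbsolutelyContinuousOnInterval (fun t => c t i q) a b) :
    AbsolutelyContinuousOnInterval
      (fun t => M.cellInt fun i x => ⟪fieldOf (c t) i x, fieldOf (c t) i x⟫) a b := by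
  simp_rw [cellInt_inner_fieldOf]
  refine absolutelyContinuous_sum fun i _ => absolutelyContinuous_sum fun q _ =>
    absolutelyContinuous_sum fun q' _ => ?_
  simp_rw [mul_comm _ (∫ x in (M.cell i).carrier, ⟪polyVec (k := k) q x, polyVec (k := k) q' x⟫)]
  exact ((hc i q).fun_mul (hc i q')).const_mul _

theorem hasDerivAt_energy {c : ℝ → Coeffs d k M} {c' : Coeffs d k M} {t : ℝ}
    (hc : ∀ i q, HasDerivAt (fun t => c t i q) (c' i q) t) :
    HasDerivAt (fun t => M.cellInt fun i x => ⟪fieldOf (c t) i x, fieldOf (c t) i x⟫)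
      (2 * M.cellInt fun i x => ⟪fieldOf c' i x, fieldOf (c t) i x⟫) t := by
  have h : HasDerivAt (fun t => M.cellInt fun i x => ⟪fieldOf (c t) i x, fieldOf (c t) i x⟫)
      ((M.cellInt fun i x => ⟪fieldOf c' i x, fieldOf (c t) i x⟫) +
        M.cellInt fun i x => ⟪fieldOf (c t) i x, fieldOf c' i x⟫) t := by
    simp_rw [cellInt_inner_fieldOf, ← Finset.sum_add_distrib, ← add_mul]
    exact HasDerivAt.fun_sum fun i _ => HasDerivAt.fun_sum fun q _ => HasDerivAt.fun_sum
      fun q' _ => ((hc i q).mul (hc i q')).mul_const _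
  convert h using 1
  rw [two_mul]
  simp_rw [real_inner_comm (fieldOf c' _ _)]

theorem hasDerivAt_fieldOf {c : ℝ → Coeffs d k M} {c' : Coeffs d k M} {t : ℝ}
    (hc : ∀ i q, HasDerivAt (fun t => c t i q) (c' i q) t) (i : Fin M.numCells) (x : Vec d) :
    HasDerivAt (fun t => fieldOf (c t) i x) (fieldOf c' i x) t :=
  HasDerivAt.fun_sum fun q _ => (hc i q).smul_const _

/-- The power of the forcing. -/
theorem cellInt_inner_le (f : Lp (Vec d) 2 (volume.restrict M.domain)) {v : Broken M (Vec d)}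
    (hv : ∀ i, Continuous (v i)) (hg : MemLp (M.glue v) 2 (volume.restrict M.domain)) :
    (M.cellInt fun i x => ⟪f x, v i x⟫) ≤ ‖f‖ * √(M.cellInt fun i x => ⟪v i x, v i x⟫) := by
  -- Both sides are recast as inner products and norms in `L²` of the domain, where Cauchy–Schwarz
  -- applies.
  have hae : ∀ i, ∀ᵐ x ∂volume.restrict (M.cell i).openCarrier, hg.toLp _ x = v i x := fun i => by
    filter_upwards [ae_restrict_of_ae_restrict_of_subset (openCarrier_subset_domain i)
      hg.coeFn_toLp, ae_restrict_mem (M.cell i).isOpen_openCarrier.measurableSet] with x hx hxi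
    rw [hx, glue_eq v hxi]
  have h1 : ⟪f, hg.toLp _⟫ = M.cellInt fun i x => ⟪f x, v i x⟫ := by
    refine (L2.inner_def f _).trans (integral_domain_eq
      (fun i => (hae i).mono fun x hx => by rw [hx]) fun i => ?_)
    have h2 : IntegrableOn (fun x => ⟪f x, hg.toLp _ x⟫) (M.cell i).openCarrier :=
      IntegrableOn.mono_set (L2.integrable_inner (𝕜 := ℝ) f (hg.toLp _))
        (openCarrier_subset_domain i)
    have h3 : IntegrableOn (fun x => ⟪f x, v i x⟫) (M.cell i).openCarrier :=
      Integrable.congr h2 ((hae i).mono fun x hx => by beta_reduce; rw [hx])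
    exact h3.congr_set_ae (M.cell i).openCarrier_ae_eq.symm
  have h2 : ⟪hg.toLp _, hg.toLp _⟫ = M.cellInt fun i x => ⟪v i x, v i x⟫ :=
    (L2.inner_def _ _).trans (integral_domain_eq (fun i => (hae i).mono fun x hx => by rw [hx])
      fun i => (M.cell i).integrableOn_carrier ((hv i).inner (hv i)).continuousOn)
  rw [← h1, ← h2, real_inner_self_eq_norm_sq, Real.sqrt_sq (norm_nonneg _)]
  exact real_inner_le_norm _ _

end energy

end Mesh

namespace Mesh

/-! ### The kinetic energy estimate -/

theorem continuous_dissipation {m k : ℕ} {M : Mesh (m + 1)} (ζ C : ℝ) :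
    Continuous fun c : Coeffs (m + 1) k M =>
      M.convSeminorm ζ (fieldOf c) (fieldOf c) ^ 2 + C * M.symNorm (fieldOf c) ^ 2 :=
  ((continuous_convSeminorm_fieldOf ζ).pow 2).add
    (continuous_const.mul (continuous_symNorm_fieldOf.pow 2))

theorem l2Norm_sq {d : ℕ} {M : Mesh d} (v : Broken M (Vec d)) :
    M.l2Norm v ^ 2 = M.cellInt fun i x => ⟪v i x, v i x⟫ := by
  simp_rw [real_inner_self_eq_norm_sq]
  exact Real.sq_sqrt (Finset.sum_nonneg fun i _ => integral_nonneg fun x => sq_nonneg _)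

theorem kinetic_energy_estimate {m k : ℕ} {M : Mesh (m + 1)} (hm : m + 1 = 2 ∨ m + 1 = 3)
    {ρ C : ℝ} (hC : IsTraceConst (m + 1) k ρ C) (hreg : ∀ i, (M.cell i).ShapeRegular ρ) {N : ℕ}
    (hN : ∀ i, (M.cell i).halfspaces.card ≤ N)
    {W : Submodule ℝ (Broken M (Vec (m + 1)))} {Q : Submodule ℝ (Broken M ℝ)}
    (hW : M.IsVelocitySpace k W) (hQ : M.IsPressureSpace Q)
    {η θ ν ζ : ℝ} (hη : 2 * C ^ 2 * N < η) (hν : 0 ≤ ν) (hζ : 0 ≤ ζ) (hθ : θ = 0 ∨ θ = 1)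
    {t0 tn : ℝ} (ht : t0 ≤ tn) {f : ℝ → Lp (Vec (m + 1)) 2 (volume.restrict M.domain)}
    (hf : IntervalIntegrable f volume t0 tn)
    {u : ℝ → Broken M (Vec (m + 1))} {π : ℝ → Broken M ℝ}
    (hsol : M.IsSolution W Q ν ζ η θ t0 tn f u π) :
    IntervalIntegrable
        (fun s => M.convSeminorm ζ (u s) (u s) ^ 2 + ν * coercConst C N η * M.symNorm (u s) ^ 2)
        volume t0 tn ∧
      1 / 2 * M.l2Norm (u tn) ^ 2 +
          ∫ s in t0..tn,
            (M.convSeminorm ζ (u s) (u s) ^ 2 + ν * coercConst C N η * M.symNorm (u s) ^ 2) ≤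
        M.l2Norm (u t0) ^ 2 + 3 / 2 * (∫ s in t0..tn, ‖f s‖) ^ 2 := by
  have hpoly : ∀ t ∈ Icc t0 tn, ∀ i a, IsPoly k fun x => u t i x a := fun t h =>
    (hW _ (hsol.velocity_mem t h)).1
  obtain ⟨c, hc, huc⟩ := exists_coeffs hpoly hsol.absolutelyContinuous
  have hccont : ContinuousOn c (Icc t0 tn) := by
    rw [← uIcc_of_le ht]
    exact continuousOn_pi.mpr fun i => continuousOn_pi.mpr fun q => (hc i q).continuousOn
  have hD : IntervalIntegrable
      (fun s => M.convSeminorm ζ (u s) (u s) ^ 2 + ν * coercConst C N η * M.symNorm (u s) ^ 2)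
      volume t0 tn := by
    -- The dissipation is a continuous function of the coefficients, which are continuous in time.
    refine ContinuousOn.intervalIntegrable ?_
    rw [uIcc_of_le ht]
    refine ((continuous_dissipation ζ (ν * coercConst C N η)).comp_continuousOn
      hccont).congr fun s hs => ?_
    rw [huc s hs]
    rfl
  refine ⟨hD, ?_⟩
  rw [l2Norm_sq, l2Norm_sq, huc t0 ⟨le_rfl, ht⟩, huc tn ⟨ht, le_rfl⟩]
  refine energy_estimate
    (y := fun t => M.cellInt fun i x => ⟪fieldOf (c t) i x, fieldOf (c t) i x⟫) ht
    (absolutelyContinuous_energy hc) (fun t _ => ?_) hf.norm (fun t => norm_nonneg _) hD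
    (fun t => ?_) ?_
  · exact Finset.sum_nonneg fun i _ => integral_nonneg fun x => real_inner_self_nonneg
  · exact add_nonneg (sq_nonneg _)
      (mul_nonneg (mul_nonneg hν (coercConst_pos hη).le) (sq_nonneg _))
  · have hdiff : ∀ᵐ t ∂volume.restrict (Ioo t0 tn), ∀ i q,
        DifferentiableAt ℝ (fun t => c t i q) t := by
      rw [ae_restrict_iff' measurableSet_Ioo]
      have h1 := fun i q => (hc i q).ae_differentiableAt
      simp_rw [uIcc_of_le ht] at h1
      filter_upwards [ae_all_iff.mpr fun i => ae_all_iff.mpr (h1 i)] with t h2 htI i q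
      exact h2 i q (Ioo_subset_Icc_self htI)
    filter_upwards [hdiff, hsol.pressure_mem, hsol.mass, hsol.momentum,
      ae_restrict_mem measurableSet_Ioo] with t hd hp hmass hmom htI
    have htc := Ioo_subset_Icc_self htI
    have hmem := hsol.velocity_mem t htc
    have hder : ∀ i q, HasDerivAt (fun t => c t i q) (deriv (fun t => c t i q) t) t :=
      fun i q => (hd i q).hasDerivAt
    -- The pointwise time derivative is the field of the differentiated coefficients. The open
    -- interval matters: the representation by coefficients holds on `[t0, tn]` only, and the
    -- derivative needs a neighbourhood of `t`.
    have hut : (fun i x => deriv (fun s => u s i x) t) =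
        fieldOf (M := M) fun i q => deriv (fun t => c t i q) t := by
      funext i x
      refine ((hasDerivAt_fieldOf hder i x).congr_of_eventuallyEq ?_).deriv
      filter_upwards [isOpen_Ioo.mem_nhds htI] with s hs
      rw [huc s (Ioo_subset_Icc_self hs)]
    have h1 := energy_inequality hm hC hreg hN hη hθ hν hζ (hpoly t htc) (hW _ hmem).2
      (hQ _ hp).1 (hmass _ hp) (hmom _ hmem)
    have h2 := cellInt_inner_le (f t)
      (fun i => (contDiff_of_isPoly (n := 0) (hpoly t htc i)).continuous) (hW _ hmem).2.1
    simp_rw [fun i x => congrFun (congrFun hut i) x] at h1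
    rw [(hasDerivAt_energy hder).deriv, ← huc t htc]
    linarith

end Mesh

end MixedNS

end

theorem mainTheorem5 (d k : ℕ) (hd : d = 2 ∨ d = 3) (ρ : ℝ) (hρ : 0 < ρ) :
    (∃ Ctr : ℝ, IsTraceConst d k ρ Ctr) ∧
    ∀ Ctr : ℝ, IsTraceConst d k ρ Ctr → ∀ (N : ℕ) (η : ℝ), 2 * Ctr ^ 2 * N < η →
      0 < coercConst Ctr N η ∧
      ∀ (M : Mesh d), (∀ i, (M.cell i).ShapeRegular ρ) →
        (∀ i, (M.cell i).halfspaces.card ≤ N) →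
      ∀ (W : Submodule ℝ (Broken M (Vec d))) (Q : Submodule ℝ (Broken M ℝ)),
        M.IsVelocitySpace k W → M.IsPressureSpace Q →
      ∀ (ν ζ θ : ℝ), 0 ≤ ν → 0 ≤ ζ → (θ = 0 ∨ θ = 1) →
      ∀ (t0 tn : ℝ), t0 ≤ tn →
      ∀ (f : ℝ → Lp (Vec d) 2 (volume.restrict M.domain)), IntervalIntegrable f volume t0 tn →
      ∀ (u : ℝ → Broken M (Vec d)) (π : ℝ → Broken M ℝ),
        M.IsSolution W Q ν ζ η θ t0 tn f u π →
      IntervalIntegrable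
        (fun s => M.convSeminorm ζ (u s) (u s) ^ 2 + ν * coercConst Ctr N η * M.symNorm (u s) ^ 2)
        volume t0 tn ∧
      1 / 2 * M.l2Norm (u tn) ^ 2 +
          ∫ s in t0..tn,
            (M.convSeminorm ζ (u s) (u s) ^ 2 + ν * coercConst Ctr N η * M.symNorm (u s) ^ 2) ≤
        M.l2Norm (u t0) ^ 2 + 3 / 2 * (∫ s in t0..tn, ‖f s‖) ^ 2 := by
  -- Writing `d = m + 1` turns the dimension `d - 1` of the surface measure into `m`, the dimension
  -- of the charts.
  obtain ⟨m, rfl⟩ : ∃ m, d = m + 1 := ⟨d - 1, by omega⟩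
  exact ⟨exists_isTraceConst k hρ, fun Ctr hC N η hη => ⟨coercConst_pos hη,
    fun M hreg hN W Q hW hQ ν ζ θ hν hζ hθ t0 tn ht f hf u π hsol =>
      Mesh.kinetic_energy_estimate hd hC hreg hN hW hQ hη hν hζ hθ ht hf hsol⟩⟩
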